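/- **Setting.** Let $M$ be a smooth (Hausdorff) manifold of dimension $2m+1$ with a pseudo-Hermitian structure: a $1$-form $\theta$, a smooth complex structure $J$ on the horizontal bundle $H=\ker\theta$, integrable in the sense that the sections of $H^{1,0}=\{X-iJX : X\in H\}$ are closed under the Lie bracket, such that the Levi form $d\theta(X,JY)$ is positive definite on $H$. Here $2\,d\theta(U,V)=U\theta(V)-V\theta(U)-\theta([U,V])$. Let $\xi$ be the Reeb field ($\theta(\xi)=1$, $d\theta(\xi,\cdot)=0$), extend $J$ by $J\xi=0$, let $\pi_H$ be the projection onto $H$ along $\xi$, and let $\langle U,V\rangle=\theta(U)\theta(V)+d\theta(\pi_HU,J\pi_HV)$ be the Webster metric. Let $\nabla$ be the Tanaka–Webster connection, that is, the unique smooth linear connection that preserves $H$, satisfies $\nabla\langle\cdot,\cdot\rangle=0$ and $\nabla J=0$, and whose torsion $T$ satisfies $T(X,Y)=2\,d\theta(X,Y)\xi$ and $T(\xi,JX)+JT(\xi,X)=0$ for $X,Y\in H$. Let $R(U,V)W=\nabla_U\nabla_VW-\nabla_V\nabla_UW-\nabla_{[U,V]}W$ be its curvature. Assume that $M$ is Sasakian,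 i.e. $T(\xi,\cdot)=0$. Let $l>0$ and let $\gamma:[0,l]\to M$ be a $\nabla$-geodesic ($\nabla_{\gamma'}\gamma'=0$) parametrized by arc length. A vector field $V$ along $\gamma$ is a *Jacobi field* if $\nabla_{\gamma'}\nabla_{\gamma'}V=R(\gamma',V)\gamma'+\nabla_{\gamma'}\big(T(\gamma',V)\big)$. For $t\in(0,l]$, $\gamma(t)$ is *conjugate* to $\gamma(0)$ along $\gamma$ if the differential of the exponential map $\exp^\nabla_{\gamma(0)}$ of $\nabla$ is singular at $t\gamma'(0)$. For a (continuous) piecewise $C^1$ vector field $X$ along $\gamma$ put $$I(X)=\int_0^l\big(\langle\nabla_{\gamma'}X,\nabla_{\gamma'}X\rangle-\langle R(X,\gamma')\gamma',X\rangle\big)\,dt .$$ **Theorem.** Suppose that no point $\gamma(t)$, $0<t\le l$, is conjugate to $\gamma(0)$ along $\gamma$. Let $Y$ be a horizontal Jacobi field along $\gamma$ (that is, $\theta(Y)=0$ on $[0,l]$) with $Y(0)=0$, and let $X$ be a piecewise $C^1$ vector field along $\gamma$ with $X(0)=0$ and $X(l)=Y(l)$. Then $$I(X)\ge I(Y),$$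 with equality if and only if $X=Y$ on $[0,l]$. -/

import Mathlib

open Set Bundle
open scoped Manifold ContDiff

noncomputable section

section Connection

variable {E : Type*} [NormedAddCommGroup E] [NormedSpace ℝ E]
  {M : Type*} [TopologicalSpace M] [ChartedSpace E M] [IsManifold 𝓘(ℝ, E) ∞ M]

/-- A linear connection on (the tangent bundle of) the manifold `M`. The covariant derivative
`∇_u Y` of a vector field `Y` in the direction `u ∈ T_x M` is written `D Y x u`. -/
abbrev LinearConnection (E : Type*) [NormedAddCommGroup E] [NormedSpace ℝ E]
    (M : Type*) [TopologicalSpace M] [ChartedSpace E M] [IsManifold 𝓘(ℝ, E) ∞ M] : Type _ :=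
  CovariantDerivative 𝓘(ℝ, E) E (fun x : M => TangentSpace 𝓘(ℝ, E) x)

/-- The vector field `X` on `M` is smooth. -/
def IsSmoothField (X : ∀ x : M, TangentSpace 𝓘(ℝ, E) x) : Prop :=
  ContMDiff 𝓘(ℝ, E) (𝓘(ℝ, E).prod 𝓘(ℝ, E)) ∞
    (fun x => (⟨x, X x⟩ : TangentBundle 𝓘(ℝ, E) M))

/-- The vector field `X` on `M` is differentiable at the point `x`. -/
def IsDifferentiableFieldAt (X : ∀ x : M, TangentSpace 𝓘(ℝ, E) x) (x : M) : Prop :=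
  MDifferentiableAt 𝓘(ℝ, E) (𝓘(ℝ, E).prod 𝓘(ℝ, E))
    (fun y => (⟨y, X y⟩ : TangentBundle 𝓘(ℝ, E) M)) x

/-- The exterior derivative of a one-form `θ`, with the convention
`2 dθ(U, V) = U (θ V) - V (θ U) - θ [U, V]`. The right hand side is tensorial in `U` and `V`, so
that it may be computed with any local extensions of the vectors `u`, `v` at `x`. -/
def extDerivOneForm (θ : ∀ x : M, TangentSpace 𝓘(ℝ, E) x →L[ℝ] ℝ) (x : M)
    (u v : TangentSpace 𝓘(ℝ, E) x) : ℝ :=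
  (1 / 2 : ℝ) *
    (mvfderiv 𝓘(ℝ, E) (fun y => θ y (FiberBundle.extend E v y)) x u
      - mvfderiv 𝓘(ℝ, E) (fun y => θ y (FiberBundle.extend E u y)) x v
      - θ x (VectorField.mlieBracket 𝓘(ℝ, E)
          (FiberBundle.extend E u) (FiberBundle.extend E v) x))

/-- The curvature tensor `R(U, V)W = ∇_U ∇_V W - ∇_V ∇_U W - ∇_[U, V] W` at the point `x`.
The right hand side is tensorial in `U`, `V`, `W`, so that it may be computed with any smooth local
extensions of the vectors `u`, `v`, `w` at `x`. -/
def curvatureTensor (D : LinearConnection E M) (x : M) (u v w : TangentSpace 𝓘(ℝ, E) x) :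
    TangentSpace 𝓘(ℝ, E) x :=
  D (fun y => D (FiberBundle.extend E w) y (FiberBundle.extend E v y)) x u
    - D (fun y => D (FiberBundle.extend E w) y (FiberBundle.extend E u y)) x v
    - D (FiberBundle.extend E w) x
        (VectorField.mlieBracket 𝓘(ℝ, E) (FiberBundle.extend E u) (FiberBundle.extend E v) x)

/-- The velocity `γ'(t)` of a curve defined on the set of times `S` (one-sided at the end points
of an interval). -/
def velocity (γ : ℝ → M) (S : Set ℝ) (t : ℝ) : TangentSpace 𝓘(ℝ, E) (γ t) :=
  mfderivWithin 𝓘(ℝ, ℝ) 𝓘(ℝ, E) γ S t (1 : ℝ)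

/-- The vector field `X` along the curve `γ` is of class `C^n` on the set of times `S`. -/
def IsContDiffFieldAlong (n : ℕ∞ω) (γ : ℝ → M) (S : Set ℝ)
    (X : ∀ t, TangentSpace 𝓘(ℝ, E) (γ t)) : Prop :=
  ContMDiffOn 𝓘(ℝ, ℝ) (𝓘(ℝ, E).prod 𝓘(ℝ, E)) n
    (fun t => (⟨γ t, X t⟩ : TangentBundle 𝓘(ℝ, E) M)) S

/-- The covariant derivative `∇_{γ'} X` at time `t` of a vector field `X` along the curve `γ`.
In the local frame `(e_i)` of the preferred chart at `γ t`, in which `X = ∑ X^i e_i`, it is the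
usual expression `∑ (X^i)'(t) e_i + ∑ X^i(t) ∇_{γ'(t)} e_i`. -/
def covDerivAlong (D : LinearConnection E M) (γ : ℝ → M) (S : Set ℝ)
    (X : ∀ t, TangentSpace 𝓘(ℝ, E) (γ t)) (t : ℝ) : TangentSpace 𝓘(ℝ, E) (γ t) :=
  (trivializationAt E (fun x : M => TangentSpace 𝓘(ℝ, E) x) (γ t)).symm (γ t)
      (derivWithin
        (fun s => (trivializationAt E (fun x : M => TangentSpace 𝓘(ℝ, E) x) (γ t)
          (⟨γ s, X s⟩ : TangentBundle 𝓘(ℝ, E) M)).2) S t)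
    + D (FiberBundle.extend E (X t)) (γ t) (velocity γ S t)

/-- `γ` is a geodesic of the connection on the interval `S`: it satisfies `∇_{γ'} γ' = 0`.
(A `C^2` solution of this equation is automatically smooth.) -/
structure IsGeodesicOn (D : LinearConnection E M) (γ : ℝ → M) (S : Set ℝ) : Prop where
  contMDiffOn : ContMDiffOn 𝓘(ℝ, ℝ) 𝓘(ℝ, E) 2 γ S
  geodesic_eq : ∀ t ∈ S, covDerivAlong D γ S (fun s => velocity γ S s) t = 0

open Classical in
/-- The exponential map `T_p M → M` of the connection: `exp_p u = c 1`, where `c` is the geodesic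
with `c 0 = p` and `c' 0 = u`, whenever that geodesic exists up to time `1` (and the irrelevant
value `p` elsewhere). The tangent space `T_p M` is the normed space `E`, as everywhere in
Mathlib. -/
def expMap (D : LinearConnection E M) (p : M) (u : E) : M :=
  if h : ∃ c : ℝ → M, IsGeodesicOn D c (Icc 0 1) ∧
      (⟨c 0, velocity c (Icc 0 1) 0⟩ : TangentBundle 𝓘(ℝ, E) M) = ⟨p, u⟩
  then h.choose 1 else p

/-- `γ t` is conjugate to `γ 0` along the geodesic `γ : [0, l] → M`: the differential of the
exponential map at `γ 0` is singular at the vector `t γ'(0)`. -/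
def IsConjugateAlong (D : LinearConnection E M) (γ : ℝ → M) (l t : ℝ) : Prop :=
  ¬ Function.Injective
    (mfderiv 𝓘(ℝ, E) 𝓘(ℝ, E) (expMap D (γ 0)) (t • (velocity γ (Icc 0 l) 0 : E)))

/-- `X` is a (continuous) piecewise `C^1` vector field along `γ : [0, l] → M`: for a suitable
subdivision `0 = a_0 < a_1 < ⋯ < a_n = l` it is of class `C^1` on each closed interval
`[a_i, a_{i+1}]`. -/
def IsPiecewiseC1Along (γ : ℝ → M) (l : ℝ) (X : ∀ t, TangentSpace 𝓘(ℝ, E) (γ t)) : Prop :=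
  ∃ (n : ℕ) (a : Fin (n + 1) → ℝ), StrictMono a ∧ a 0 = 0 ∧ a (Fin.last n) = l ∧
    ∀ i : Fin n, IsContDiffFieldAlong 1 γ (Icc (a i.castSucc) (a i.succ)) X

variable [FiniteDimensional ℝ E]

/-- `V` is a Jacobi field along the geodesic `γ : [0, l] → M` of a connection with torsion `T` and
curvature `R`: it satisfies `∇_{γ'} ∇_{γ'} V = R(γ', V)γ' + ∇_{γ'} (T(γ', V))` on `[0, l]`. -/
structure IsJacobiField (D : LinearConnection E M) (γ : ℝ → M) (l : ℝ)
    (V : ∀ t, TangentSpace 𝓘(ℝ, E) (γ t)) : Prop where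
  contDiff : IsContDiffFieldAlong 2 γ (Icc 0 l) V
  jacobi_eq : ∀ t ∈ Icc 0 l,
    covDerivAlong D γ (Icc 0 l) (fun s => covDerivAlong D γ (Icc 0 l) V s) t =
      curvatureTensor D (γ t) (velocity γ (Icc 0 l) t) (V t) (velocity γ (Icc 0 l) t)
      + covDerivAlong D γ (Icc 0 l)
          (fun s => D.torsion (γ s) (velocity γ (Icc 0 l) s) (V s)) t

end Connection

/-- A pseudo-Hermitian structure on a smooth manifold `M` of dimension `2m+1`: a contact form `θ`
with horizontal bundle `H = ker θ`, an integrable complex structure `J` on `H` (extended by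
`J ξ = 0`) whose Levi form `L(X, Y) = dθ(X, JY)` is positive definite on `H`, together with the
Reeb field `ξ`, the unique field with `θ(ξ) = 1` and `dθ(ξ, ·) = 0`. The complex bundle
`H^{1,0}` of the CR structure is `{X - i JX | X ∈ H}`, and `integrable` says that its sections
are closed under the Lie bracket. -/
structure PseudoHermitianStructure (m : ℕ) (M : Type*) [TopologicalSpace M]
    [ChartedSpace (EuclideanSpace ℝ (Fin (2 * m + 1))) M] [IsManifold (𝓡 (2 * m + 1)) ∞ M] where
  θ : ∀ x : M, TangentSpace (𝓡 (2 * m + 1)) x →L[ℝ] ℝ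
  J : ∀ x : M, TangentSpace (𝓡 (2 * m + 1)) x →L[ℝ] TangentSpace (𝓡 (2 * m + 1)) x
  ξ : ∀ x : M, TangentSpace (𝓡 (2 * m + 1)) x
  θ_smooth : ContMDiff (𝓡 (2 * m + 1))
    ((𝓡 (2 * m + 1)).prod 𝓘(ℝ, EuclideanSpace ℝ (Fin (2 * m + 1)) →L[ℝ] ℝ)) ∞
    (fun x => (⟨x, θ x⟩ : TotalSpace (EuclideanSpace ℝ (Fin (2 * m + 1)) →L[ℝ] ℝ)
      (fun x : M => TangentSpace (𝓡 (2 * m + 1)) x →L[ℝ] Bundle.Trivial M ℝ x)))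
  J_smooth : ContMDiff (𝓡 (2 * m + 1))
    ((𝓡 (2 * m + 1)).prod 𝓘(ℝ, EuclideanSpace ℝ (Fin (2 * m + 1)) →L[ℝ]
      EuclideanSpace ℝ (Fin (2 * m + 1)))) ∞
    (fun x => (⟨x, J x⟩ : TotalSpace (EuclideanSpace ℝ (Fin (2 * m + 1)) →L[ℝ]
        EuclideanSpace ℝ (Fin (2 * m + 1)))
      (fun x : M => TangentSpace (𝓡 (2 * m + 1)) x →L[ℝ] TangentSpace (𝓡 (2 * m + 1)) x)))
  ξ_smooth : IsSmoothField ξ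
  θ_ξ : ∀ x, θ x (ξ x) = 1
  dθ_ξ : ∀ x v, extDerivOneForm θ x (ξ x) v = 0
  J_ξ : ∀ x, J x (ξ x) = 0
  J_horizontal : ∀ x v, θ x (J x v) = 0
  J_sq : ∀ x v, θ x v = 0 → J x (J x v) = -v
  integrable : ∀ X Y : (∀ x : M, TangentSpace (𝓡 (2 * m + 1)) x),
    IsSmoothField X → IsSmoothField Y → (∀ x, θ x (X x) = 0) → (∀ x, θ x (Y x) = 0) → ∀ x,
      θ x (VectorField.mlieBracket (𝓡 (2 * m + 1)) X Y x
        - VectorField.mlieBracket (𝓡 (2 * m + 1)) (fun y => J y (X y)) (fun y => J y (Y y)) x) = 0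
      ∧ VectorField.mlieBracket (𝓡 (2 * m + 1)) (fun y => J y (X y)) Y x
          + VectorField.mlieBracket (𝓡 (2 * m + 1)) X (fun y => J y (Y y)) x
        = J x (VectorField.mlieBracket (𝓡 (2 * m + 1)) X Y x
            - VectorField.mlieBracket (𝓡 (2 * m + 1))
                (fun y => J y (X y)) (fun y => J y (Y y)) x)
  levi_pos : ∀ x v, θ x v = 0 → v ≠ 0 → 0 < extDerivOneForm θ x v (J x v)

namespace PseudoHermitianStructure

variable {m : ℕ} {M : Type*} [TopologicalSpace M]
  [ChartedSpace (EuclideanSpace ℝ (Fin (2 * m + 1))) M] [IsManifold (𝓡 (2 * m + 1)) ∞ M]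
  (P : PseudoHermitianStructure m M)

/-- The horizontal projection `π_H : TM → H`. -/
def horizontalPart (x : M) (v : TangentSpace (𝓡 (2 * m + 1)) x) :
    TangentSpace (𝓡 (2 * m + 1)) x :=
  v - P.θ x v • P.ξ x

/-- The Webster metric `⟨u, v⟩ = θ(u) θ(v) + dθ(π_H u, J π_H v)`. -/
def websterMetric (x : M) (u v : TangentSpace (𝓡 (2 * m + 1)) x) : ℝ :=
  P.θ x u * P.θ x v
    + extDerivOneForm P.θ x (P.horizontalPart x u) (P.J x (P.horizontalPart x v))

/-- `D` is the Tanaka–Webster connection of the pseudo-Hermitian structure: the unique smooth linear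
connection that preserves `H`, makes the Webster metric and `J` parallel, and has pure torsion,
that is `T(X, Y) = 2 dθ(X, Y) ξ` and `T(ξ, JX) + J T(ξ, X) = 0` for horizontal `X`, `Y`. -/
structure IsTanakaWebster (D : LinearConnection (EuclideanSpace ℝ (Fin (2 * m + 1))) M) :
    Prop where
  smooth : D.ContMDiffCovariantDerivative ∞
  preserves_horizontal : ∀ (Y : ∀ x : M, TangentSpace (𝓡 (2 * m + 1)) x) (x : M),
    IsDifferentiableFieldAt Y x → (∀ y, P.θ y (Y y) = 0) → ∀ u, P.θ x (D Y x u) = 0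
  metric_parallel : ∀ (Y Z : ∀ x : M, TangentSpace (𝓡 (2 * m + 1)) x) (x : M),
    IsDifferentiableFieldAt Y x → IsDifferentiableFieldAt Z x → ∀ u,
      mvfderiv (𝓡 (2 * m + 1)) (fun y => P.websterMetric y (Y y) (Z y)) x u
        = P.websterMetric x (D Y x u) (Z x) + P.websterMetric x (Y x) (D Z x u)
  J_parallel : ∀ (Y : ∀ x : M, TangentSpace (𝓡 (2 * m + 1)) x) (x : M),
    IsDifferentiableFieldAt Y x → ∀ u, D (fun y => P.J y (Y y)) x u = P.J x (D Y x u)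
  torsion_horizontal : ∀ x u v, P.θ x u = 0 → P.θ x v = 0 →
    D.torsion x u v = (2 * extDerivOneForm P.θ x u v) • P.ξ x
  torsion_reeb : ∀ x u, P.θ x u = 0 →
    D.torsion x (P.ξ x) (P.J x u) + P.J x (D.torsion x (P.ξ x) u) = 0

/-- The pseudo-Hermitian manifold, with Tanaka–Webster connection `D`, is Sasakian: its
pseudo-Hermitian torsion `τ = T(ξ, ·)` vanishes. -/
def IsSasakian (D : LinearConnection (EuclideanSpace ℝ (Fin (2 * m + 1))) M) : Prop :=
  ∀ x v, D.torsion x (P.ξ x) v = 0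

/-- The index form `I(X) = ∫_0^l ⟨∇_{γ'} X, ∇_{γ'} X⟩ - ⟨R(X, γ')γ', X⟩ dt`. The derivative of a
piecewise `C^1` field exists except at finitely many times. -/
def indexForm (D : LinearConnection (EuclideanSpace ℝ (Fin (2 * m + 1))) M) (γ : ℝ → M) (l : ℝ)
    (X : ∀ t, TangentSpace (𝓡 (2 * m + 1)) (γ t)) : ℝ :=
  ∫ t in (0 : ℝ)..l,
    (P.websterMetric (γ t) (covDerivAlong D γ (Icc 0 l) X t) (covDerivAlong D γ (Icc 0 l) X t)
      - P.websterMetric (γ t)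
          (curvatureTensor D (γ t) (X t) (velocity γ (Icc 0 l) t) (velocity γ (Icc 0 l) t)) (X t))

end PseudoHermitianStructure

end

/-! On a Sasakian manifold the Tanaka–Webster connection behaves, for the purposes of the index
form, like a Levi-Civita connection. Its torsion is `T(u, v) = -2⟨u, Jv⟩ξ`
(`torsion_eq_websterMetric`), an expression in the parallel tensors `⟨·,·⟩`, `J`, `ξ`. Hence `∇T =
0`, and since `T(ξ, ·) = 0` also `T(T(·,·),·) = 0`. The first Bianchi identity therefore has no
torsion terms, and the curvature has the pair symmetry of Riemannian geometry; moreover `R(·,·)ξ =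
0`, `R(ξ, v)v = 0` and `R(·,·)·` is horizontal. These identities are proved in coordinates for
`IsSasakianModel` and transferred by `isSasakianModel`.

In a parallel orthonormal frame along `γ`, the operator `v ↦ R(v, γ')γ'` becomes a continuous family
`K(t)` of symmetric matrices, and the index form becomes the integral of `|x'|² - ⟨Kx, x⟩`. For a
horizontal Jacobi field `Y` the `ξ`-component of the Jacobi equation says that `∇(T(γ', Y))`
vanishes; what remains is `y'' = -Ky` (`hasDerivWithinAt_of_isJacobiField`).

Let `A` be the matrix solution of `A'' = -KA`, `A(0) = 0`, `A'(0) = 1`, and suppose `A(t)` is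
invertible for `0 < t ≤ l`. With `x - y = Ac`, symmetry of the Wronskian of `A` and integration by
parts give `I(x) - I(y) = ∫ |A c'|²`. This is nonnegative, and it vanishes only if `c` is constant,
hence zero because `x` and `y` agree at `l`. The argument is `index_comparison`; the delicate point
is the boundary term at `0`, where `A` degenerates.

Invertibility of `A` is where the absence of conjugate points enters. A vector `v` in the kernel of
`A(t)` gives a field `Z` with `Z'' = R(γ', Z)γ'` vanishing at `0` and at `t`. It is not yet a Jacobi
field of a connection with torsion, but adding a suitable multiple of `ξ`, obtained by integrating
the coefficient of `T(γ', Z)` and subtracting a linear function, makes it one without losing the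
zeros (`isConjugateAlong_of_frame_solution`). A Jacobi field vanishing at `0` is the variation field
of a variation by geodesics from `γ 0` (`exists_isVariation`), by differentiable dependence of the
geodesic equation on initial values. Its zero at `t` puts a nonzero vector in the kernel of the
differential of the exponential map (`IsGeodesicOn.isConjugateAlong`). -/

noncomputable section

open Filter Topology

/-! ### Vector fields and differentials in a chart -/

section Coordinates

set_option linter.unusedSectionVars false

variable {E : Type*} [NormedAddCommGroup E] [NormedSpace ℝ E]
  {M : Type*} [TopologicalSpace M] [ChartedSpace E M] [IsManifold 𝓘(ℝ, E) ∞ M]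

/-- The coordinates in the chart at `x₀` of tangent vectors at `y`. -/
def chartCoord (x₀ y : M) : TangentSpace 𝓘(ℝ, E) y →L[ℝ] E :=
  (trivializationAt E (TangentSpace 𝓘(ℝ, E)) x₀).continuousLinearMapAt ℝ y

/-- The vector field with constant coordinates `b` in the chart at `x₀`. -/
def coordField (x₀ : M) (b : E) (y : M) : TangentSpace 𝓘(ℝ, E) y :=
  (trivializationAt E (TangentSpace 𝓘(ℝ, E)) x₀).symmL ℝ y b

/-- The representation of a vector field in the chart at `x₀`. -/
def fieldRep (x₀ : M) (Z : ∀ y : M, TangentSpace 𝓘(ℝ, E) y) (q : E) : E :=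
  chartCoord x₀ ((extChartAt 𝓘(ℝ, E) x₀).symm q) (Z ((extChartAt 𝓘(ℝ, E) x₀).symm q))

lemma coordField_sum_smul {ι : Type*} (s : Finset ι) (x₀ : M) (r : ι → ℝ) (b : ι → E) (y : M) :
    coordField x₀ (∑ i ∈ s, r i • b i) y = ∑ i ∈ s, r i • coordField x₀ (b i) y := by
  simp only [coordField, map_sum, map_smul]

lemma fieldRep_extChartAt {x₀ y : M} (hy : y ∈ (chartAt E x₀).source)
    (Z : ∀ y : M, TangentSpace 𝓘(ℝ, E) y) :
    fieldRep x₀ Z (extChartAt 𝓘(ℝ, E) x₀ y) = chartCoord x₀ y (Z y) := by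
  have h : ∀ z, z = y → chartCoord x₀ z (Z z) = chartCoord x₀ y (Z y) := by rintro z rfl; rfl
  exact h _ ((extChartAt 𝓘(ℝ, E) x₀).left_inv (by simpa using hy))

lemma chartCoord_coordField {x₀ y : M} (hy : y ∈ (chartAt E x₀).source) (b : E) :
    chartCoord x₀ y (coordField x₀ b y) = b :=
  Trivialization.continuousLinearMapAt_symmL _ (by simpa using hy) b

lemma coordField_chartCoord {x₀ y : M} (hy : y ∈ (chartAt E x₀).source)
    (v : TangentSpace 𝓘(ℝ, E) y) : coordField x₀ (chartCoord x₀ y v) y = v :=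
  Trivialization.symmL_continuousLinearMapAt _ (by simpa using hy) v

lemma chartCoord_injective {x₀ y : M} (hy : y ∈ (chartAt E x₀).source) :
    Function.Injective (chartCoord (E := E) x₀ y) :=
  Function.LeftInverse.injective (g := fun b => coordField x₀ b y) (coordField_chartCoord hy)

lemma trivializationAt_snd_eq_chartCoord {x₀ y : M} (hy : y ∈ (chartAt E x₀).source)
    (v : TangentSpace 𝓘(ℝ, E) y) :
    (trivializationAt E (TangentSpace 𝓘(ℝ, E)) x₀ (⟨y, v⟩ : TangentBundle 𝓘(ℝ, E) M)).2
      = chartCoord x₀ y v := by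
  rw [chartCoord, Trivialization.continuousLinearMapAt_apply,
    Trivialization.coe_linearMapAt_of_mem _ (by simpa using hy)]

lemma extend_eq_coordField {x y : M} (hy : y ∈ (chartAt E x).source)
    (v : TangentSpace 𝓘(ℝ, E) x) : FiberBundle.extend E v y = coordField x (chartCoord x x v) y := by
  simp only [FiberBundle.extend, coordField]
  rw [trivializationAt_snd_eq_chartCoord (by simp)]
  exact (Trivialization.symmL_apply _ (by simpa using hy) _).symm

/-- The tangent bundle is trivialised by the differentials of charts. This identity lets derivatives
of curves and functions be read in the same coordinates as tangent vectors. -/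
lemma hasMFDerivAt_extChartAt_chartCoord {x₀ y : M} (hy : y ∈ (chartAt E x₀).source) :
    HasMFDerivAt 𝓘(ℝ, E) 𝓘(ℝ, E) (extChartAt 𝓘(ℝ, E) x₀) y (chartCoord x₀ y) := by
  have h : MDifferentiableAt 𝓘(ℝ, E) 𝓘(ℝ, E) (extChartAt 𝓘(ℝ, E) x₀) y :=
    mdifferentiableAt_extChartAt hy
  have := h.hasMFDerivAt
  rwa [← TangentBundle.continuousLinearMapAt_trivializationAt hy] at this

lemma contMDiffOn_coordField (x₀ : M) (b : E) :
    ContMDiffOn 𝓘(ℝ, E) (𝓘(ℝ, E).prod 𝓘(ℝ, E)) ∞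
      (fun y => (⟨y, coordField x₀ b y⟩ : TangentBundle 𝓘(ℝ, E) M)) (chartAt E x₀).source := by
  have := (trivializationAt E (TangentSpace 𝓘(ℝ, E)) x₀).contMDiffOn_section_baseSet_iff
    (IB := 𝓘(ℝ, E)) (n := ∞) (s := coordField x₀ b)
  refine this.2 ?_
  refine (contMDiffOn_const (c := b)).congr fun y hy => ?_
  have hy' : y ∈ (chartAt E x₀).source := by simpa using hy
  rw [trivializationAt_snd_eq_chartCoord hy', chartCoord_coordField hy']

lemma contMDiffAt_coordField {x₀ y : M} (hy : y ∈ (chartAt E x₀).source) (b : E) :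
    ContMDiffAt 𝓘(ℝ, E) (𝓘(ℝ, E).prod 𝓘(ℝ, E)) ∞
      (fun y => (⟨y, coordField x₀ b y⟩ : TangentBundle 𝓘(ℝ, E) M)) y :=
  (contMDiffOn_coordField x₀ b).contMDiffAt ((chartAt E x₀).open_source.mem_nhds hy)

lemma isDifferentiableFieldAt_coordField {x₀ y : M} (hy : y ∈ (chartAt E x₀).source) (b : E) :
    IsDifferentiableFieldAt (coordField x₀ b) y :=
  (contMDiffAt_coordField hy b).mdifferentiableAt (by simp)

lemma symm_mem_source {x₀ : M} {q : E} (hq : q ∈ (extChartAt 𝓘(ℝ, E) x₀).target) :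
    (extChartAt 𝓘(ℝ, E) x₀).symm q ∈ (chartAt E x₀).source := by
  simpa using (extChartAt 𝓘(ℝ, E) x₀).map_target hq

lemma contDiffAt_comp_symm {F : Type*} [NormedAddCommGroup F] [NormedSpace ℝ F] {n : ℕ∞}
    {x₀ : M} {q : E} (hq : q ∈ (extChartAt 𝓘(ℝ, E) x₀).target) {f : M → F}
    (hf : ContMDiffAt 𝓘(ℝ, E) 𝓘(ℝ, F) n f ((extChartAt 𝓘(ℝ, E) x₀).symm q)) :
    ContDiffAt ℝ n (fun q => f ((extChartAt 𝓘(ℝ, E) x₀).symm q)) q := by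
  have h1 : ContMDiffAt 𝓘(ℝ, E) 𝓘(ℝ, E) n (extChartAt 𝓘(ℝ, E) x₀).symm q :=
    ((contMDiffOn_extChartAt_symm (n := ∞) x₀).contMDiffAt
      ((isOpen_extChartAt_target x₀).mem_nhds hq)).of_le (by exact_mod_cast le_top)
  exact (hf.comp q h1).contDiffAt

lemma differentiableAt_comp_symm {F : Type*} [NormedAddCommGroup F] [NormedSpace ℝ F]
    {x₀ : M} {q : E} (hq : q ∈ (extChartAt 𝓘(ℝ, E) x₀).target) {f : M → F}
    (hf : MDifferentiableAt 𝓘(ℝ, E) 𝓘(ℝ, F) f ((extChartAt 𝓘(ℝ, E) x₀).symm q)) :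
    DifferentiableAt ℝ (fun q => f ((extChartAt 𝓘(ℝ, E) x₀).symm q)) q := by
  have h1 : ContMDiffAt 𝓘(ℝ, E) 𝓘(ℝ, E) ∞ (extChartAt 𝓘(ℝ, E) x₀).symm q :=
    ((contMDiffOn_extChartAt_symm (n := ∞) x₀).contMDiffAt
      ((isOpen_extChartAt_target x₀).mem_nhds hq))
  exact (hf.comp q (h1.mdifferentiableAt (by simp))).differentiableAt

lemma mdifferentiableAt_of_comp_symm {F : Type*} [NormedAddCommGroup F] [NormedSpace ℝ F]
    {x₀ y : M} (hy : y ∈ (chartAt E x₀).source) {f : M → F}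
    (hf : DifferentiableAt ℝ (fun q => f ((extChartAt 𝓘(ℝ, E) x₀).symm q))
      (extChartAt 𝓘(ℝ, E) x₀ y)) :
    HasMFDerivAt 𝓘(ℝ, E) 𝓘(ℝ, F) f y
      ((fderiv ℝ (fun q => f ((extChartAt 𝓘(ℝ, E) x₀).symm q))
        (extChartAt 𝓘(ℝ, E) x₀ y)).comp (chartCoord x₀ y)) := by
  have := hf.hasFDerivAt.hasMFDerivAt.comp y (hasMFDerivAt_extChartAt_chartCoord hy)
  refine this.congr_of_eventuallyEq ?_
  filter_upwards [(chartAt E x₀).open_source.mem_nhds hy] with z hz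
  exact congrArg f ((extChartAt 𝓘(ℝ, E) x₀).left_inv (by simpa using hz)).symm

/-- The differential of a function on `M` in the chart at `x₀`. -/
lemma mvfderiv_eq_fderiv_comp_symm {F : Type*} [NormedAddCommGroup F] [NormedSpace ℝ F]
    {x₀ y : M} (hy : y ∈ (chartAt E x₀).source) {f : M → F}
    (hf : MDifferentiableAt 𝓘(ℝ, E) 𝓘(ℝ, F) f y) (v : TangentSpace 𝓘(ℝ, E) y) :
    mvfderiv 𝓘(ℝ, E) f y v =
      fderiv ℝ (fun q => f ((extChartAt 𝓘(ℝ, E) x₀).symm q)) (extChartAt 𝓘(ℝ, E) x₀ y)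
        (chartCoord x₀ y v) := by
  have h := mdifferentiableAt_of_comp_symm (f := f) hy
    (differentiableAt_comp_symm ((extChartAt 𝓘(ℝ, E) x₀).map_source (by simpa using hy))
      (by rwa [(extChartAt 𝓘(ℝ, E) x₀).left_inv (by simpa using hy)]))
  rw [mvfderiv, h.mfderiv]
  rfl

lemma contDiffAt_fieldRep {n : ℕ∞} {x₀ : M} {q : E} (hq : q ∈ (extChartAt 𝓘(ℝ, E) x₀).target)
    {Z : ∀ y : M, TangentSpace 𝓘(ℝ, E) y}
    (hZ : ContMDiffAt 𝓘(ℝ, E) (𝓘(ℝ, E).prod 𝓘(ℝ, E)) n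
      (fun y => (⟨y, Z y⟩ : TangentBundle 𝓘(ℝ, E) M)) ((extChartAt 𝓘(ℝ, E) x₀).symm q)) :
    ContDiffAt ℝ n (fieldRep x₀ Z) q := by
  have hn : (n : ℕ∞ω) ≤ ∞ := by exact_mod_cast le_top
  have : ContMDiffVectorBundle n E (TangentSpace 𝓘(ℝ, E) : M → Type _) 𝓘(ℝ, E) :=
    ContMDiffVectorBundle.of_le hn
  have hy := symm_mem_source hq
  have h := ((trivializationAt E (TangentSpace 𝓘(ℝ, E)) x₀).contMDiffAt_section_iff
    (IB := 𝓘(ℝ, E)) (s := Z) (by simpa using hy)).1 hZ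
  refine contDiffAt_comp_symm hq (f := fun y => chartCoord x₀ y (Z y)) (h.congr_of_eventuallyEq ?_)
  filter_upwards [(chartAt E x₀).open_source.mem_nhds hy] with z hz
  exact (trivializationAt_snd_eq_chartCoord hz _).symm

lemma mdifferentiableAt_chartCoord {x₀ y : M} (hy : y ∈ (chartAt E x₀).source)
    {Z : ∀ y : M, TangentSpace 𝓘(ℝ, E) y} (hZ : IsDifferentiableFieldAt Z y) :
    MDifferentiableAt 𝓘(ℝ, E) 𝓘(ℝ, E) (fun y => chartCoord x₀ y (Z y)) y := by
  have h := ((trivializationAt E (TangentSpace 𝓘(ℝ, E)) x₀).mdifferentiableAt_section_iff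
    𝓘(ℝ, E) (s := Z) (by simpa using hy)).1 hZ
  refine h.congr_of_eventuallyEq ?_
  filter_upwards [(chartAt E x₀).open_source.mem_nhds hy] with z hz
  exact (trivializationAt_snd_eq_chartCoord hz _).symm

lemma isDifferentiableFieldAt_iff_fieldRep {x₀ y : M} (hy : y ∈ (chartAt E x₀).source)
    {Z : ∀ y : M, TangentSpace 𝓘(ℝ, E) y} :
    IsDifferentiableFieldAt Z y ↔
      DifferentiableAt ℝ (fieldRep x₀ Z) (extChartAt 𝓘(ℝ, E) x₀ y) := by
  have hl := (extChartAt 𝓘(ℝ, E) x₀).left_inv (show y ∈ _ by simpa using hy)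
  constructor
  · intro hZ
    exact differentiableAt_comp_symm (f := fun y => chartCoord x₀ y (Z y))
      ((extChartAt 𝓘(ℝ, E) x₀).map_source (by simpa using hy))
      (by rw [hl]; exact mdifferentiableAt_chartCoord hy hZ)
  · intro h
    refine ((trivializationAt E (TangentSpace 𝓘(ℝ, E)) x₀).mdifferentiableAt_section_iff
      𝓘(ℝ, E) (s := Z) (by simpa using hy)).2 ?_
    have := (mdifferentiableAt_of_comp_symm (f := fun y => chartCoord x₀ y (Z y)) hy h
      ).mdifferentiableAt
    refine this.congr_of_eventuallyEq ?_
    filter_upwards [(chartAt E x₀).open_source.mem_nhds hy] with z hz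
    exact (trivializationAt_snd_eq_chartCoord hz _)

end Coordinates

/-! ### Christoffel symbols -/

section Christoffel

set_option linter.unusedSectionVars false

variable {E : Type*} [NormedAddCommGroup E] [NormedSpace ℝ E]
  {M : Type*} [TopologicalSpace M] [ChartedSpace E M] [IsManifold 𝓘(ℝ, E) ∞ M]

/-- The vector field `Z` is smooth on the set `u`. -/
def IsSmoothFieldOn (Z : ∀ x : M, TangentSpace 𝓘(ℝ, E) x) (u : Set M) : Prop :=
  ContMDiffOn 𝓘(ℝ, E) (𝓘(ℝ, E).prod 𝓘(ℝ, E)) ∞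
    (fun x => (⟨x, Z x⟩ : TangentBundle 𝓘(ℝ, E) M)) u

lemma IsDifferentiableFieldAt.congr {Z Z' : ∀ x : M, TangentSpace 𝓘(ℝ, E) x} {y : M}
    (hZ : IsDifferentiableFieldAt Z y) (h : ∀ᶠ x in 𝓝 y, Z x = Z' x) :
    IsDifferentiableFieldAt Z' y := by
  refine MDifferentiableAt.congr_of_eventuallyEq hZ ?_
  filter_upwards [h] with x hx
  rw [hx]

lemma IsSmoothFieldOn.isDifferentiableFieldAt {Z : ∀ x : M, TangentSpace 𝓘(ℝ, E) x} {u : Set M}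
    (hZ : IsSmoothFieldOn Z u) {y : M} (hu : u ∈ 𝓝 y) : IsDifferentiableFieldAt Z y :=
  (hZ.contMDiffAt hu).mdifferentiableAt (by simp)

lemma connection_congr (D : LinearConnection E M) {Z Z' : ∀ x : M, TangentSpace 𝓘(ℝ, E) x} {y : M}
    (hZ : IsDifferentiableFieldAt Z y) (h : ∀ᶠ x in 𝓝 y, Z x = Z' x) : D Z y = D Z' y :=
  D.isCovariantDerivativeOnUniv.congr_of_eventuallyEq hZ (hZ.congr h) univ_mem h

lemma IsDifferentiableFieldAt.add {Z Z' : ∀ x : M, TangentSpace 𝓘(ℝ, E) x} {y : M}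
    (hZ : IsDifferentiableFieldAt Z y) (hZ' : IsDifferentiableFieldAt Z' y) :
    IsDifferentiableFieldAt (Z + Z') y :=
  mdifferentiableAt_add_section hZ hZ'

lemma IsDifferentiableFieldAt.smul {Z : ∀ x : M, TangentSpace 𝓘(ℝ, E) x} {y : M} {f : M → ℝ}
    (hf : MDifferentiableAt 𝓘(ℝ, E) 𝓘(ℝ, ℝ) f y) (hZ : IsDifferentiableFieldAt Z y) :
    IsDifferentiableFieldAt (f • Z) y :=
  MDifferentiableAt.smul_section hf hZ

/-- Differentiability of the sum is carried along in the same induction because additivity of the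
connection requires it of both summands. -/
lemma connection_sum (D : LinearConnection E M) {ι : Type*} (s : Finset ι) (f : ι → M → ℝ)
    (Z : ι → ∀ x : M, TangentSpace 𝓘(ℝ, E) x) {y : M}
    (hf : ∀ i ∈ s, MDifferentiableAt 𝓘(ℝ, E) 𝓘(ℝ, ℝ) (f i) y)
    (hZ : ∀ i ∈ s, IsDifferentiableFieldAt (Z i) y) (v : TangentSpace 𝓘(ℝ, E) y) :
    IsDifferentiableFieldAt (∑ i ∈ s, f i • Z i) y ∧ D (∑ i ∈ s, f i • Z i) y v =
      ∑ i ∈ s, (f i y • D (Z i) y v + mvfderiv 𝓘(ℝ, E) (f i) y v • Z i y) := by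
  classical
  induction s using Finset.induction_on with
  | empty =>
    refine ⟨mdifferentiableAt_zeroSection .., ?_⟩
    simp
  | insert i s hi ih =>
    have h1 := hf i (Finset.mem_insert_self i s)
    have h2 := hZ i (Finset.mem_insert_self i s)
    obtain ⟨ih1, ih2⟩ := ih (fun j hj => hf j (Finset.mem_insert_of_mem hj))
      (fun j hj => hZ j (Finset.mem_insert_of_mem hj))
    have h3 := h2.smul h1
    rw [Finset.sum_insert hi, Finset.sum_insert hi]
    refine ⟨h3.add ih1, ?_⟩
    rw [D.isCovariantDerivativeOnUniv.add h3 ih1, add_apply, ih2,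
      D.isCovariantDerivativeOnUniv.leibniz h2 h1]
    rfl

variable [FiniteDimensional ℝ E]

/-- A field which is smooth near `y` agrees near `y` with a globally smooth field. -/
lemma exists_isSmoothField_eventuallyEq [T2Space M] {Z : ∀ x : M, TangentSpace 𝓘(ℝ, E) x}
    {u : Set M} (hu : IsOpen u) {y : M} (hy : y ∈ u) (hZ : IsSmoothFieldOn Z u) :
    ∃ f : M → ℝ, (∀ᶠ x in 𝓝 y, f x = 1) ∧ IsSmoothField (f • Z) := by
  obtain ⟨f, hf, -⟩ := (SmoothBumpFunction.nhds_basis_support (I := 𝓘(ℝ, E))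
    (hu.mem_nhds hy)).mem_iff.1 (hu.mem_nhds hy)
  refine ⟨f, f.eventuallyEq_one, ?_⟩
  exact ContMDiffOn.smul_section_of_tsupport f.contMDiff.contMDiffOn hu hf hZ

/-- Smoothness of a connection is a statement about global sections, so `W` is multiplied by a bump
function equal to `1` near `y`; the connection is local and does not see the change. -/
lemma contMDiffAt_connection [T2Space M] {D : LinearConnection E M}
    (hD : D.ContMDiffCovariantDerivative ∞) {W V : ∀ x : M, TangentSpace 𝓘(ℝ, E) x}
    {u : Set M} (hu : IsOpen u) {y : M} (hy : y ∈ u) (hW : IsSmoothFieldOn W u)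
    (hV : IsSmoothFieldOn V u) :
    ContMDiffAt 𝓘(ℝ, E) (𝓘(ℝ, E).prod 𝓘(ℝ, E)) ∞
      (fun x => (⟨x, D W x (V x)⟩ : TangentBundle 𝓘(ℝ, E) M)) y := by
  obtain ⟨f, hf, hs⟩ := exists_isSmoothField_eventuallyEq hu hy hW
  have h1 := (hD.contMDiff.contMDiff (σ := f • W) (by
    simpa [IsSmoothField] using! (show IsSmoothField (f • W) from hs).contMDiffOn)).contMDiffAt (x := y) univ_mem
  have h2 := ContMDiffAt.clm_bundle_apply (F₁ := E) (F₂ := E) h1 (hV.contMDiffAt (hu.mem_nhds hy))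
  refine h2.congr_of_eventuallyEq ?_
  filter_upwards [hf.eventually_nhds, hu.mem_nhds hy] with x hx hxu
  rw [connection_congr D (hW.isDifferentiableFieldAt (hu.mem_nhds hxu)) (Z' := f • W)]
  filter_upwards [hx] with z hz
  simp [hz]

/-- The Christoffel symbols of the connection in the chart at `x₀`, as a function of the point `q`
in the chart: `christoffel D x₀ q a b` is the representation of `∇_a ∂_b`. -/
def christoffel (D : LinearConnection E M) (x₀ : M) (q : E) : E →L[ℝ] E →L[ℝ] E :=
  ∑ i, (ContinuousLinearMap.smulRightL ℝ E E
      (LinearMap.toContinuousLinearMap ((Module.finBasis ℝ E).coord i))).comp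
    (((chartCoord x₀ ((extChartAt 𝓘(ℝ, E) x₀).symm q)).comp
      (D (coordField x₀ (Module.finBasis ℝ E i)) ((extChartAt 𝓘(ℝ, E) x₀).symm q))).comp
      ((trivializationAt E (TangentSpace 𝓘(ℝ, E)) x₀).symmL ℝ
        ((extChartAt 𝓘(ℝ, E) x₀).symm q)))

lemma christoffel_apply (D : LinearConnection E M) (x₀ : M) (q a b : E) :
    christoffel D x₀ q a b = ∑ i, (Module.finBasis ℝ E).repr b i •
      fieldRep x₀ (fun y => D (coordField x₀ (Module.finBasis ℝ E i)) y (coordField x₀ a y)) q := by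
  simp only [christoffel, sum_apply]
  rfl

lemma contDiffOn_christoffel [T2Space M] {D : LinearConnection E M}
    (hD : D.ContMDiffCovariantDerivative ∞) (x₀ : M) :
    ContDiffOn ℝ ∞ (christoffel D x₀) (extChartAt 𝓘(ℝ, E) x₀).target := by
  rw [contDiffOn_clm_apply]
  intro a
  rw [contDiffOn_clm_apply]
  intro b
  simp only [christoffel_apply]
  refine ContDiffOn.sum fun i _ => contDiffOn_const.smul fun q hq => ?_
  exact (contDiffAt_fieldRep (n := ⊤) hq (contMDiffAt_connection hD (chartAt E x₀).open_source
    (symm_mem_source hq) (contMDiffOn_coordField x₀ _)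
    (contMDiffOn_coordField x₀ a))).contDiffWithinAt

/-- The covariant derivative in the chart at `x₀`. -/
lemma chartCoord_connection (D : LinearConnection E M) {x₀ y : M} (hy : y ∈ (chartAt E x₀).source)
    {Z : ∀ y : M, TangentSpace 𝓘(ℝ, E) y} (hZ : IsDifferentiableFieldAt Z y)
    (v : TangentSpace 𝓘(ℝ, E) y) :
    chartCoord x₀ y (D Z y v) =
      fderiv ℝ (fieldRep x₀ Z) (extChartAt 𝓘(ℝ, E) x₀ y) (chartCoord x₀ y v)
      + christoffel D x₀ (extChartAt 𝓘(ℝ, E) x₀ y) (chartCoord x₀ y v) (chartCoord x₀ y (Z y)) := by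
  set B := Module.finBasis ℝ E
  have hl := (extChartAt 𝓘(ℝ, E) x₀).left_inv (show y ∈ _ by simpa using hy)
  set f : Fin (Module.finrank ℝ E) → M → ℝ := fun i y =>
    LinearMap.toContinuousLinearMap (B.coord i) (chartCoord x₀ y (Z y)) with hfdef
  have hc := mdifferentiableAt_chartCoord hy hZ
  have hf : ∀ i, MDifferentiableAt 𝓘(ℝ, E) 𝓘(ℝ, ℝ) (f i) y := fun i =>
    ((LinearMap.toContinuousLinearMap (B.coord i)).differentiableAt.mdifferentiableAt).comp y hc
  have hcf : ∀ i, IsDifferentiableFieldAt (coordField x₀ (B i)) y := fun i =>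
    isDifferentiableFieldAt_coordField hy _
  obtain ⟨-, h⟩ := connection_sum D Finset.univ f (fun i => coordField x₀ (B i))
    (fun i _ => hf i) (fun i _ => hcf i) v
  -- Near `y` the field is a combination of coordinate fields. The Leibniz rule then yields the
  -- derivative of the components plus the Christoffel term.
  have hloc : ∀ᶠ x in 𝓝 y, Z x = (∑ i, f i • coordField x₀ (B i)) x := by
    filter_upwards [(chartAt E x₀).open_source.mem_nhds hy] with x hx
    have h1 : ∑ i, B.repr (chartCoord x₀ x (Z x)) i • B i = chartCoord x₀ x (Z x) :=
      B.sum_repr _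
    rw [← coordField_chartCoord hx (Z x), ← h1, coordField_sum_smul]
    simp [hfdef]
  have h2 : ∀ i, mvfderiv 𝓘(ℝ, E) (f i) y v = B.coord i
      (fderiv ℝ (fieldRep x₀ Z) (extChartAt 𝓘(ℝ, E) x₀ y) (chartCoord x₀ y v)) := fun i => by
    rw [mvfderiv_eq_fderiv_comp_symm hy (hf i)]
    have h3 := (LinearMap.toContinuousLinearMap (B.coord i)).hasFDerivAt.comp _
      ((isDifferentiableFieldAt_iff_fieldRep hy).1 hZ).hasFDerivAt
    have h4 := h3.fderiv
    exact congrArg (fun A => A (chartCoord x₀ y v)) h4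
  rw [connection_congr D hZ hloc, h, map_sum, christoffel_apply]
  simp only [map_add, map_smul, Finset.sum_add_distrib, h2, chartCoord_coordField hy,
    fieldRep_extChartAt hy, coordField_chartCoord hy]
  rw [add_comm]
  congr 1
  exact B.sum_repr _

end Christoffel

/-! ### Torsion and curvature in coordinates -/

section TorsionCurvature

set_option linter.unusedSectionVars false

variable {E : Type*} [NormedAddCommGroup E] [NormedSpace ℝ E]
  {M : Type*} [TopologicalSpace M] [ChartedSpace E M] [IsManifold 𝓘(ℝ, E) ∞ M]

/-- The constant vector field on a normed space. -/
def constField (b : E) : ∀ q : E, TangentSpace 𝓘(ℝ, E) q := fun _ => b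

lemma mpullback_extChartAt_constField {x₀ y : M} (hy : y ∈ (chartAt E x₀).source) (b : E) :
    VectorField.mpullback 𝓘(ℝ, E) 𝓘(ℝ, E) (extChartAt 𝓘(ℝ, E) x₀) (constField b) y
      = coordField x₀ b y := by
  rw [VectorField.mpullback_apply, (hasMFDerivAt_extChartAt_chartCoord hy).mfderiv]
  have hinv : (chartCoord (E := E) x₀ y).inverse =
      (trivializationAt E (TangentSpace 𝓘(ℝ, E)) x₀).symmL ℝ y := by
    refine ContinuousLinearMap.inverse_eq ?_ ?_
    · ext b; exact chartCoord_coordField hy b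
    · ext b; exact coordField_chartCoord hy b
  exact congrArg (fun A => A b) hinv

lemma mlieBracket_constField (a b q : E) :
    VectorField.mlieBracket 𝓘(ℝ, E) (constField a) (constField b) q = 0 := by
  rw [← VectorField.mlieBracketWithin_univ, VectorField.mlieBracketWithin_eq_lieBracketWithin]
  have h : VectorField.lieBracketWithin ℝ (fun _ : E => a) (fun _ : E => b) univ q = 0 := by
    simp [VectorField.lieBracketWithin]
  exact h

variable [FiniteDimensional ℝ E]

/-- Coordinate fields are pullbacks by the chart of constant fields, and the bracket commutes with
pullbacks. -/
lemma mlieBracket_coordField {x₀ y : M} (hy : y ∈ (chartAt E x₀).source) (a b : E) :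
    VectorField.mlieBracket 𝓘(ℝ, E) (coordField x₀ a) (coordField (M := M) x₀ b) y = 0 := by
  have hm : minSmoothness ℝ 2 = 2 := minSmoothness_of_isRCLikeNormedField
  have : IsManifold 𝓘(ℝ, E) (minSmoothness ℝ 2) M := by rw [hm]; infer_instance
  have hc : ∀ c q : E, MDifferentiableAt 𝓘(ℝ, E) (𝓘(ℝ, E).prod 𝓘(ℝ, E))
      (fun q => (⟨q, constField c q⟩ : TangentBundle 𝓘(ℝ, E) E)) q := fun c q =>
    ((contMDiffAt_vectorSpace_iff_contDiffAt (n := 1) (V := constField c)).2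
      contDiffAt_const).mdifferentiableAt (by simp)
  have h := VectorField.mpullback_mlieBracket (I := 𝓘(ℝ, E)) (I' := 𝓘(ℝ, E)) (n := ∞) (x₀ := y)
    (V := constField a) (W := constField b) (f := extChartAt 𝓘(ℝ, E) x₀)
    (hc a _) (hc b _) (contMDiffAt_extChartAt' (by simpa using hy))
    (by rw [hm]; exact WithTop.coe_le_coe.2 le_top)
  rw [VectorField.mpullback_apply, mlieBracket_constField] at h
  rw [Filter.EventuallyEq.mlieBracket_vectorField_eq (I := 𝓘(ℝ, E))
    (V₁ := coordField x₀ a)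
    (V := VectorField.mpullback 𝓘(ℝ, E) 𝓘(ℝ, E) (extChartAt 𝓘(ℝ, E) x₀) (constField a))
    (W := VectorField.mpullback 𝓘(ℝ, E) 𝓘(ℝ, E) (extChartAt 𝓘(ℝ, E) x₀) (constField b)) ?_ ?_]
  · exact h.symm.trans (map_zero _)
  · filter_upwards [(chartAt E x₀).open_source.mem_nhds hy] with z hz
    exact (mpullback_extChartAt_constField hz a).symm
  · filter_upwards [(chartAt E x₀).open_source.mem_nhds hy] with z hz
    exact (mpullback_extChartAt_constField hz b).symm

lemma fieldRep_coordField {x₀ : M} {q : E} (hq : q ∈ (extChartAt 𝓘(ℝ, E) x₀).target) (b : E) :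
    fieldRep x₀ (coordField (M := M) x₀ b) q = b :=
  chartCoord_coordField (symm_mem_source hq) b

lemma chartCoord_connection_coordField (D : LinearConnection E M) {x₀ y : M}
    (hy : y ∈ (chartAt E x₀).source) (b : E) (v : TangentSpace 𝓘(ℝ, E) y) :
    chartCoord x₀ y (D (coordField x₀ b) y v) =
      christoffel D x₀ (extChartAt 𝓘(ℝ, E) x₀ y) (chartCoord x₀ y v) b := by
  have h0 : fderiv ℝ (fieldRep x₀ (coordField (M := M) x₀ b)) (extChartAt 𝓘(ℝ, E) x₀ y) = 0 := by
    have : fieldRep x₀ (coordField (M := M) x₀ b) =ᶠ[𝓝 (extChartAt 𝓘(ℝ, E) x₀ y)] fun _ => b := by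
      filter_upwards [(isOpen_extChartAt_target x₀).mem_nhds
        ((extChartAt 𝓘(ℝ, E) x₀).map_source (show y ∈ _ by simpa using hy))] with q hq
      exact fieldRep_coordField hq b
    rw [this.fderiv_eq]; simp
  rw [chartCoord_connection D hy (isDifferentiableFieldAt_coordField hy b), h0,
    chartCoord_coordField hy]
  simp

/-- The torsion in the chart at `x₀`. -/
lemma chartCoord_torsion (D : LinearConnection E M) {x₀ y : M} (hy : y ∈ (chartAt E x₀).source)
    (u v : TangentSpace 𝓘(ℝ, E) y) :
    chartCoord x₀ y (D.torsion y u v) =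
      christoffel D x₀ (extChartAt 𝓘(ℝ, E) x₀ y) (chartCoord x₀ y u) (chartCoord x₀ y v)
      - christoffel D x₀ (extChartAt 𝓘(ℝ, E) x₀ y) (chartCoord x₀ y v) (chartCoord x₀ y u) := by
  have h := D.torsion_apply (isDifferentiableFieldAt_coordField hy (chartCoord x₀ y u))
    (isDifferentiableFieldAt_coordField hy (chartCoord x₀ y v))
  rw [mlieBracket_coordField hy, coordField_chartCoord hy, coordField_chartCoord hy, sub_zero] at h
  rw [h, map_sub, chartCoord_connection_coordField D hy, chartCoord_connection_coordField D hy]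

/-- The curvature of a connection with Christoffel symbols `G`. -/
def curvRep (G : E → E →L[ℝ] E →L[ℝ] E) (q a b c : E) : E :=
  fderiv ℝ G q a b c - fderiv ℝ G q b a c + G q a (G q b c) - G q b (G q a c)

/-- Near `x` the chosen extension of a vector is a coordinate field of the chart at `x`. This
removes the bracket term from `curvatureTensor`. -/
lemma mlieBracket_extend {x : M} (u v : TangentSpace 𝓘(ℝ, E) x) :
    VectorField.mlieBracket 𝓘(ℝ, E) (FiberBundle.extend E u)
      (FiberBundle.extend E v : ∀ y : M, TangentSpace 𝓘(ℝ, E) y) x = 0 := by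
  have h : ∀ u : TangentSpace 𝓘(ℝ, E) x,
      (FiberBundle.extend E u : ∀ y : M, TangentSpace 𝓘(ℝ, E) y)
        =ᶠ[𝓝 x] coordField x (chartCoord x x u) := fun u => by
    filter_upwards [(chartAt E x).open_source.mem_nhds (mem_chart_source E x)] with y hy
    exact extend_eq_coordField hy u
  rw [(h u).mlieBracket_vectorField_eq (h v), mlieBracket_coordField (mem_chart_source E x)]

lemma contMDiffAt_extend_field {x : M} (u : TangentSpace 𝓘(ℝ, E) x) :
    ContMDiffAt 𝓘(ℝ, E) (𝓘(ℝ, E).prod 𝓘(ℝ, E)) ∞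
      (fun y => (⟨y, FiberBundle.extend E u y⟩ : TangentBundle 𝓘(ℝ, E) M)) x :=
  FiberBundle.contMDiffAt_extend 𝓘(ℝ, E) E u

lemma contDiffAt_fieldRep_extend {x₀ x : M} (hx : x ∈ (chartAt E x₀).source)
    (u : TangentSpace 𝓘(ℝ, E) x) :
    ContDiffAt ℝ ∞ (fieldRep x₀ (FiberBundle.extend E u)) (extChartAt 𝓘(ℝ, E) x₀ x) := by
  have hx' : x ∈ (extChartAt 𝓘(ℝ, E) x₀).source := by simpa using hx
  refine contDiffAt_fieldRep (n := ⊤) ((extChartAt 𝓘(ℝ, E) x₀).map_source hx') ?_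
  rw [(extChartAt 𝓘(ℝ, E) x₀).left_inv hx']
  exact contMDiffAt_extend_field u

lemma fieldRep_connection (D : LinearConnection E M) {x₀ : M} {q : E}
    (hq : q ∈ (extChartAt 𝓘(ℝ, E) x₀).target) {W : ∀ y : M, TangentSpace 𝓘(ℝ, E) y}
    (hW : DifferentiableAt ℝ (fieldRep x₀ W) q) (V : ∀ y : M, TangentSpace 𝓘(ℝ, E) y) :
    fieldRep x₀ (fun y => D W y (V y)) q =
      fderiv ℝ (fieldRep x₀ W) q (fieldRep x₀ V q)
        + christoffel D x₀ q (fieldRep x₀ V q) (fieldRep x₀ W q) := by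
  have hr := (extChartAt 𝓘(ℝ, E) x₀).right_inv hq
  have hy := symm_mem_source hq
  have h := chartCoord_connection D hy
    ((isDifferentiableFieldAt_iff_fieldRep hy (Z := W)).2 (by rwa [hr]))
    (V ((extChartAt 𝓘(ℝ, E) x₀).symm q))
  rw [hr] at h
  exact h

/-- The curvature in the chart at `x₀`. -/
lemma chartCoord_curvatureTensor [T2Space M] {D : LinearConnection E M}
    (hD : D.ContMDiffCovariantDerivative ∞) {x₀ x : M} (hx : x ∈ (chartAt E x₀).source)
    (u v w : TangentSpace 𝓘(ℝ, E) x) :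
    chartCoord x₀ x (curvatureTensor D x u v w) =
      curvRep (christoffel D x₀) (extChartAt 𝓘(ℝ, E) x₀ x)
        (chartCoord x₀ x u) (chartCoord x₀ x v) (chartCoord x₀ x w) := by
  have hx' : x ∈ (extChartAt 𝓘(ℝ, E) x₀).source := by simpa using hx
  set q := extChartAt 𝓘(ℝ, E) x₀ x with hqdef
  have hq : q ∈ (extChartAt 𝓘(ℝ, E) x₀).target := (extChartAt 𝓘(ℝ, E) x₀).map_source hx'
  have hT := (isOpen_extChartAt_target (I := 𝓘(ℝ, E)) x₀).mem_nhds hq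
  set G := christoffel D x₀ with hG
  have hGd : DifferentiableAt ℝ G q :=
    ((contDiffOn_christoffel hD x₀).contDiffAt hT).differentiableAt (by simp)
  have hs : ∀ u : TangentSpace 𝓘(ℝ, E) x,
      ContDiffAt ℝ ∞ (fieldRep x₀ (FiberBundle.extend E u)) q := contDiffAt_fieldRep_extend hx
  have hval : ∀ u : TangentSpace 𝓘(ℝ, E) x,
      fieldRep x₀ (FiberBundle.extend E u) q = chartCoord x₀ x u := fun u => by
    rw [hqdef, fieldRep_extChartAt hx, FiberBundle.extend_apply_self]
  -- The extensions have constant components in the chart at `x`, but not in the chart at `x₀`.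
  -- Derivatives of their components therefore appear here and have to cancel after
  -- antisymmetrisation in `u`, `v`.
  have hmain : ∀ u v w : TangentSpace 𝓘(ℝ, E) x,
      chartCoord x₀ x (D (fun y => D (FiberBundle.extend E w) y (FiberBundle.extend E v y)) x u) =
      (fderiv ℝ (fderiv ℝ (fieldRep x₀ (FiberBundle.extend E w))) q (chartCoord x₀ x u)
          (chartCoord x₀ x v)
        + fderiv ℝ (fieldRep x₀ (FiberBundle.extend E w)) q
          (fderiv ℝ (fieldRep x₀ (FiberBundle.extend E v)) q (chartCoord x₀ x u))
        + (fderiv ℝ G q (chartCoord x₀ x u) (chartCoord x₀ x v) (chartCoord x₀ x w)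
          + G q (fderiv ℝ (fieldRep x₀ (FiberBundle.extend E v)) q (chartCoord x₀ x u))
            (chartCoord x₀ x w)
          + G q (chartCoord x₀ x v)
            (fderiv ℝ (fieldRep x₀ (FiberBundle.extend E w)) q (chartCoord x₀ x u))))
      + G q (chartCoord x₀ x u) (fderiv ℝ (fieldRep x₀ (FiberBundle.extend E w)) q
          (chartCoord x₀ x v) + G q (chartCoord x₀ x v) (chartCoord x₀ x w)) := by
    intro u v w
    have hev : fieldRep x₀ (fun y => D (FiberBundle.extend E w) y (FiberBundle.extend E v y))
        =ᶠ[𝓝 q] fun p => fderiv ℝ (fieldRep x₀ (FiberBundle.extend E w)) p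
            (fieldRep x₀ (FiberBundle.extend E v) p)
          + G p (fieldRep x₀ (FiberBundle.extend E v) p)
            (fieldRep x₀ (FiberBundle.extend E w) p) := by
      have h1 : ∀ᶠ p in 𝓝 q, ContDiffAt ℝ 1 (fieldRep x₀ (FiberBundle.extend E w)) p :=
        ((hs w).of_le (m := 1) (WithTop.coe_le_coe.2 le_top)).eventually (by simp)
      filter_upwards [hT, h1] with p hp hp1
      exact fieldRep_connection D hp (hp1.differentiableAt (by simp)) _
    have hdw : HasFDerivAt (fderiv ℝ (fieldRep x₀ (FiberBundle.extend E w)))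
        (fderiv ℝ (fderiv ℝ (fieldRep x₀ (FiberBundle.extend E w))) q) q :=
      (((hs w).fderiv_right (m := 1) (WithTop.coe_le_coe.2 le_top)).differentiableAt
        (by simp)).hasFDerivAt
    have hv := ((hs v).differentiableAt (by simp)).hasFDerivAt
    have hw := ((hs w).differentiableAt (by simp)).hasFDerivAt
    have hd := (hdw.clm_apply hv).add ((hGd.hasFDerivAt.clm_apply hv).clm_apply hw)
    have hd' := hd.congr_of_eventuallyEq hev
    have hdiff : IsDifferentiableFieldAt
        (fun y => D (FiberBundle.extend E w) y (FiberBundle.extend E v y)) x :=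
      (isDifferentiableFieldAt_iff_fieldRep hx).2 hd'.differentiableAt
    have h2 : chartCoord x₀ x (D (FiberBundle.extend E w) x (FiberBundle.extend E v x)) = _ :=
      (fieldRep_extChartAt hx (fun y => D (FiberBundle.extend E w) y
        (FiberBundle.extend E v y))).symm.trans hev.eq_of_nhds
    rw [chartCoord_connection D hx hdiff, ← hqdef, hd'.fderiv, h2, hval, hval]
    simp only [add_apply, ContinuousLinearMap.comp_apply, ContinuousLinearMap.flip_apply, hG]
    abel
  have hsymm : ∀ a b : E, fderiv ℝ (fderiv ℝ (fieldRep x₀ (FiberBundle.extend E w))) q a b =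
      fderiv ℝ (fderiv ℝ (fieldRep x₀ (FiberBundle.extend E w))) q b a := fun a b =>
    ((hs w).isSymmSndFDerivAt (by
      rw [minSmoothness_of_isRCLikeNormedField]; exact WithTop.coe_le_coe.2 le_top)) a b
  -- The vanishing of the bracket, read in the chart at `x₀`: it comes from comparing the torsion
  -- computed with the extended fields with its Christoffel expression.
  have hbr : fderiv ℝ (fieldRep x₀ (FiberBundle.extend E v)) q (chartCoord x₀ x u) =
      fderiv ℝ (fieldRep x₀ (FiberBundle.extend E u)) q (chartCoord x₀ x v) := by
    have h := D.torsion_apply_eq_extend u v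
    rw [mlieBracket_extend, sub_zero, FiberBundle.extend_apply_self,
      FiberBundle.extend_apply_self] at h
    have hd : ∀ u : TangentSpace 𝓘(ℝ, E) x, IsDifferentiableFieldAt (FiberBundle.extend E u) x :=
      fun u => (contMDiffAt_extend_field u).mdifferentiableAt (by simp)
    have h' := congrArg (chartCoord x₀ x) h
    rw [chartCoord_torsion D hx, map_sub, chartCoord_connection D hx (hd v),
      chartCoord_connection D hx (hd u), FiberBundle.extend_apply_self,
      FiberBundle.extend_apply_self, add_sub_add_comm, right_eq_add, sub_eq_zero] at h'
    exact h'
  rw [curvatureTensor, mlieBracket_extend, map_zero, sub_zero, map_sub, hmain, hmain, hbr,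
    hsymm (chartCoord x₀ x u), curvRep]
  simp only [map_add]
  abel

end TorsionCurvature

/-! ### Covariant differentiation along a curve -/

section AlongCurves

set_option linter.unusedSectionVars false

variable {E : Type*} [NormedAddCommGroup E] [NormedSpace ℝ E]
  {M : Type*} [TopologicalSpace M] [ChartedSpace E M] [IsManifold 𝓘(ℝ, E) ∞ M]

/-- The curve `γ` has velocity `v` at time `t`, within the set of times `S`. -/
def HasVelocityWithinAt (γ : ℝ → M) (S : Set ℝ) (t : ℝ) (v : TangentSpace 𝓘(ℝ, E) (γ t)) : Prop :=
  HasMFDerivWithinAt 𝓘(ℝ, ℝ) 𝓘(ℝ, E) γ S t (ContinuousLinearMap.toSpanSingleton ℝ v)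

lemma HasVelocityWithinAt.mono {γ : ℝ → M} {S S' : Set ℝ} {t : ℝ}
    {v : TangentSpace 𝓘(ℝ, E) (γ t)} (h : HasVelocityWithinAt γ S t v) (hS : S' ⊆ S) :
    HasVelocityWithinAt γ S' t v :=
  HasMFDerivWithinAt.mono h hS

lemma hasVelocityWithinAt_velocity {γ : ℝ → M} {S : Set ℝ} {t : ℝ}
    (h : MDifferentiableWithinAt 𝓘(ℝ, ℝ) 𝓘(ℝ, E) γ S t) :
    HasVelocityWithinAt (E := E) γ S t (velocity γ S t) := by
  have h1 := h.hasMFDerivWithinAt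
  have : mfderivWithin 𝓘(ℝ, ℝ) 𝓘(ℝ, E) γ S t =
      ContinuousLinearMap.toSpanSingleton ℝ (velocity (E := E) γ S t) := by
    refine ContinuousLinearMap.ext_ring ?_
    exact (one_smul ℝ (velocity (E := E) γ S t)).symm
  rwa [this] at h1

lemma HasVelocityWithinAt.velocity_eq {γ : ℝ → M} {S : Set ℝ} {t : ℝ}
    {v : TangentSpace 𝓘(ℝ, E) (γ t)} (h : HasVelocityWithinAt γ S t v)
    (hS : UniqueDiffWithinAt ℝ S t) : velocity γ S t = v := by
  rw [velocity, HasMFDerivWithinAt.mfderivWithin h hS.uniqueMDiffWithinAt]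
  exact one_smul ℝ v

lemma HasVelocityWithinAt.comp_mfderiv {F : Type*} [NormedAddCommGroup F] [NormedSpace ℝ F]
    {γ : ℝ → M} {S : Set ℝ} {t : ℝ} {v : TangentSpace 𝓘(ℝ, E) (γ t)}
    (h : HasVelocityWithinAt γ S t v) {f : M → F} {A : TangentSpace 𝓘(ℝ, E) (γ t) →L[ℝ] F}
    (hf : HasMFDerivAt 𝓘(ℝ, E) 𝓘(ℝ, F) f (γ t) A) :
    HasDerivWithinAt (fun s => f (γ s)) (A v) S t := by
  have h1 := HasMFDerivAt.comp_hasMFDerivWithinAt t hf h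
  have h2 : HasFDerivWithinAt (fun s => f (γ s))
      (A.comp (ContinuousLinearMap.toSpanSingleton ℝ v)) S t :=
    hasMFDerivWithinAt_iff_hasFDerivWithinAt.1 h1
  refine h2.hasDerivWithinAt.congr_deriv ?_
  exact congrArg A (one_smul ℝ v)

lemma HasVelocityWithinAt.hasDerivWithinAt {γ : ℝ → M} {S : Set ℝ} {t : ℝ}
    {v : TangentSpace 𝓘(ℝ, E) (γ t)} (h : HasVelocityWithinAt γ S t v) {x₀ : M}
    (hx : γ t ∈ (chartAt E x₀).source) :
    HasDerivWithinAt (fun s => extChartAt 𝓘(ℝ, E) x₀ (γ s)) (chartCoord x₀ (γ t) v) S t :=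
  h.comp_mfderiv (hasMFDerivAt_extChartAt_chartCoord hx)

lemma HasVelocityWithinAt.eventually_mem {γ : ℝ → M} {S : Set ℝ} {t : ℝ}
    {v : TangentSpace 𝓘(ℝ, E) (γ t)} (h : HasVelocityWithinAt γ S t v) {x₀ : M}
    (hx : γ t ∈ (chartAt E x₀).source) : ∀ᶠ s in 𝓝[S] t, γ s ∈ (chartAt E x₀).source :=
  (HasMFDerivWithinAt.continuousWithinAt h) ((chartAt E x₀).open_source.mem_nhds hx)

/-- The manifold derivative at time `t` is defined through the chart at `γ t`; the coordinate change
between the two charts carries the derivative found in the chart at `x₀` to it. -/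
lemma hasVelocityWithinAt_of_chart {γ : ℝ → M} {S : Set ℝ} {t : ℝ} {x₀ : M}
    (hx : γ t ∈ (chartAt E x₀).source) (hc : ContinuousWithinAt γ S t) {a : E}
    (h : HasDerivWithinAt (fun s => extChartAt 𝓘(ℝ, E) x₀ (γ s)) a S t) :
    HasVelocityWithinAt γ S t (coordField x₀ a (γ t)) := by
  have hx₁ := mem_chart_source E (γ t)
  have hl : ∀ s, γ s ∈ (chartAt E x₀).source →
      (extChartAt 𝓘(ℝ, E) x₀).symm (extChartAt 𝓘(ℝ, E) x₀ (γ s)) = γ s := fun s hs =>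
    (extChartAt 𝓘(ℝ, E) x₀).left_inv (by simpa using hs)
  have h1 := hasFDerivWithinAt_tangentCoordChange (I := 𝓘(ℝ, E)) (x := x₀) (y := γ t) (z := γ t)
    (by simpa using hx)
  rw [modelWithCornersSelf_coe, range_id, hasFDerivWithinAt_univ] at h1
  have h2 : HasDerivWithinAt (fun s => extChartAt 𝓘(ℝ, E) (γ t) (γ s))
      (tangentCoordChange 𝓘(ℝ, E) x₀ (γ t) (γ t) a) S t := by
    refine (h1.comp_hasDerivWithinAt t h).congr_of_eventuallyEq ?_ ?_
    · filter_upwards [hc ((chartAt E x₀).open_source.mem_nhds hx)] with s hs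
      simp only [Function.comp_apply, hl s hs]
    · simp only [Function.comp_apply, hl t hx]
  refine ⟨hc, ?_⟩
  have h3 : tangentCoordChange 𝓘(ℝ, E) x₀ (γ t) (γ t) =
      (trivializationAt E (TangentSpace 𝓘(ℝ, E)) x₀).symmL ℝ (γ t) :=
    (TangentBundle.symmL_trivializationAt_eq_core hx).symm
  rw [h3] at h2
  simpa [writtenInExtChartAt, Function.comp_def] using! h2.hasFDerivWithinAt

variable [FiniteDimensional ℝ E]

/-- The field `X` along `γ` has, within the set of times `S`, covariant derivative `W` at time `t`
when `γ` has velocity `v`. This is expressed in the chart at `x₀`. -/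
def HasCovDerivWithinAt (D : LinearConnection E M) (x₀ : M) (γ : ℝ → M) (S : Set ℝ)
    (X : ∀ t, TangentSpace 𝓘(ℝ, E) (γ t)) (t : ℝ) (v W : TangentSpace 𝓘(ℝ, E) (γ t)) : Prop :=
  HasDerivWithinAt (fun s => chartCoord x₀ (γ s) (X s))
    (chartCoord x₀ (γ t) W - christoffel D x₀ (extChartAt 𝓘(ℝ, E) x₀ (γ t))
      (chartCoord x₀ (γ t) v) (chartCoord x₀ (γ t) (X t))) S t

variable {D : LinearConnection E M} {x₀ x₁ : M} {γ : ℝ → M} {S : Set ℝ} {t : ℝ}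

lemma HasCovDerivWithinAt.mono {X : ∀ t, TangentSpace 𝓘(ℝ, E) (γ t)}
    {v W : TangentSpace 𝓘(ℝ, E) (γ t)} (h : HasCovDerivWithinAt D x₀ γ S X t v W) {S' : Set ℝ}
    (hS : S' ⊆ S) : HasCovDerivWithinAt D x₀ γ S' X t v W :=
  HasDerivWithinAt.mono h hS

lemma HasCovDerivWithinAt.congr {X Y : ∀ t, TangentSpace 𝓘(ℝ, E) (γ t)}
    {v W : TangentSpace 𝓘(ℝ, E) (γ t)} (h : HasCovDerivWithinAt D x₀ γ S X t v W)
    (hXY : ∀ᶠ s in 𝓝[S] t, Y s = X s) (ht : Y t = X t) :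
    HasCovDerivWithinAt D x₀ γ S Y t v W := by
  unfold HasCovDerivWithinAt at *
  rw [ht]
  refine h.congr_of_eventuallyEq ?_ (by rw [ht])
  filter_upwards [hXY] with s hs
  rw [hs]

lemma HasCovDerivWithinAt.sum_smul {ι : Type*} [Fintype ι] {f : ι → ℝ → ℝ} {f' : ι → ℝ}
    {Z : ι → ∀ t, TangentSpace 𝓘(ℝ, E) (γ t)} {W : ι → TangentSpace 𝓘(ℝ, E) (γ t)}
    {v : TangentSpace 𝓘(ℝ, E) (γ t)}
    (hf : ∀ i, HasDerivWithinAt (f i) (f' i) S t)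
    (hZ : ∀ i, HasCovDerivWithinAt D x₀ γ S (Z i) t v (W i)) :
    HasCovDerivWithinAt D x₀ γ S (fun s => ∑ i, f i s • Z i s) t v
      (∑ i, (f' i • Z i t + f i t • W i)) := by
  have h := HasDerivWithinAt.fun_sum (u := Finset.univ) fun i _ => (hf i).smul (hZ i)
  unfold HasCovDerivWithinAt
  simp only [map_sum, map_smul, map_add, ← Finset.sum_sub_distrib]
  refine h.congr_deriv (Finset.sum_congr rfl fun i _ => ?_)
  rw [smul_sub]; abel

/-- The covariant derivative along a curve of the restriction of a vector field. -/
lemma hasCovDerivWithinAt_comp {v : TangentSpace 𝓘(ℝ, E) (γ t)}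
    (hγ : HasVelocityWithinAt γ S t v) (hx : γ t ∈ (chartAt E x₀).source)
    {Z : ∀ y : M, TangentSpace 𝓘(ℝ, E) y} (hZ : IsDifferentiableFieldAt Z (γ t)) :
    HasCovDerivWithinAt D x₀ γ S (fun s => Z (γ s)) t v (D Z (γ t) v) := by
  have h1 := mdifferentiableAt_of_comp_symm (f := fun y => chartCoord x₀ y (Z y)) hx
    ((isDifferentiableFieldAt_iff_fieldRep hx).1 hZ)
  refine (hγ.comp_mfderiv h1).congr_deriv ?_
  rw [chartCoord_connection D hx hZ, add_sub_cancel_right]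
  rfl

/-- The covariant derivative along a curve does not depend on the chart. -/
lemma HasCovDerivWithinAt.change_chart {X : ∀ t, TangentSpace 𝓘(ℝ, E) (γ t)}
    {v W : TangentSpace 𝓘(ℝ, E) (γ t)} (h : HasCovDerivWithinAt D x₀ γ S X t v W)
    (hγ : HasVelocityWithinAt γ S t v) (hx₀ : γ t ∈ (chartAt E x₀).source)
    (hx₁ : γ t ∈ (chartAt E x₁).source) : HasCovDerivWithinAt D x₁ γ S X t v W := by
  set B := Module.finBasis ℝ E
  have hf : ∀ i, HasDerivWithinAt (fun s => B.repr (chartCoord x₀ (γ s) (X s)) i)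
      (B.repr (chartCoord x₀ (γ t) W - christoffel D x₀ (extChartAt 𝓘(ℝ, E) x₀ (γ t))
      (chartCoord x₀ (γ t) v) (chartCoord x₀ (γ t) (X t))) i) S t := fun i =>
    (LinearMap.toContinuousLinearMap (B.coord i)).hasFDerivAt.comp_hasDerivWithinAt t h
  -- `X` is expanded in the coordinate frame of `x₀`. Its components are differentiable functions of
  -- time, and the frame fields are restrictions of fields on `M`, whose covariant derivative along
  -- the curve is the same in every chart.
  have h1 := HasCovDerivWithinAt.sum_smul (D := D) (x₀ := x₁) (v := v) hf
    (fun i => hasCovDerivWithinAt_comp (D := D) hγ hx₁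
      (isDifferentiableFieldAt_coordField hx₀ (B i)))
  have hX : ∀ s, γ s ∈ (chartAt E x₀).source → X s =
      ∑ i, B.repr (chartCoord x₀ (γ s) (X s)) i • coordField x₀ (B i) (γ s) := fun s hs => by
    rw [← coordField_sum_smul, B.sum_repr, coordField_chartCoord hs]
  have h2 := h1.congr (Y := X) (by
    filter_upwards [hγ.eventually_mem hx₀] with s hs using hX s hs) (hX t hx₀)
  convert h2 using 1
  apply chartCoord_injective hx₀
  simp only [Finset.sum_add_distrib, map_add, ← coordField_sum_smul, B.sum_repr,
    chartCoord_coordField hx₀, map_sum, map_smul, chartCoord_connection_coordField D hx₀]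
  simp only [← map_smul, ← map_sum, B.sum_repr]
  abel

/-- The covariant derivative along a curve, computed in any chart. -/
lemma HasCovDerivWithinAt.covDerivAlong_eq {X : ∀ t, TangentSpace 𝓘(ℝ, E) (γ t)}
    {v W : TangentSpace 𝓘(ℝ, E) (γ t)} (h : HasCovDerivWithinAt D x₀ γ S X t v W)
    (hγ : HasVelocityWithinAt γ S t v) (hx₀ : γ t ∈ (chartAt E x₀).source)
    (hS : UniqueDiffWithinAt ℝ S t) : covDerivAlong D γ S X t = W := by
  have h1 := h.change_chart hγ hx₀ (mem_chart_source E (γ t))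
  have h2 : HasDerivWithinAt (fun s => (trivializationAt E (TangentSpace 𝓘(ℝ, E)) (γ t)
      (⟨γ s, X s⟩ : TangentBundle 𝓘(ℝ, E) M)).2)
      (chartCoord (γ t) (γ t) W - christoffel D (γ t) (extChartAt 𝓘(ℝ, E) (γ t) (γ t))
      (chartCoord (γ t) (γ t) v) (chartCoord (γ t) (γ t) (X t))) S t := by
    refine HasDerivWithinAt.congr_of_eventuallyEq h1 ?_ ?_
    · filter_upwards [hγ.eventually_mem (mem_chart_source E (γ t))] with s hs
      exact trivializationAt_snd_eq_chartCoord hs _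
    · exact trivializationAt_snd_eq_chartCoord (mem_chart_source E (γ t)) _
  apply chartCoord_injective (mem_chart_source E (γ t))
  have h3 : D (FiberBundle.extend E (X t)) (γ t)
      = D (coordField (γ t) (chartCoord (γ t) (γ t) (X t))) (γ t) := by
    refine connection_congr D ((contMDiffAt_extend_field (X t)).mdifferentiableAt (by simp)) ?_
    filter_upwards [(chartAt E (γ t)).open_source.mem_nhds (mem_chart_source E _)] with y hy
    exact extend_eq_coordField hy _
  have h4 : ∀ b : E, (trivializationAt E (TangentSpace 𝓘(ℝ, E)) (γ t)).symm (γ t) b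
      = coordField (γ t) b (γ t) := fun b =>
    (Trivialization.symmL_apply _ (by simp) _).symm
  rw [covDerivAlong, h2.derivWithin hS, h4, map_add, chartCoord_coordField (mem_chart_source E _),
    hγ.velocity_eq hS, h3, chartCoord_connection_coordField D (mem_chart_source E _)]
  abel

/-- A differentiable field along a curve has a covariant derivative, in any chart. -/
lemma hasCovDerivWithinAt_covDerivAlong {X : ∀ t, TangentSpace 𝓘(ℝ, E) (γ t)}
    (hX : MDifferentiableWithinAt 𝓘(ℝ, ℝ) (𝓘(ℝ, E).prod 𝓘(ℝ, E))
      (fun t => (⟨γ t, X t⟩ : TangentBundle 𝓘(ℝ, E) M)) S t)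
    (hS : UniqueDiffWithinAt ℝ S t) (hx₀ : γ t ∈ (chartAt E x₀).source) :
    HasVelocityWithinAt (E := E) γ S t (velocity γ S t) ∧
    HasCovDerivWithinAt D x₀ γ S X t (velocity γ S t) (covDerivAlong D γ S X t) := by
  have hm : (fun t => (⟨γ t, X t⟩ : TangentBundle 𝓘(ℝ, E) M)) t ∈
      (trivializationAt E (TangentSpace 𝓘(ℝ, E)) x₀).source := by simpa using hx₀
  obtain ⟨h1, h2⟩ := (Trivialization.mdifferentiableWithinAt_totalSpace_iff 𝓘(ℝ, E)
    (trivializationAt E (TangentSpace 𝓘(ℝ, E)) x₀)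
    (fun t => (⟨γ t, X t⟩ : TangentBundle 𝓘(ℝ, E) M)) hm).1 hX
  have hv : HasVelocityWithinAt (E := E) γ S t (velocity γ S t) := hasVelocityWithinAt_velocity h1
  refine ⟨hv, ?_⟩
  have h3 : DifferentiableWithinAt ℝ (fun s => chartCoord x₀ (γ s) (X s)) S t := by
    refine h2.differentiableWithinAt.congr_of_eventuallyEq ?_ ?_
    · filter_upwards [hv.eventually_mem hx₀] with s hs
      exact (trivializationAt_snd_eq_chartCoord hs _).symm
    · exact (trivializationAt_snd_eq_chartCoord hx₀ _).symm
  have h4 : HasCovDerivWithinAt D x₀ γ S X t (velocity γ S t)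
      (coordField x₀ (derivWithin (fun s => chartCoord x₀ (γ s) (X s)) S t
        + christoffel D x₀ (extChartAt 𝓘(ℝ, E) x₀ (γ t))
      (chartCoord x₀ (γ t) (velocity γ S t)) (chartCoord x₀ (γ t) (X t))) (γ t)) := by
    unfold HasCovDerivWithinAt
    rw [chartCoord_coordField hx₀, add_sub_cancel_right]
    exact h3.hasDerivWithinAt
  rwa [h4.covDerivAlong_eq hv hx₀ hS]

end AlongCurves

/-! ### The Webster metric expressed through the torsion -/

namespace PseudoHermitianStructure

set_option linter.unusedSectionVars false

variable {m : ℕ} {M : Type*} [TopologicalSpace M]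
  [ChartedSpace (EuclideanSpace ℝ (Fin (2 * m + 1))) M] [IsManifold (𝓡 (2 * m + 1)) ∞ M]
  (P : PseudoHermitianStructure m M)
  {D : LinearConnection (EuclideanSpace ℝ (Fin (2 * m + 1))) M}

lemma contMDiffOn_theta {Z : ∀ x : M, TangentSpace (𝓡 (2 * m + 1)) x} {u : Set M}
    (hZ : IsSmoothFieldOn Z u) :
    ContMDiffOn (𝓡 (2 * m + 1)) 𝓘(ℝ, ℝ) ∞ (fun y => P.θ y (Z y)) u := by
  have h := ContMDiffOn.clm_bundle_apply (F₁ := EuclideanSpace ℝ (Fin (2 * m + 1))) (F₂ := ℝ)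
    (E₂ := Bundle.Trivial M ℝ) (b := fun y : M => y) (ϕ := P.θ) P.θ_smooth.contMDiffOn hZ
  intro y hy
  exact (contMDiffWithinAt_totalSpace.1 (h y hy)).2

lemma isSmoothFieldOn_J {Z : ∀ x : M, TangentSpace (𝓡 (2 * m + 1)) x} {u : Set M}
    (hZ : IsSmoothFieldOn Z u) : IsSmoothFieldOn (fun y => P.J y (Z y)) u :=
  ContMDiffOn.clm_bundle_apply (F₁ := EuclideanSpace ℝ (Fin (2 * m + 1)))
    (F₂ := EuclideanSpace ℝ (Fin (2 * m + 1))) (b := fun y : M => y) (ϕ := P.J)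
    P.J_smooth.contMDiffOn hZ

lemma isSmoothFieldOn_horizontalPart {Z : ∀ x : M, TangentSpace (𝓡 (2 * m + 1)) x} {u : Set M}
    (hZ : IsSmoothFieldOn Z u) : IsSmoothFieldOn (fun y => P.horizontalPart y (Z y)) u :=
  ContMDiffOn.sub_section hZ
    (ContMDiffOn.smul_section (P.contMDiffOn_theta hZ) P.ξ_smooth.contMDiffOn)

lemma theta_horizontalPart (x : M) (v : TangentSpace (𝓡 (2 * m + 1)) x) :
    P.θ x (P.horizontalPart x v) = 0 := by
  simp [horizontalPart, P.θ_ξ]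

lemma horizontalPart_of_theta_eq_zero {x : M} {v : TangentSpace (𝓡 (2 * m + 1)) x}
    (hv : P.θ x v = 0) : P.horizontalPart x v = v := by
  simp [horizontalPart, hv]

lemma horizontalPart_add_smul (x : M) (v : TangentSpace (𝓡 (2 * m + 1)) x) :
    P.horizontalPart x v + P.θ x v • P.ξ x = v := by simp [horizontalPart]

lemma J_horizontalPart (x : M) (v : TangentSpace (𝓡 (2 * m + 1)) x) :
    P.J x (P.horizontalPart x v) = P.J x v := by
  simp [horizontalPart, P.J_ξ]

lemma J_J (x : M) (v : TangentSpace (𝓡 (2 * m + 1)) x) :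
    P.J x (P.J x v) = -P.horizontalPart x v := by
  have h := P.J_sq x _ (P.theta_horizontalPart x v)
  rwa [P.J_horizontalPart] at h

/-- A tangent vector extends to a differentiable horizontal field, up to its Reeb component. -/
lemma exists_horizontal_smooth (x : M) (v : TangentSpace (𝓡 (2 * m + 1)) x) :
    ∃ Z : ∀ x : M, TangentSpace (𝓡 (2 * m + 1)) x,
      IsSmoothFieldOn Z (chartAt (EuclideanSpace ℝ (Fin (2 * m + 1))) x).source ∧
      (∀ y, P.θ y (Z y) = 0) ∧ Z x = P.horizontalPart x v :=
  ⟨fun y => P.horizontalPart y (coordField x (chartCoord x x v) y),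
    P.isSmoothFieldOn_horizontalPart (contMDiffOn_coordField x _),
    fun y => P.theta_horizontalPart y _, by
      simp only [coordField_chartCoord (mem_chart_source _ x)]⟩

section TanakaWebster

variable (hD : P.IsTanakaWebster D) (hS : P.IsSasakian D)
include hD

lemma theta_torsion_horizontal {x : M} {u v : TangentSpace (𝓡 (2 * m + 1)) x}
    (hu : P.θ x u = 0) (hv : P.θ x v = 0) :
    P.θ x (D.torsion x u v) = 2 * extDerivOneForm P.θ x u v := by
  rw [hD.torsion_horizontal x u v hu hv]
  simp [P.θ_ξ]

include hS

/-- The Sasakian condition puts `ξ` in the kernel of the torsion in the first slot, and antisymmetry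
does so in the second. -/
lemma torsion_horizontalPart (x : M) (u v : TangentSpace (𝓡 (2 * m + 1)) x) :
    D.torsion x (P.horizontalPart x u) (P.horizontalPart x v) = D.torsion x u v := by
  have h : ∀ w, D.torsion x w (P.ξ x) = 0 := fun w => by
    rw [D.torsion_antisymm, hS, neg_zero]
  simp [horizontalPart, hS x, h]

lemma torsion_eq (x : M) (u v : TangentSpace (𝓡 (2 * m + 1)) x) :
    D.torsion x u v = P.θ x (D.torsion x u v) • P.ξ x := by
  rw [← P.torsion_horizontalPart hD hS, P.theta_torsion_horizontal hD
    (P.theta_horizontalPart x u) (P.theta_horizontalPart x v),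
    hD.torsion_horizontal _ _ _ (P.theta_horizontalPart x u) (P.theta_horizontalPart x v)]

/-- For horizontal vectors `2 dθ = θ ∘ T`. The torsion is a bundled bilinear tensor, whereas
`extDerivOneForm` is defined through extensions of single vectors; this formula is the source of
bilinearity and smoothness of the metric. -/
lemma websterMetric_eq (x : M) (u v : TangentSpace (𝓡 (2 * m + 1)) x) :
    P.websterMetric x u v = P.θ x u * P.θ x v + 1 / 2 * P.θ x (D.torsion x u (P.J x v)) := by
  rw [websterMetric, ← P.torsion_horizontalPart hD hS x u,
    P.horizontalPart_of_theta_eq_zero (P.J_horizontal x v), P.theta_torsion_horizontal hD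
    (P.theta_horizontalPart x u) (P.J_horizontal x v), P.J_horizontalPart]
  ring

/-- Replacing `v` by `Jv` in the preceding formula and using `J² = -1` on `H` solves for the
torsion. Only the tensors `⟨·,·⟩`, `J`, `ξ` occur on the right, all of them parallel; hence the
torsion is parallel too. -/
lemma torsion_eq_websterMetric (x : M) (u v : TangentSpace (𝓡 (2 * m + 1)) x) :
    D.torsion x u v = (-2 * P.websterMetric x u (P.J x v)) • P.ξ x := by
  rw [P.torsion_eq hD hS, P.websterMetric_eq hD hS, P.J_horizontal, P.J_J, map_neg, map_neg,
    ← P.torsion_horizontalPart hD hS x u (P.horizontalPart x v),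
    P.horizontalPart_of_theta_eq_zero (P.theta_horizontalPart x v),
    P.torsion_horizontalPart hD hS]
  congr 1
  ring

lemma websterMetric_xi_right (x : M) (u : TangentSpace (𝓡 (2 * m + 1)) x) :
    P.websterMetric x u (P.ξ x) = P.θ x u := by
  rw [P.websterMetric_eq hD hS, P.J_ξ, P.θ_ξ]; simp

lemma websterMetric_self_pos (x : M) {u : TangentSpace (𝓡 (2 * m + 1)) x} (hu : u ≠ 0) :
    0 < P.websterMetric x u u := by
  rw [websterMetric]
  by_cases h : P.horizontalPart x u = 0
  · have h1 := P.horizontalPart_add_smul x u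
    rw [h, zero_add] at h1
    have h2 : P.θ x u ≠ 0 := fun h0 => hu (by rw [← h1, h0, zero_smul])
    -- `dθ(0, ·) = 0` is not immediate from the definition by extensions; it follows from the
    -- linearity of the torsion.
    have h3 : extDerivOneForm P.θ x (P.horizontalPart x u) (P.J x (P.horizontalPart x u)) = 0 := by
      have h4 := P.theta_torsion_horizontal hD (P.theta_horizontalPart x u)
        (P.J_horizontal x (P.horizontalPart x u))
      rw [h] at h4 ⊢
      simp at h4
      simpa using h4
    rw [h3, add_zero]
    exact mul_self_pos.2 h2
  · have := P.levi_pos x _ (P.theta_horizontalPart x u) h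
    have h2 := mul_self_nonneg (P.θ x u)
    linarith

/-- Since `∇` preserves `H`, `θ(T(X, Y)) = -θ([X, Y])` for horizontal fields, and integrability
gives `θ([X, Y]) = θ([JX, JY])`. The `J`-invariance obtained is what makes the Webster metric
symmetric. Globally smooth horizontal extensions are needed because integrability speaks of global
sections. -/
lemma theta_torsion_J [T2Space M] (x : M) (u v : TangentSpace (𝓡 (2 * m + 1)) x) :
    P.θ x (D.torsion x (P.J x u) (P.J x v)) = P.θ x (D.torsion x u v) := by
  have hglob : ∀ u : TangentSpace (𝓡 (2 * m + 1)) x,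
      ∃ X : ∀ x : M, TangentSpace (𝓡 (2 * m + 1)) x, IsSmoothField X ∧
        (∀ y, P.θ y (X y) = 0) ∧ X x = P.horizontalPart x u := by
    intro u
    obtain ⟨Z, h1, h2, h3⟩ := P.exists_horizontal_smooth x u
    obtain ⟨f, hf, hs⟩ := exists_isSmoothField_eventuallyEq (chartAt _ x).open_source
      (mem_chart_source _ x) h1
    refine ⟨f • Z, hs, fun y => by simp [h2], ?_⟩
    have := hf.self_of_nhds
    simp [this, h3]
  obtain ⟨X, hX, hX0, hXx⟩ := hglob u
  obtain ⟨Y, hY, hY0, hYx⟩ := hglob v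
  have hkey : ∀ X Y : ∀ x : M, TangentSpace (𝓡 (2 * m + 1)) x, IsSmoothField X →
      IsSmoothField Y → (∀ y, P.θ y (X y) = 0) → (∀ y, P.θ y (Y y) = 0) →
      P.θ x (D.torsion x (X x) (Y x)) = - P.θ x (VectorField.mlieBracket (𝓡 (2 * m + 1)) X Y x) := by
    intro X Y hX hY hX0 hY0
    have hXd : IsDifferentiableFieldAt X x := hX.mdifferentiableAt (by simp)
    have hYd : IsDifferentiableFieldAt Y x := hY.mdifferentiableAt (by simp)
    rw [D.torsion_apply hXd hYd, map_sub, map_sub,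
      hD.preserves_horizontal X x hXd hX0, hD.preserves_horizontal Y x hYd hY0]
    ring
  have hJ : ∀ X : ∀ x : M, TangentSpace (𝓡 (2 * m + 1)) x, IsSmoothField X →
      IsSmoothField (fun y => P.J y (X y)) := fun X hX => by
    have := P.isSmoothFieldOn_J (Z := X) (u := univ) (ContMDiff.contMDiffOn hX)
    exact contMDiffOn_univ.1 this
  have h1 := hkey X Y hX hY hX0 hY0
  have h2 := hkey _ _ (hJ X hX) (hJ Y hY) (fun y => P.J_horizontal y _)
    (fun y => P.J_horizontal y _)
  have h3 := (P.integrable X Y hX hY hX0 hY0 x).1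
  rw [map_sub, sub_eq_zero] at h3
  simp only [hXx, hYx, P.J_horizontalPart, P.torsion_horizontalPart hD hS] at h1 h2
  rw [h1, h2, h3]

lemma websterMetric_comm [T2Space M] (x : M) (u v : TangentSpace (𝓡 (2 * m + 1)) x) :
    P.websterMetric x u v = P.websterMetric x v u := by
  rw [P.websterMetric_eq hD hS, P.websterMetric_eq hD hS, ← P.theta_torsion_J hD hS x u, P.J_J,
    map_neg, map_neg, ← P.torsion_horizontalPart hD hS x _ (P.horizontalPart x v),
    P.horizontalPart_of_theta_eq_zero (P.theta_horizontalPart x v),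
    P.torsion_horizontalPart hD hS, D.torsion_antisymm, map_neg]
  ring

end TanakaWebster

end PseudoHermitianStructure

/-! ### Curvature identities for a metric connection with parallel torsion -/

section LocalModel

set_option linter.unusedSectionVars false

variable {E : Type*} [NormedAddCommGroup E] [NormedSpace ℝ E] [FiniteDimensional ℝ E]

lemma two_le_infty : (2 : ℕ∞ω) ≤ ∞ := WithTop.coe_le_coe.2 (le_top : (2 : ℕ∞) ≤ ⊤)

/-- The expression in coordinates of a metric connection with parallel torsion
`T(a, b) = -2 g(a, j b) x`, for a parallel endomorphism `j` and a parallel field `x`. -/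
structure IsSasakianModel (Ω : Set E) (Γ : E → E →L[ℝ] E →L[ℝ] E) (g : E → E →L[ℝ] E →L[ℝ] ℝ)
    (j : E → E →L[ℝ] E) (x : E → E) : Prop where
  isOpen : IsOpen Ω
  smooth_Γ : ContDiffOn ℝ ∞ Γ Ω
  smooth_g : ContDiffOn ℝ ∞ g Ω
  smooth_j : ContDiffOn ℝ ∞ j Ω
  smooth_x : ContDiffOn ℝ ∞ x Ω
  symm : ∀ q ∈ Ω, ∀ a b, g q a b = g q b a
  pos : ∀ q ∈ Ω, ∀ a, a ≠ 0 → 0 < g q a a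
  dg : ∀ q ∈ Ω, ∀ a b c, fderiv ℝ g q c a b = g q (Γ q c a) b + g q a (Γ q c b)
  dj : ∀ q ∈ Ω, ∀ a c, fderiv ℝ j q c a = j q (Γ q c a) - Γ q c (j q a)
  dx : ∀ q ∈ Ω, ∀ c, fderiv ℝ x q c = - Γ q c (x q)
  torsion : ∀ q ∈ Ω, ∀ a b, Γ q a b - Γ q b a = (-2 * g q a (j q b)) • x q
  gjx : ∀ q ∈ Ω, ∀ a, g q (j q a) (x q) = 0

namespace IsSasakianModel

variable {Ω : Set E} {Γ : E → E →L[ℝ] E →L[ℝ] E} {g : E → E →L[ℝ] E →L[ℝ] ℝ}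
    {j : E → E →L[ℝ] E} {x : E → E} (h : IsSasakianModel Ω Γ g j x) {q : E}

lemma hasFDerivAt_of_contDiffOn {F : Type*} [NormedAddCommGroup F] [NormedSpace ℝ F] {f : E → F}
    (ho : IsOpen Ω) (hf : ContDiffOn ℝ ∞ f Ω) (hq : q ∈ Ω) : HasFDerivAt f (fderiv ℝ f q) q :=
  ((hf.contDiffAt (ho.mem_nhds hq)).differentiableAt (by simp)).hasFDerivAt

lemma hasDerivAt_line {F : Type*} [NormedAddCommGroup F] [NormedSpace ℝ F] {f : E → F}
    {f' : E →L[ℝ] F} (hf : HasFDerivAt f f' q) (c : E) :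
    HasDerivAt (fun s : ℝ => f (q + s • c)) (f' c) 0 := by
  have h1 : HasDerivAt (fun s : ℝ => q + s • c) c 0 := by
    simpa using ((hasDerivAt_id (0 : ℝ)).smul_const c).const_add q
  have h2 : HasFDerivAt f f' (q + (0 : ℝ) • c) := by simpa using hf
  exact h2.comp_hasDerivAt (0 : ℝ) h1

lemma eventually_line {P : E → Prop} (hP : ∀ᶠ y in 𝓝 q, P y) (c : E) :
    ∀ᶠ s : ℝ in 𝓝 0, P (q + s • c) := by
  have : Tendsto (fun s : ℝ => q + s • c) (𝓝 0) (𝓝 q) := by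
    have : Continuous fun s : ℝ => q + s • c := by fun_prop
    simpa using this.tendsto 0
  exact this.eventually hP

include h

/-- This is `∇T = 0` in coordinates. The torsion identity is differentiated in the direction `c`;
the derivatives of `g`, `j`, `x` on the right are given by their being parallel. -/
lemma sub_smul_Γ (hq : q ∈ Ω) (a b c : E) :
    fderiv ℝ Γ q c a b - fderiv ℝ Γ q c b a =
      (Γ q (Γ q c a) b - Γ q b (Γ q c a)) + (Γ q a (Γ q c b) - Γ q (Γ q c b) a)
        - Γ q c (Γ q a b - Γ q b a) := by
  have hΓ := hasDerivAt_line (hasFDerivAt_of_contDiffOn h.isOpen h.smooth_Γ hq) c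
  have hg := hasDerivAt_line (hasFDerivAt_of_contDiffOn h.isOpen h.smooth_g hq) c
  have hj := hasDerivAt_line (hasFDerivAt_of_contDiffOn h.isOpen h.smooth_j hq) c
  have hx := hasDerivAt_line (hasFDerivAt_of_contDiffOn h.isOpen h.smooth_x hq) c
  have h1 := ((hΓ.clm_apply (hasDerivAt_const _ a)).clm_apply (hasDerivAt_const _ b)).sub
    ((hΓ.clm_apply (hasDerivAt_const _ b)).clm_apply (hasDerivAt_const _ a))
  have h2 := ((((hg.clm_apply (hasDerivAt_const _ a)).clm_apply
    (hj.clm_apply (hasDerivAt_const _ b))).const_mul (-2)).smul hx)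
  have h4 := h1.unique (h2.congr_of_eventuallyEq (by
      filter_upwards [eventually_line (h.isOpen.mem_nhds hq) c] with s hs
      exact h.torsion _ hs a b))
  simp only [zero_smul, add_zero, map_zero, h.dg q hq, h.dj q hq,
    h.dx q hq] at h4
  rw [h4, h.torsion q hq, h.torsion q hq a b, h.torsion q hq a (Γ q c b)]
  simp only [map_sub, map_smul]
  module

lemma torsion_x_left (hq : q ∈ Ω) (b : E) : Γ q (x q) b = Γ q b (x q) := by
  have := h.torsion q hq (x q) b
  rw [h.symm q hq, h.gjx q hq] at this
  simpa [sub_eq_zero] using this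

/-- In invariant terms `T(T(a, b), c) = 0`: the values of the torsion are multiples of `x`, which
lies in its kernel. -/
lemma torsion_torsion (hq : q ∈ Ω) (a b c : E) :
    Γ q (Γ q a b - Γ q b a) c = Γ q c (Γ q a b - Γ q b a) := by
  rw [h.torsion q hq]
  simp [h.torsion_x_left hq]

/-- For a connection with torsion the cyclic sum of the curvature is the cyclic sum of `∇T` and
`T(T(·,·),·)`. Both vanish here, which leaves the identity known from the torsion-free case. -/
lemma bianchi (hq : q ∈ Ω) (a b c : E) :
    curvRep Γ q a b c + curvRep Γ q b c a + curvRep Γ q c a b = 0 := by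
  have h1 := h.sub_smul_Γ hq b c a
  have h2 := h.sub_smul_Γ hq c a b
  have h3 := h.sub_smul_Γ hq a b c
  have h4 := h.torsion_torsion hq a b c
  have h5 := h.torsion_torsion hq b c a
  have h6 := h.torsion_torsion hq c a b
  simp only [map_sub, sub_apply] at h1 h2 h3 h4 h5 h6
  simp only [curvRep]
  linear_combination (norm := module) h1 + h2 + h3 + h4 + h5 + h6

/-- The curvature annihilates a parallel field: differentiate `∇x = 0` once more and use the
symmetry of second derivatives. -/
lemma curvRep_x (hq : q ∈ Ω) (a b : E) : curvRep Γ q a b (x q) = 0 := by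
  have hs : IsSymmSndFDerivAt ℝ x q :=
    (h.smooth_x.contDiffAt (h.isOpen.mem_nhds hq)).isSymmSndFDerivAt (by simpa using two_le_infty)
  have hx2 : DifferentiableAt ℝ (fderiv ℝ x) q :=
    ((h.smooth_x.contDiffAt (h.isOpen.mem_nhds hq)).fderiv_right (m := 1)
      (by simpa [one_add_one_eq_two] using two_le_infty)).differentiableAt (by simp)
  have key : ∀ c d, fderiv ℝ (fderiv ℝ x) q d c = - (fderiv ℝ Γ q d c (x q) - Γ q c (Γ q d (x q))) := by
    intro c d
    have hΓ := hasDerivAt_line (hasFDerivAt_of_contDiffOn h.isOpen h.smooth_Γ hq) d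
    have hx := hasDerivAt_line (hasFDerivAt_of_contDiffOn h.isOpen h.smooth_x hq) d
    have h1 := (hasDerivAt_line hx2.hasFDerivAt d).clm_apply (hasDerivAt_const _ c)
    have h2 := ((hΓ.clm_apply (hasDerivAt_const _ c)).clm_apply hx).neg
    have h4 := h1.unique (h2.congr_of_eventuallyEq (by
        filter_upwards [eventually_line (h.isOpen.mem_nhds hq) d] with s hs
        exact h.dx _ hs c))
    simp only [zero_smul, add_zero, map_zero, h.dx q hq, map_neg, neg_zero, zero_apply] at h4
    rw [h4]
    abel
  have h5 := hs.eq a b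
  rw [key, key] at h5
  simp only [curvRep]
  linear_combination (norm := module) - h5

/-- The two second derivatives of `g(a, b)`, for constant `a` and `b`, agree; expressed by the
parallelism of `g`, their difference is the asserted sum. -/
lemma curvRep_skew (hq : q ∈ Ω) (a b c d : E) :
    g q (curvRep Γ q c d a) b = - g q a (curvRep Γ q c d b) := by
  set f : E → ℝ := fun y => g y a b with hfdef
  have hf : ContDiffOn ℝ ∞ f Ω := (h.smooth_g.clm_apply contDiffOn_const).clm_apply contDiffOn_const
  have hs : IsSymmSndFDerivAt ℝ f q :=
    (hf.contDiffAt (h.isOpen.mem_nhds hq)).isSymmSndFDerivAt (by simpa using two_le_infty)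
  have hf2 : DifferentiableAt ℝ (fderiv ℝ f) q :=
    ((hf.contDiffAt (h.isOpen.mem_nhds hq)).fderiv_right (m := 1)
      (by simpa [one_add_one_eq_two] using two_le_infty)).differentiableAt (by simp)
  have hdf : ∀ y ∈ Ω, ∀ c, fderiv ℝ f y c = g y (Γ y c a) b + g y a (Γ y c b) := by
    intro y hy c
    rw [← h.dg y hy]
    have := hasDerivAt_line (hasFDerivAt_of_contDiffOn h.isOpen h.smooth_g hy) c
    have h1 := (this.clm_apply (hasDerivAt_const _ a)).clm_apply (hasDerivAt_const _ b)
    have h2 := hasDerivAt_line (hasFDerivAt_of_contDiffOn h.isOpen hf hy) c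
    simpa using h2.unique h1
  have key : ∀ c d, fderiv ℝ (fderiv ℝ f) q d c =
      g q (Γ q d (Γ q c a)) b + g q (Γ q c a) (Γ q d b) + g q (fderiv ℝ Γ q d c a) b
      + (g q (Γ q d a) (Γ q c b) + g q a (Γ q d (Γ q c b)) + g q a (fderiv ℝ Γ q d c b)) := by
    intro c d
    have hΓ := hasDerivAt_line (hasFDerivAt_of_contDiffOn h.isOpen h.smooth_Γ hq) d
    have hg := hasDerivAt_line (hasFDerivAt_of_contDiffOn h.isOpen h.smooth_g hq) d
    have h1 := (hasDerivAt_line hf2.hasFDerivAt d).clm_apply (hasDerivAt_const _ c)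
    have hc := hΓ.clm_apply (hasDerivAt_const _ c)
    have h2 := ((hg.clm_apply (hc.clm_apply (hasDerivAt_const _ a))).clm_apply
      (hasDerivAt_const _ b)).add ((hg.clm_apply (hasDerivAt_const _ a)).clm_apply
        (hc.clm_apply (hasDerivAt_const _ b)))
    have h4 := h1.unique (h2.congr_of_eventuallyEq (by
        filter_upwards [eventually_line (h.isOpen.mem_nhds hq) d] with s hs
        exact hdf _ hs c))
    simp only [zero_smul, add_zero, map_zero, h.dg q hq, add_apply] at h4
    rw [h4]
  have h5 := hs.eq c d
  simp only [key] at h5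
  simp only [curvRep, map_add, map_sub, add_apply, sub_apply]
  linear_combination h5

lemma curvRep_antisymm (a b c : E) : curvRep Γ q a b c = - curvRep Γ q b a c := by
  simp only [curvRep]; abel

/-- The classical algebraic argument: the cyclic identity for four choices of arguments, combined
with the two skew symmetries, leaves twice the difference of the two sides. -/
lemma curvRep_pair (hq : q ∈ Ω) (a b c d : E) :
    g q (curvRep Γ q a b c) d = g q (curvRep Γ q c d a) b := by
  have hA : ∀ a b c d, g q (curvRep Γ q a b c) d + g q (curvRep Γ q b a c) d = 0 := by
    intro a b c d
    rw [h.curvRep_antisymm (q := q) a b c]; simp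
  have hB : ∀ a b c d, g q (curvRep Γ q a b c) d + g q (curvRep Γ q b c a) d
      + g q (curvRep Γ q c a b) d = 0 := by
    intro a b c d
    simpa using congrArg (fun v => g q v d) (h.bianchi hq a b c)
  have hS : ∀ a b c d, g q (curvRep Γ q a b c) d + g q (curvRep Γ q a b d) c = 0 := by
    intro a b c d
    rw [h.curvRep_skew hq c d a b, h.symm q hq c]; ring
  linarith [hB a b c d, hB b c d a, hB c d a b, hB d a b c, hA a b c d, hA a b d c, hA b c a d,
    hA b c d a, hA c d a b, hA c d b a, hA d a b c, hA d a c b, hA a c b d, hA a c d b, hA b d a c,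
    hA b d c a, hS a b c d, hS b c a d, hS c d a b, hS d a b c, hS a c b d, hS b d a c, hS c a b d,
    hS d b a c, hS b a c d, hS c b a d, hS d c a b, hS a d b c]

lemma g_curvRep_comm (hq : q ∈ Ω) (v w T : E) :
    g q (curvRep Γ q v T T) w = g q (curvRep Γ q w T T) v := by
  rw [h.curvRep_pair hq, h.curvRep_antisymm, map_neg, neg_apply,
    h.curvRep_skew hq, neg_neg, h.symm q hq]

/-- By pair symmetry `g(R(x, T)T, d) = g(R(T, d)x, T) = 0`; the choice `d = R(x, T)T` and positivity
conclude. -/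
lemma curvRep_x_left (hq : q ∈ Ω) (T : E) : curvRep Γ q (x q) T T = 0 := by
  by_contra hne
  have := h.pos q hq _ hne
  rw [h.curvRep_pair hq, h.curvRep_x hq] at this
  simp at this

lemma g_curvRep_x (hq : q ∈ Ω) (a b c : E) : g q (curvRep Γ q a b c) (x q) = 0 := by
  rw [h.curvRep_skew hq, h.curvRep_x hq]; simp

set_option synthInstance.maxHeartbeats 200000 in
set_option maxHeartbeats 1000000 in
lemma continuousWithinAt_curvRep {S : Set ℝ} {t : ℝ} {p a b c d : ℝ → E} (hp : p t ∈ Ω)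
    (hpc : ContinuousWithinAt p S t) (ha : ContinuousWithinAt a S t)
    (hb : ContinuousWithinAt b S t) (hc : ContinuousWithinAt c S t)
    (hd : ContinuousWithinAt d S t) :
    ContinuousWithinAt (fun s => g (p s) (curvRep Γ (p s) (a s) (b s) (c s)) (d s)) S t := by
  have hg := (h.smooth_g.continuousOn.continuousAt
    (h.isOpen.mem_nhds hp)).comp_continuousWithinAt hpc
  have hΓ := (h.smooth_Γ.continuousOn.continuousAt
    (h.isOpen.mem_nhds hp)).comp_continuousWithinAt hpc
  have hdΓ := ((h.smooth_Γ.fderiv_of_isOpen h.isOpen (m := ∞)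
    (by simp)).continuousOn.continuousAt (h.isOpen.mem_nhds hp)).comp_continuousWithinAt hpc
  have hR := ((((hdΓ.clm_apply ha).clm_apply hb).clm_apply hc).sub
    (((hdΓ.clm_apply hb).clm_apply ha).clm_apply hc)).add
    ((hΓ.clm_apply ha).clm_apply ((hΓ.clm_apply hb).clm_apply hc)) |>.sub
    ((hΓ.clm_apply hb).clm_apply ((hΓ.clm_apply ha).clm_apply hc))
  exact (hg.clm_apply hR).clm_apply hd

end IsSasakianModel

set_option synthInstance.maxHeartbeats 200000 in
set_option maxHeartbeats 1000000 in
lemma curvRep_sum_smul (Γ : E → E →L[ℝ] E →L[ℝ] E) (q : E) {ι : Type*} (s : Finset ι) (f : ι → ℝ)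
    (u : ι → E) (v w : E) :
    curvRep Γ q (∑ i ∈ s, f i • u i) v w = ∑ i ∈ s, f i • curvRep Γ q (u i) v w := by
  simp only [map_sum, map_smul, curvRep, sum_apply, smul_apply, smul_sub, smul_add,
    Finset.sum_sub_distrib, Finset.sum_add_distrib]

end LocalModel

/-! ### A Sasakian structure in a chart -/

namespace PseudoHermitianStructure

set_option linter.unusedSectionVars false

variable {m : ℕ} {M : Type*} [TopologicalSpace M] [T2Space M]
  [ChartedSpace (EuclideanSpace ℝ (Fin (2 * m + 1))) M] [IsManifold (𝓡 (2 * m + 1)) ∞ M]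
  (P : PseudoHermitianStructure m M)
  {D : LinearConnection (EuclideanSpace ℝ (Fin (2 * m + 1))) M}

local notation "𝔼" => EuclideanSpace ℝ (Fin (2 * m + 1))

section Parallel

variable (hD : P.IsTanakaWebster D) (hS : P.IsSasakian D)
include hD hS

/-- Differentiating `⟨ξ, ξ⟩ = 1` shows that `∇_u ξ` is horizontal. Differentiating `⟨Z, ξ⟩ = 0` for
a horizontal `Z` through `∇_u ξ`, whose derivative stays horizontal, gives `⟨∇_u ξ, ∇_u ξ⟩ = 0`. -/
lemma connection_xi (x : M) (u : TangentSpace (𝓡 (2 * m + 1)) x) : D P.ξ x u = 0 := by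
  have hξ : ∀ y, IsDifferentiableFieldAt P.ξ y := fun y => P.ξ_smooth.mdifferentiableAt (by simp)
  have hconst : ∀ (c : ℝ) (f : M → ℝ), (∀ y, f y = c) → mvfderiv (𝓡 (2 * m + 1)) f x u = 0 := by
    intro c f hf
    rw [show f = fun _ => c from funext hf]
    simp [mvfderiv]
  have h1 : P.θ x (D P.ξ x u) = 0 := by
    have h := hD.metric_parallel P.ξ P.ξ x (hξ x) (hξ x) u
    rw [hconst 1 _ fun y => by rw [P.websterMetric_xi_right hD hS, P.θ_ξ],
      P.websterMetric_comm hD hS x (P.ξ x), P.websterMetric_xi_right hD hS] at h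
    linarith
  obtain ⟨Z, hZ, hZ0, hZx⟩ := P.exists_horizontal_smooth x (D P.ξ x u)
  have hZd := hZ.isDifferentiableFieldAt ((chartAt 𝔼 x).open_source.mem_nhds (mem_chart_source 𝔼 x))
  have h := hD.metric_parallel Z P.ξ x hZd (hξ x) u
  rw [hconst 0 _ fun y => by rw [P.websterMetric_xi_right hD hS, hZ0],
    P.websterMetric_xi_right hD hS, hD.preserves_horizontal Z x hZd hZ0 u, zero_add, hZx,
    P.horizontalPart_of_theta_eq_zero h1] at h
  by_contra hne
  exact (P.websterMetric_self_pos hD hS x hne).ne h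

end Parallel

section Representation

variable (D)

/-- The contact form in the chart at `x₀`. -/
def thetaRep (x₀ : M) (q : 𝔼) : 𝔼 →L[ℝ] ℝ :=
  (P.θ ((extChartAt (𝓡 (2 * m + 1)) x₀).symm q)).comp
    ((trivializationAt 𝔼 (TangentSpace (𝓡 (2 * m + 1))) x₀).symmL ℝ
      ((extChartAt (𝓡 (2 * m + 1)) x₀).symm q))

/-- The complex structure in the chart at `x₀`. -/
def JRep (x₀ : M) (q : 𝔼) : 𝔼 →L[ℝ] 𝔼 :=
  (chartCoord x₀ ((extChartAt (𝓡 (2 * m + 1)) x₀).symm q)).comp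
    ((P.J ((extChartAt (𝓡 (2 * m + 1)) x₀).symm q)).comp
      ((trivializationAt 𝔼 (TangentSpace (𝓡 (2 * m + 1))) x₀).symmL ℝ
        ((extChartAt (𝓡 (2 * m + 1)) x₀).symm q)))

/-- The Webster metric in the chart at `x₀`. -/
def metricRep (x₀ : M) (q : 𝔼) : 𝔼 →L[ℝ] 𝔼 →L[ℝ] ℝ :=
  (P.thetaRep x₀ q).smulRight (P.thetaRep x₀ q) + (1 / 2 : ℝ) •
    ((ContinuousLinearMap.compL ℝ 𝔼 𝔼 ℝ (P.thetaRep x₀ q)).comp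
      (((ContinuousLinearMap.compL ℝ 𝔼 𝔼 𝔼).flip (P.JRep x₀ q)).comp
        (christoffel D x₀ q - (christoffel D x₀ q).flip)))

variable {D}

lemma thetaRep_extChartAt {x₀ y : M} (hy : y ∈ (chartAt 𝔼 x₀).source)
    (v : TangentSpace (𝓡 (2 * m + 1)) y) :
    P.thetaRep x₀ (extChartAt (𝓡 (2 * m + 1)) x₀ y) (chartCoord x₀ y v) = P.θ y v := by
  have h : ∀ z, z = y → P.θ z (coordField x₀ (chartCoord x₀ y v) z) = P.θ y v := by
    rintro z rfl
    rw [coordField_chartCoord hy]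
  exact h _ ((extChartAt (𝓡 (2 * m + 1)) x₀).left_inv (by simpa using hy))

lemma JRep_extChartAt {x₀ y : M} (hy : y ∈ (chartAt 𝔼 x₀).source)
    (v : TangentSpace (𝓡 (2 * m + 1)) y) :
    P.JRep x₀ (extChartAt (𝓡 (2 * m + 1)) x₀ y) (chartCoord x₀ y v) =
      chartCoord x₀ y (P.J y v) := by
  have h : ∀ z, z = y → chartCoord x₀ z (P.J z (coordField x₀ (chartCoord x₀ y v) z)) =
      chartCoord x₀ y (P.J y v) := by
    rintro z rfl
    rw [coordField_chartCoord hy]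
  exact h _ ((extChartAt (𝓡 (2 * m + 1)) x₀).left_inv (by simpa using hy))

lemma metricRep_extChartAt (hD : P.IsTanakaWebster D) (hS : P.IsSasakian D) {x₀ y : M}
    (hy : y ∈ (chartAt 𝔼 x₀).source) (u v : TangentSpace (𝓡 (2 * m + 1)) y) :
    P.metricRep D x₀ (extChartAt (𝓡 (2 * m + 1)) x₀ y) (chartCoord x₀ y u) (chartCoord x₀ y v) =
      P.websterMetric y u v := by
  have h1 : P.metricRep D x₀ (extChartAt (𝓡 (2 * m + 1)) x₀ y) (chartCoord x₀ y u)
      (chartCoord x₀ y v) = P.thetaRep x₀ (extChartAt (𝓡 (2 * m + 1)) x₀ y) (chartCoord x₀ y u) *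
      P.thetaRep x₀ (extChartAt (𝓡 (2 * m + 1)) x₀ y) (chartCoord x₀ y v) + (1 / 2 : ℝ) *
        P.thetaRep x₀ (extChartAt (𝓡 (2 * m + 1)) x₀ y)
          (christoffel D x₀ (extChartAt (𝓡 (2 * m + 1)) x₀ y) (chartCoord x₀ y u)
            (P.JRep x₀ (extChartAt (𝓡 (2 * m + 1)) x₀ y) (chartCoord x₀ y v))
          - christoffel D x₀ (extChartAt (𝓡 (2 * m + 1)) x₀ y)
            (P.JRep x₀ (extChartAt (𝓡 (2 * m + 1)) x₀ y) (chartCoord x₀ y v))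
            (chartCoord x₀ y u)) := rfl
  rw [h1, P.JRep_extChartAt hy, ← chartCoord_torsion D hy, P.thetaRep_extChartAt hy,
    P.thetaRep_extChartAt hy, P.thetaRep_extChartAt hy, P.websterMetric_eq hD hS]

variable {x₀ : M}

lemma contDiffOn_thetaRep :
    ContDiffOn ℝ ∞ (P.thetaRep x₀) (extChartAt (𝓡 (2 * m + 1)) x₀).target := by
  rw [contDiffOn_clm_apply]
  intro b q hq
  have h := P.contMDiffOn_theta (contMDiffOn_coordField x₀ b)
  exact (contDiffAt_comp_symm (n := ⊤) hq
    (h.contMDiffAt ((chartAt 𝔼 x₀).open_source.mem_nhds (symm_mem_source hq)))).contDiffWithinAt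

lemma contDiffOn_JRep :
    ContDiffOn ℝ ∞ (P.JRep x₀) (extChartAt (𝓡 (2 * m + 1)) x₀).target := by
  rw [contDiffOn_clm_apply]
  intro b q hq
  have h := P.isSmoothFieldOn_J (contMDiffOn_coordField x₀ b)
  exact (contDiffAt_fieldRep (n := ⊤) hq
    (h.contMDiffAt ((chartAt 𝔼 x₀).open_source.mem_nhds (symm_mem_source hq)))).contDiffWithinAt

lemma contDiffOn_xiRep :
    ContDiffOn ℝ ∞ (fieldRep x₀ P.ξ) (extChartAt (𝓡 (2 * m + 1)) x₀).target :=
  fun _ hq => (contDiffAt_fieldRep (n := ⊤) hq P.ξ_smooth.contMDiffAt).contDiffWithinAt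

lemma contDiffOn_metricRep (hD : P.IsTanakaWebster D) :
    ContDiffOn ℝ ∞ (P.metricRep D x₀) (extChartAt (𝓡 (2 * m + 1)) x₀).target := by
  have hΓ := contDiffOn_christoffel hD.smooth x₀
  have hθ := P.contDiffOn_thetaRep (x₀ := x₀)
  have hJ := P.contDiffOn_JRep (x₀ := x₀)
  rw [contDiffOn_clm_apply]
  intro a
  rw [contDiffOn_clm_apply]
  intro b
  have hJb := hJ.clm_apply (contDiffOn_const (c := b))
  have h1 := ((hΓ.clm_apply (contDiffOn_const (c := a))).clm_apply hJb).sub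
    ((hΓ.clm_apply hJb).clm_apply (contDiffOn_const (c := a)))
  exact ((hθ.clm_apply contDiffOn_const).mul (hθ.clm_apply contDiffOn_const)).add
    (contDiffOn_const.mul (hθ.clm_apply h1))

/-- In a chart, a Sasakian structure is a Sasakian model. -/
lemma isSasakianModel (hD : P.IsTanakaWebster D) (hS : P.IsSasakian D) (x₀ : M) :
    IsSasakianModel (extChartAt (𝓡 (2 * m + 1)) x₀).target (christoffel D x₀) (P.metricRep D x₀)
      (P.JRep x₀) (fieldRep x₀ P.ξ) := by
  have hrep : ∀ q ∈ (extChartAt (𝓡 (2 * m + 1)) x₀).target, ∃ y ∈ (chartAt 𝔼 x₀).source,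
      extChartAt (𝓡 (2 * m + 1)) x₀ y = q := fun q hq =>
    ⟨_, symm_mem_source hq, (extChartAt (𝓡 (2 * m + 1)) x₀).right_inv hq⟩
  have hvec : ∀ y ∈ (chartAt 𝔼 x₀).source, ∀ a : 𝔼, ∃ u : TangentSpace (𝓡 (2 * m + 1)) y,
      chartCoord x₀ y u = a := fun y hy a => ⟨_, chartCoord_coordField hy a⟩
  have ho := isOpen_extChartAt_target (I := 𝓡 (2 * m + 1)) x₀
  refine ⟨ho, contDiffOn_christoffel hD.smooth x₀, P.contDiffOn_metricRep hD, P.contDiffOn_JRep,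
    P.contDiffOn_xiRep, ?_, ?_, ?_, ?_, ?_, ?_, ?_⟩
  · intro q hq a b
    obtain ⟨y, hy, rfl⟩ := hrep q hq
    obtain ⟨u, rfl⟩ := hvec y hy a
    obtain ⟨v, rfl⟩ := hvec y hy b
    rw [P.metricRep_extChartAt hD hS hy, P.metricRep_extChartAt hD hS hy,
      P.websterMetric_comm hD hS]
  · intro q hq a ha
    obtain ⟨y, hy, rfl⟩ := hrep q hq
    obtain ⟨u, rfl⟩ := hvec y hy a
    rw [P.metricRep_extChartAt hD hS hy]
    exact P.websterMetric_self_pos hD hS y (fun h => ha (by rw [h, map_zero]))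
  · intro q hq a b c
    -- Constant vectors `a`, `b` in the chart correspond to coordinate fields, to which metric
    -- compatibility of the connection applies.
    have hd := IsSasakianModel.hasDerivAt_line (IsSasakianModel.hasFDerivAt_of_contDiffOn ho
      (P.contDiffOn_metricRep hD (x₀ := x₀)) hq) c
    have hd1 := (hd.clm_apply (hasDerivAt_const _ a)).clm_apply (hasDerivAt_const _ b)
    have hsm : ContDiffOn ℝ ∞ (fun q => P.metricRep D x₀ q a b)
        (extChartAt (𝓡 (2 * m + 1)) x₀).target :=
      ((P.contDiffOn_metricRep hD).clm_apply contDiffOn_const).clm_apply contDiffOn_const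
    have hd2 := IsSasakianModel.hasDerivAt_line
      (IsSasakianModel.hasFDerivAt_of_contDiffOn ho hsm hq) c
    have hd3 := hd1.unique hd2
    simp only [map_zero, add_zero] at hd3
    rw [hd3]
    have heq : (fun q => P.metricRep D x₀ q a b) =ᶠ[𝓝 q] fun q =>
        P.websterMetric ((extChartAt (𝓡 (2 * m + 1)) x₀).symm q)
          (coordField x₀ a ((extChartAt (𝓡 (2 * m + 1)) x₀).symm q))
          (coordField x₀ b ((extChartAt (𝓡 (2 * m + 1)) x₀).symm q)) := by
      filter_upwards [ho.mem_nhds hq] with q hq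
      rw [← P.metricRep_extChartAt hD hS (symm_mem_source hq),
        chartCoord_coordField (symm_mem_source hq), chartCoord_coordField (symm_mem_source hq),
        (extChartAt (𝓡 (2 * m + 1)) x₀).right_inv hq]
    have hdiff := (IsSasakianModel.hasFDerivAt_of_contDiffOn ho hsm hq).differentiableAt
    rw [heq.fderiv_eq]
    rw [heq.differentiableAt_iff] at hdiff
    obtain ⟨y, hy, rfl⟩ := hrep q hq
    obtain ⟨w, rfl⟩ := hvec y hy c
    have hmd := (mdifferentiableAt_of_comp_symm
      (f := fun z => P.websterMetric z (coordField x₀ a z) (coordField x₀ b z)) hy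
        hdiff).mdifferentiableAt
    rw [← mvfderiv_eq_fderiv_comp_symm
      (f := fun z => P.websterMetric z (coordField x₀ a z) (coordField x₀ b z)) hy hmd,
      hD.metric_parallel _ _ y (isDifferentiableFieldAt_coordField hy a)
        (isDifferentiableFieldAt_coordField hy b), ← P.metricRep_extChartAt hD hS hy,
      ← P.metricRep_extChartAt hD hS hy, chartCoord_connection_coordField D hy,
      chartCoord_connection_coordField D hy, chartCoord_coordField hy, chartCoord_coordField hy]
  · intro q hq b c
    have hd := IsSasakianModel.hasDerivAt_line (IsSasakianModel.hasFDerivAt_of_contDiffOn ho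
      (P.contDiffOn_JRep (x₀ := x₀)) hq) c
    have hd1 := hd.clm_apply (hasDerivAt_const _ b)
    have hsm : ContDiffOn ℝ ∞ (fun q => P.JRep x₀ q b) (extChartAt (𝓡 (2 * m + 1)) x₀).target :=
      P.contDiffOn_JRep.clm_apply contDiffOn_const
    have hd2 := IsSasakianModel.hasDerivAt_line
      (IsSasakianModel.hasFDerivAt_of_contDiffOn ho hsm hq) c
    have hd3 := hd1.unique hd2
    simp only [map_zero, add_zero] at hd3
    rw [hd3]
    obtain ⟨y, hy, rfl⟩ := hrep q hq
    obtain ⟨w, rfl⟩ := hvec y hy c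
    have hJd := (P.isSmoothFieldOn_J (contMDiffOn_coordField x₀ b)).isDifferentiableFieldAt
      ((chartAt 𝔼 x₀).open_source.mem_nhds hy)
    have h1 := chartCoord_connection D hy hJd w
    rw [hD.J_parallel _ y (isDifferentiableFieldAt_coordField hy b), ← P.JRep_extChartAt hy,
      ← P.JRep_extChartAt hy, chartCoord_connection_coordField D hy, chartCoord_coordField hy] at h1
    rw [h1]
    exact (add_sub_cancel_right _ _).symm
  · intro q hq c
    obtain ⟨y, hy, rfl⟩ := hrep q hq
    obtain ⟨w, rfl⟩ := hvec y hy c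
    have h1 := chartCoord_connection D hy (P.ξ_smooth.mdifferentiableAt (by simp)) w
    rw [P.connection_xi hD hS, map_zero] at h1
    rw [fieldRep_extChartAt hy]
    exact eq_neg_of_add_eq_zero_left h1.symm
  · intro q hq a b
    obtain ⟨y, hy, rfl⟩ := hrep q hq
    obtain ⟨u, rfl⟩ := hvec y hy a
    obtain ⟨v, rfl⟩ := hvec y hy b
    rw [← chartCoord_torsion D hy, P.torsion_eq_websterMetric hD hS, map_smul,
      fieldRep_extChartAt hy, P.JRep_extChartAt hy, P.metricRep_extChartAt hD hS hy]
  · intro q hq a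
    obtain ⟨y, hy, rfl⟩ := hrep q hq
    obtain ⟨u, rfl⟩ := hvec y hy a
    rw [fieldRep_extChartAt hy, P.JRep_extChartAt hy, P.metricRep_extChartAt hD hS hy,
      P.websterMetric_xi_right hD hS, P.J_horizontal]

end Representation

end PseudoHermitianStructure

/-! ### Parallel tensors along curves and curvature identities on the manifold -/

namespace PseudoHermitianStructure

set_option linter.unusedSectionVars false

variable {m : ℕ} {M : Type*} [TopologicalSpace M] [T2Space M]
  [ChartedSpace (EuclideanSpace ℝ (Fin (2 * m + 1))) M] [IsManifold (𝓡 (2 * m + 1)) ∞ M]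
  (P : PseudoHermitianStructure m M)
  {D : LinearConnection (EuclideanSpace ℝ (Fin (2 * m + 1))) M}
  (hD : P.IsTanakaWebster D) (hS : P.IsSasakian D)

local notation "𝔼" => EuclideanSpace ℝ (Fin (2 * m + 1))

section AlongCurve

variable {γ : ℝ → M} {S : Set ℝ} {t : ℝ} {x₀ : M} {X Y : ∀ t, TangentSpace (𝓡 (2 * m + 1)) (γ t)}
  {v W Z : TangentSpace (𝓡 (2 * m + 1)) (γ t)}
  (hγ : HasVelocityWithinAt (E := EuclideanSpace ℝ (Fin (2 * m + 1))) γ S t v)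
  (hx : γ t ∈ (chartAt (EuclideanSpace ℝ (Fin (2 * m + 1))) x₀).source)

include hγ hx

lemma hasDerivWithinAt_comp_chart {F : Type*} [NormedAddCommGroup F] [NormedSpace ℝ F]
    {f : 𝔼 → F} (hf : ContDiffOn ℝ ∞ f (extChartAt (𝓡 (2 * m + 1)) x₀).target) :
    HasDerivWithinAt (fun s => f (extChartAt (𝓡 (2 * m + 1)) x₀ (γ s)))
      (fderiv ℝ f (extChartAt (𝓡 (2 * m + 1)) x₀ (γ t)) (chartCoord x₀ (γ t) v)) S t :=
  (IsSasakianModel.hasFDerivAt_of_contDiffOn (isOpen_extChartAt_target x₀) hf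
    ((extChartAt (𝓡 (2 * m + 1)) x₀).map_source (by simpa using hx))).comp_hasDerivWithinAt t
    (hγ.hasDerivWithinAt hx)

include hD hS

/-- The Webster metric is parallel along curves. -/
lemma hasDerivWithinAt_websterMetric (hX : HasCovDerivWithinAt D x₀ γ S X t v W)
    (hY : HasCovDerivWithinAt D x₀ γ S Y t v Z) :
    HasDerivWithinAt (fun s => P.websterMetric (γ s) (X s) (Y s))
      (P.websterMetric (γ t) W (Y t) + P.websterMetric (γ t) (X t) Z) S t := by
  have h := P.isSasakianModel hD hS x₀
  have hq : extChartAt (𝓡 (2 * m + 1)) x₀ (γ t) ∈ (extChartAt (𝓡 (2 * m + 1)) x₀).target :=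
    (extChartAt (𝓡 (2 * m + 1)) x₀).map_source (by simpa using hx)
  have hg := hasDerivWithinAt_comp_chart hγ hx h.smooth_g
  have h1 := (hg.clm_apply hX).clm_apply hY
  refine (h1.congr_of_eventuallyEq ?_ ?_).congr_deriv ?_
  · filter_upwards [hγ.eventually_mem hx] with s hs
    exact (P.metricRep_extChartAt hD hS hs _ _).symm
  · exact (P.metricRep_extChartAt hD hS hx _ _).symm
  · rw [← P.metricRep_extChartAt hD hS hx, ← P.metricRep_extChartAt hD hS hx]
    simp only [h.dg _ hq, add_apply, map_sub, sub_apply]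
    ring

/-- The complex structure is parallel along curves. -/
lemma hasCovDerivWithinAt_J (hX : HasCovDerivWithinAt D x₀ γ S X t v W) :
    HasCovDerivWithinAt D x₀ γ S (fun s => P.J (γ s) (X s)) t v (P.J (γ t) W) := by
  have h := P.isSasakianModel hD hS x₀
  have hq : extChartAt (𝓡 (2 * m + 1)) x₀ (γ t) ∈ (extChartAt (𝓡 (2 * m + 1)) x₀).target :=
    (extChartAt (𝓡 (2 * m + 1)) x₀).map_source (by simpa using hx)
  have h1 := (hasDerivWithinAt_comp_chart hγ hx h.smooth_j).clm_apply hX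
  refine (h1.congr_of_eventuallyEq ?_ ?_).congr_deriv ?_
  · filter_upwards [hγ.eventually_mem hx] with s hs
    exact (P.JRep_extChartAt hs _).symm
  · exact (P.JRep_extChartAt hx _).symm
  · rw [← P.JRep_extChartAt hx, ← P.JRep_extChartAt hx]
    simp only [h.dj _ hq, map_sub]
    abel

lemma hasCovDerivWithinAt_xi :
    HasCovDerivWithinAt D x₀ γ S (fun s => P.ξ (γ s)) t v 0 := by
  have := hasCovDerivWithinAt_comp (D := D) hγ hx
    (P.ξ_smooth.mdifferentiableAt (by simp) : IsDifferentiableFieldAt P.ξ (γ t))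
  rwa [P.connection_xi hD hS] at this

/-- Continuity of the sectional curvature along a curve. -/
lemma continuousWithinAt_curvature {T : ∀ t, TangentSpace (𝓡 (2 * m + 1)) (γ t)}
    {A : TangentSpace (𝓡 (2 * m + 1)) (γ t)}
    (hX : HasCovDerivWithinAt D x₀ γ S X t v W) (hY : HasCovDerivWithinAt D x₀ γ S Y t v Z)
    (hT : HasCovDerivWithinAt D x₀ γ S T t v A) :
    ContinuousWithinAt (fun s => P.websterMetric (γ s)
      (curvatureTensor D (γ s) (X s) (T s) (T s)) (Y s)) S t := by
  have h := P.isSasakianModel hD hS x₀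
  have hq : extChartAt (𝓡 (2 * m + 1)) x₀ (γ t) ∈ (extChartAt (𝓡 (2 * m + 1)) x₀).target :=
    (extChartAt (𝓡 (2 * m + 1)) x₀).map_source (by simpa using hx)
  have h1 := h.continuousWithinAt_curvRep hq (hγ.hasDerivWithinAt hx).continuousWithinAt
    hX.continuousWithinAt hT.continuousWithinAt hT.continuousWithinAt hY.continuousWithinAt
  have key : ∀ s, γ s ∈ (chartAt 𝔼 x₀).source → P.websterMetric (γ s)
      (curvatureTensor D (γ s) (X s) (T s) (T s)) (Y s) = _ := fun s hs =>
    (P.metricRep_extChartAt hD hS hs _ _).symm.trans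
      (by rw [chartCoord_curvatureTensor hD.smooth hs])
  refine h1.congr_of_eventuallyEq ?_ ?_
  · filter_upwards [hγ.eventually_mem hx] with s hs
    exact key s hs
  · exact key t hx

end AlongCurve

section Curvature

include hD hS

variable {x : M}

lemma curvatureTensor_symm (u v T : TangentSpace (𝓡 (2 * m + 1)) x) :
    P.websterMetric x (curvatureTensor D x u T T) v =
      P.websterMetric x (curvatureTensor D x v T T) u := by
  have hx := mem_chart_source 𝔼 x
  have hq : extChartAt (𝓡 (2 * m + 1)) x x ∈ (extChartAt (𝓡 (2 * m + 1)) x).target :=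
    mem_extChartAt_target x
  rw [← P.metricRep_extChartAt hD hS hx, ← P.metricRep_extChartAt hD hS hx,
    chartCoord_curvatureTensor hD.smooth hx, chartCoord_curvatureTensor hD.smooth hx]
  exact (P.isSasakianModel hD hS x).g_curvRep_comm hq _ _ _

lemma curvatureTensor_antisymm (u v w : TangentSpace (𝓡 (2 * m + 1)) x) :
    curvatureTensor D x u v w = - curvatureTensor D x v u w := by
  have hx := mem_chart_source 𝔼 x
  refine chartCoord_injective hx ?_
  rw [map_neg, chartCoord_curvatureTensor hD.smooth hx, chartCoord_curvatureTensor hD.smooth hx]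
  exact (P.isSasakianModel hD hS x).curvRep_antisymm _ _ _

lemma curvatureTensor_sum_smul {ι : Type*} (s : Finset ι) (f : ι → ℝ)
    (u : ι → TangentSpace (𝓡 (2 * m + 1)) x) (v w : TangentSpace (𝓡 (2 * m + 1)) x) :
    curvatureTensor D x (∑ i ∈ s, f i • u i) v w = ∑ i ∈ s, f i • curvatureTensor D x (u i) v w := by
  have hx := mem_chart_source 𝔼 x
  refine chartCoord_injective hx ?_
  simp only [chartCoord_curvatureTensor hD.smooth hx, map_sum, map_smul, curvRep_sum_smul]

lemma curvatureTensor_xi (T : TangentSpace (𝓡 (2 * m + 1)) x) :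
    curvatureTensor D x (P.ξ x) T T = 0 := by
  have hx := mem_chart_source 𝔼 x
  have hq : extChartAt (𝓡 (2 * m + 1)) x x ∈ (extChartAt (𝓡 (2 * m + 1)) x).target :=
    mem_extChartAt_target x
  refine chartCoord_injective hx ?_
  rw [map_zero, chartCoord_curvatureTensor hD.smooth hx, ← fieldRep_extChartAt hx]
  exact (P.isSasakianModel hD hS x).curvRep_x_left hq _

lemma theta_curvatureTensor (u v w : TangentSpace (𝓡 (2 * m + 1)) x) :
    P.θ x (curvatureTensor D x u v w) = 0 := by
  have hx := mem_chart_source 𝔼 x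
  have hq : extChartAt (𝓡 (2 * m + 1)) x x ∈ (extChartAt (𝓡 (2 * m + 1)) x).target :=
    mem_extChartAt_target x
  rw [← P.websterMetric_xi_right hD hS, ← P.metricRep_extChartAt hD hS hx,
    chartCoord_curvatureTensor hD.smooth hx, ← fieldRep_extChartAt hx P.ξ]
  exact (P.isSasakianModel hD hS x).g_curvRep_x hq _ _ _

/-- The Webster metric as a bilinear form. -/
def websterForm (x : M) : LinearMap.BilinForm ℝ (TangentSpace (𝓡 (2 * m + 1)) x) :=
  LinearMap.mk₂ ℝ (fun u v => P.metricRep D x (extChartAt (𝓡 (2 * m + 1)) x x)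
    (chartCoord x x u) (chartCoord x x v)) (by simp) (by simp) (by simp) (by simp)

lemma websterForm_apply (u v : TangentSpace (𝓡 (2 * m + 1)) x) :
    P.websterForm (D := D) x u v = P.websterMetric x u v :=
  P.metricRep_extChartAt hD hS (mem_chart_source 𝔼 x) u v

end Curvature

end PseudoHermitianStructure

/-! ### Global existence for Lipschitz and linear equations -/

section ODE

set_option linter.unusedSectionVars false

open scoped NNReal

variable {V : Type*} [NormedAddCommGroup V] [NormedSpace ℝ V]

/-- Concatenation of differentiable curves. -/
lemma HasDerivWithinAt.ite_le {α₁ α₂ : ℝ → V} {d : V} {a b c t : ℝ} (ha : a ≤ c) (hb : c ≤ b)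
    (h₁ : t ≤ c → HasDerivWithinAt α₁ d (Icc a c) t)
    (h₂ : c ≤ t → HasDerivWithinAt α₂ d (Icc c b) t) (h : t = c → α₁ c = α₂ c) :
    HasDerivWithinAt (fun s => if s ≤ c then α₁ s else α₂ s) d (Icc a b) t := by
  rcases lt_trichotomy t c with hlt | rfl | hgt
  · refine ((h₁ hlt.le).mono_of_mem_nhdsWithin (s := Icc a b) ?_).congr_of_eventuallyEq ?_
      (if_pos hlt.le)
    · filter_upwards [self_mem_nhdsWithin, mem_nhdsWithin_of_mem_nhds (Iio_mem_nhds hlt)] with s h1 h2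
      exact ⟨h1.1, le_of_lt h2⟩
    · filter_upwards [mem_nhdsWithin_of_mem_nhds (Iio_mem_nhds hlt)] with s h2
      exact if_pos (le_of_lt h2)
  · rw [← Icc_union_Icc_eq_Icc ha hb]
    refine HasDerivWithinAt.union ((h₁ le_rfl).congr (fun s hs => if_pos hs.2) (if_pos le_rfl))
      ((h₂ le_rfl).congr (fun s hs => ?_) ((if_pos le_rfl).trans (h rfl)))
    rcases hs.1.eq_or_lt with rfl | hlt
    · exact (if_pos le_rfl).trans (h rfl)
    · exact if_neg hlt.not_ge
  · refine ((h₂ hgt.le).mono_of_mem_nhdsWithin (s := Icc a b) ?_).congr_of_eventuallyEq ?_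
      (if_neg hgt.not_ge)
    · filter_upwards [self_mem_nhdsWithin, mem_nhdsWithin_of_mem_nhds (Ioi_mem_nhds hgt)] with s h1 h2
      exact ⟨le_of_lt h2, h1.2⟩
    · filter_upwards [mem_nhdsWithin_of_mem_nhds (Ioi_mem_nhds hgt)] with s h2
      exact if_neg (not_le.2 h2)

lemma HasDerivWithinAt.Ici_of_Icc {α : ℝ → V} {d : V} {a b t : ℝ}
    (h : HasDerivWithinAt α d (Icc a b) t) (ht : t ∈ Ico a b) : HasDerivWithinAt α d (Ici t) t :=
  h.mono_of_mem_nhdsWithin (mem_of_superset (Icc_mem_nhdsGE ht.2) (Icc_subset_Icc_left ht.1))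

variable [CompleteSpace V]

lemma exists_solution_of_lipschitz_of_short {f : ℝ → V → V} {K : ℝ≥0} {a b : ℝ} (hab : a ≤ b)
    (hf : ∀ t ∈ Icc a b, LipschitzWith K (f t)) (hc : ∀ x, ContinuousOn (fun t => f t x) (Icc a b))
    (hK : K * (b - a) ≤ 1 / 2) (x₀ : V) :
    ∃ α : ℝ → V, α a = x₀ ∧ ∀ t ∈ Icc a b, HasDerivWithinAt α (f t (α t)) (Icc a b) t := by
  obtain ⟨C, hC⟩ := isCompact_Icc.exists_bound_of_continuousOn (hc x₀)
  have hC0 : 0 ≤ C := (norm_nonneg _).trans (hC a ⟨le_rfl, hab⟩)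
  have hba : 0 ≤ b - a := sub_nonneg.2 hab
  -- On the ball of radius `r` the field is bounded by `C + K r`. As `K (b - a) ≤ 1/2`, this radius
  -- satisfies `(C + K r)(b - a) ≤ r`, so that the Picard iteration stays in the ball.
  set r : ℝ≥0 := ⟨2 * C * (b - a), by positivity⟩ with hr
  have hpl : IsPicardLindelof f (⟨a, le_rfl, hab⟩ : Icc a b) x₀ r 0 (⟨C, hC0⟩ + K * r) K := by
    refine ⟨fun t ht => (hf t ht).lipschitzOnWith, fun x _ => hc x, fun t ht x hx => ?_, ?_⟩
    · have h1 := (hf t ht).dist_le_mul x x₀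
      rw [dist_eq_norm, dist_eq_norm] at h1
      have h2 : ‖x - x₀‖ ≤ r := by simpa [dist_eq_norm] using hx
      have h3 : ‖f t x‖ ≤ ‖f t x₀‖ + ‖f t x - f t x₀‖ := by
        simpa using norm_add_le (f t x₀) (f t x - f t x₀)
      have h4 := hC t ht
      have h5 : (K : ℝ) * ‖x - x₀‖ ≤ K * r := by gcongr
      change ‖f t x‖ ≤ C + K * r
      linarith
    · change (C + K * (2 * C * (b - a))) * max (b - a) (a - a) ≤ 2 * C * (b - a) - 0
      rw [sub_self, max_eq_left hba]
      nlinarith [mul_nonneg hC0 hba]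
  exact hpl.exists_eq_forall_mem_Icc_hasDerivWithinAt₀

/-- Global existence for a vector field which is Lipschitz in the space variable. -/
theorem exists_solution_of_lipschitz {f : ℝ → V → V} {K : ℝ≥0} {a b : ℝ} (hab : a ≤ b)
    (hf : ∀ t ∈ Icc a b, LipschitzWith K (f t)) (hc : ∀ x, ContinuousOn (fun t => f t x) (Icc a b))
    (x₀ : V) :
    ∃ α : ℝ → V, α a = x₀ ∧ ∀ t ∈ Icc a b, HasDerivWithinAt α (f t (α t)) (Icc a b) t := by
  obtain ⟨n, hn⟩ := exists_nat_ge (2 * (K * (b - a)))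
  have hn' : K * (b - a) ≤ (n + 1 : ℝ) / 2 := by linarith
  clear hn
  induction n generalizing b with
  | zero => exact exists_solution_of_lipschitz_of_short hab hf hc (by simpa using hn') x₀
  | succ n ih =>
    -- Cutting off the last of `n + 2` equal parts keeps `K (c - a) ≤ (n + 1) / 2` for the induction
    -- hypothesis and `K (b - c) ≤ 1/2` for the short-time result.
    set c := a + (n + 1) / (n + 2) * (b - a) with hcdef
    have hba : 0 ≤ b - a := sub_nonneg.2 hab
    have hac : a ≤ c := by rw [hcdef]; have : (0 : ℝ) ≤ (n + 1) / (n + 2) * (b - a) := by positivity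
                           linarith
    have hbc : b - c = (b - a) / (n + 2) := by rw [hcdef]; field_simp; ring
    have hcb : c ≤ b := by rw [← sub_nonneg, hbc]; positivity
    have hKc : K * (b - a) / (n + 2) ≤ 1 / 2 := by
      rw [div_le_iff₀ (by positivity)]; push_cast at hn'; linarith
    obtain ⟨α₁, h₁, h₁'⟩ := ih hac (fun t ht => hf t ⟨ht.1, ht.2.trans hcb⟩)
      (fun x => (hc x).mono (Icc_subset_Icc_right hcb)) (by
        have : K * (c - a) = K * (b - a) / (n + 2) * (n + 1) := by rw [hcdef]; field_simp; ring
        rw [this]; nlinarith)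
    obtain ⟨α₂, h₂, h₂'⟩ := exists_solution_of_lipschitz_of_short hcb
      (fun t ht => hf t ⟨hac.trans ht.1, ht.2⟩) (fun x => (hc x).mono (Icc_subset_Icc_left hac))
      (by rw [hbc, ← mul_div_assoc]; exact hKc) (α₁ c)
    refine ⟨fun s => if s ≤ c then α₁ s else α₂ s, (if_pos hac).trans h₁, fun t ht => ?_⟩
    refine HasDerivWithinAt.ite_le hac hcb (fun h => ?_) (fun h => ?_) (fun _ => h₂.symm)
    · beta_reduce; rw [if_pos h]; exact h₁' t ⟨ht.1, h⟩
    · have : (if t ≤ c then α₁ t else α₂ t) = α₂ t := by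
        rcases h.eq_or_lt with rfl | h
        · rw [if_pos le_rfl, h₂]
        · exact if_neg h.not_ge
      beta_reduce; rw [this]; exact h₂' t ⟨h, ht.2⟩

/-- Global existence for linear equations. -/
theorem exists_solution_of_linear {A : ℝ → V →L[ℝ] V} {a b : ℝ} (hab : a ≤ b)
    (hA : ContinuousOn A (Icc a b)) (x₀ : V) :
    ∃ α : ℝ → V, α a = x₀ ∧ ∀ t ∈ Icc a b, HasDerivWithinAt α (A t (α t)) (Icc a b) t := by
  obtain ⟨C, hC⟩ := isCompact_Icc.exists_bound_of_continuousOn hA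
  have hC0 : 0 ≤ C := (norm_nonneg _).trans (hC a ⟨le_rfl, hab⟩)
  refine exists_solution_of_lipschitz (f := fun t x => A t x) (K := ⟨C, hC0⟩) hab (fun t ht => ?_)
    (fun x => hA.clm_apply continuousOn_const) x₀
  exact (A t).lipschitz.weaken (hC t ht)

end ODE

/-! ### Differentiable dependence on initial values -/

section Perturbation

open scoped NNReal

variable {V : Type*} [NormedAddCommGroup V] [NormedSpace ℝ V] [FiniteDimensional ℝ V]

/-- Cutting off near a compact trajectory makes the field globally Lipschitz. Perturbed solutions
then exist on the whole interval, and they solve the original equation as long as they remain in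
`U`. -/
lemma exists_contDiff_hasCompactSupport_eqOn {F : V → V} {O K : Set V} (hO : IsOpen O)
    (hF : ContDiffOn ℝ 1 F O) (hK : IsCompact K) (hKO : K ⊆ O) :
    ∃ G : V → V, ContDiff ℝ 1 G ∧ HasCompactSupport G ∧
      ∃ U, IsOpen U ∧ K ⊆ U ∧ U ⊆ O ∧ EqOn G F U := by
  obtain ⟨L, hL, hKL, hLO⟩ := exists_compact_between hK hO hKO
  obtain ⟨f, hf1, hf0, -⟩ := exists_contMDiffMap_one_nhds_of_subset_interior (I := 𝓘(ℝ, V))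
    (n := 1) hK.isClosed hKL
  obtain ⟨U, hU, hKU, hU1⟩ := mem_nhdsSet_iff_exists.1 hf1
  refine ⟨fun x => f x • F x, ?_, ?_, U ∩ O, hU.inter hO, fun x hx => ⟨hKU hx, hKO hx⟩,
    inter_subset_right, fun x hx => ?_⟩
  · rw [contDiff_iff_contDiffAt]
    intro x
    by_cases hx : x ∈ O
    · exact f.contMDiff.contDiff.contDiffAt.smul (hF.contDiffAt (hO.mem_nhds hx))
    · refine (contDiffAt_const (c := (0 : V))).congr_of_eventuallyEq ?_
      filter_upwards [hL.isClosed.isOpen_compl.mem_nhds fun h => hx (hLO h)] with y hy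
      rw [hf0 y hy, zero_smul]
  · refine HasCompactSupport.intro hL fun x hx => ?_
    rw [hf0 x hx, zero_smul]
  · have : f x = 1 := hU1 hx.1
    simp [this]

lemma gronwallBound_mul (k δ K ε x : ℝ) :
    gronwallBound (k * δ) K (k * ε) x = k * gronwallBound δ K ε x := by
  unfold gronwallBound
  split_ifs <;> ring

/-- Solutions depend differentiably on a one-parameter family of initial values, and the
derivative solves the linearised equation. -/
theorem exists_perturbed_solutions {F : V → V} {O : Set V} (hO : IsOpen O)
    (hF : ContDiffOn ℝ 1 F O) {a b : ℝ} (hab : a ≤ b) {α β : ℝ → V}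
    (hα : ∀ t ∈ Icc a b, HasDerivWithinAt α (F (α t)) (Icc a b) t)
    (hαO : ∀ t ∈ Icc a b, α t ∈ O)
    (hβ : ∀ t ∈ Icc a b, HasDerivWithinAt β (fderiv ℝ F (α t) (β t)) (Icc a b) t)
    {z : ℝ → V} (hz0 : z 0 = α a) (hz : HasDerivAt z (β a) 0) :
    ∃ A : ℝ → ℝ → V, (∀ᶠ s in 𝓝 0, A s a = z s ∧ ∀ t ∈ Icc a b,
      A s t ∈ O ∧ HasDerivWithinAt (A s) (F (A s t)) (Icc a b) t) ∧ A 0 b = α b ∧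
      HasDerivAt (fun s => A s b) (β b) 0 := by
  have := FiniteDimensional.complete ℝ V
  have hαc : ContinuousOn α (Icc a b) := fun t ht => (hα t ht).continuousWithinAt
  have hβc : ContinuousOn β (Icc a b) := fun t ht => (hβ t ht).continuousWithinAt
  have hK : IsCompact (α '' Icc a b) := isCompact_Icc.image_of_continuousOn hαc
  obtain ⟨G, hG, hGc, U, hU, hKU, hUO, hGF⟩ := exists_contDiff_hasCompactSupport_eqOn hO hF hK
    (image_subset_iff.2 hαO)
  obtain ⟨L, hL⟩ := hG.lipschitzWith_of_hasCompactSupport hGc one_ne_zero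
  have hαU : ∀ t ∈ Icc a b, α t ∈ U := fun t ht => hKU (mem_image_of_mem _ ht)
  have hαG : ∀ t ∈ Icc a b, HasDerivWithinAt α (G (α t)) (Icc a b) t := fun t ht => by
    rw [hGF (hαU t ht)]; exact hα t ht
  have hβG : ∀ t ∈ Icc a b, HasDerivWithinAt β (fderiv ℝ G (α t) (β t)) (Icc a b) t := fun t ht => by
    rw [(hGF.eventuallyEq_of_mem (hU.mem_nhds (hαU t ht))).fderiv_eq]; exact hβ t ht
  have hex : ∀ s : ℝ, ∃ A : ℝ → V, A a = z s ∧
      ∀ t ∈ Icc a b, HasDerivWithinAt A (G (A t)) (Icc a b) t := fun s =>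
    exists_solution_of_lipschitz hab (fun _ _ => hL) (fun x => continuousOn_const) (z s)
  choose A hA0 hA using hex
  set C := Real.exp (L * (b - a)) with hC
  have hba : 0 ≤ b - a := sub_nonneg.2 hab
  have hdist : ∀ s, ∀ t ∈ Icc a b, ‖A s t - α t‖ ≤ ‖z s - z 0‖ * C := by
    intro s t ht
    have h := dist_le_of_trajectories_ODE (v := fun _ => G) (f := A s) (g := α) (fun _ => hL)
      (fun t ht => (hA s t ht).continuousWithinAt)
      (fun t ht => (hA s t ⟨ht.1, ht.2.le⟩).Ici_of_Icc ht) hαc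
      (fun t ht => (hαG t ⟨ht.1, ht.2.le⟩).Ici_of_Icc ht) le_rfl t ht
    rw [dist_eq_norm, dist_eq_norm, hA0, ← hz0] at h
    exact h.trans (mul_le_mul_of_nonneg_left (Real.exp_le_exp.2
      (mul_le_mul_of_nonneg_left (by linarith [ht.2]) L.2)) (norm_nonneg _))
  obtain ⟨B, hB0, hB⟩ := hz.isBigO_sub.exists_pos
  rw [Asymptotics.isBigOWith_iff] at hB
  have hzlim : Tendsto (fun s => ‖z s - z 0‖ * C) (𝓝 0) (𝓝 0) := by
    have : Tendsto (fun s => ‖z s - z 0‖ * C) (𝓝 0) (𝓝 (‖z 0 - z 0‖ * C)) :=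
      ((hz.continuousAt.sub continuousAt_const).norm.mul continuousAt_const)
    simpa using this
  have hsmall : ∀ δ > 0, ∀ᶠ s in 𝓝 (0 : ℝ), ∀ t ∈ Icc a b, ‖A s t - α t‖ < δ := by
    intro δ hδ
    filter_upwards [hzlim.eventually (gt_mem_nhds hδ)] with s hs t ht
    exact (hdist s t ht).trans_lt hs
  have hA0b : A 0 b = α b := by
    have := hdist 0 b ⟨hab, le_rfl⟩
    rw [sub_self, norm_zero, zero_mul] at this
    exact sub_eq_zero.1 (norm_le_zero_iff.1 this)
  obtain ⟨δ, hδ, hδU⟩ := hK.exists_thickening_subset_open hU hKU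
  refine ⟨A, ?_, hA0b, ?_⟩
  · filter_upwards [hsmall δ hδ] with s hs
    refine ⟨hA0 s, fun t ht => ?_⟩
    -- By the Gronwall estimate the perturbed solution is uniformly close to `α`, hence in the
    -- region where the cut-off field is the given one.
    have hmem : A s t ∈ U := hδU (Metric.mem_thickening_iff.2
      ⟨α t, mem_image_of_mem _ ht, by rw [dist_eq_norm]; exact hs t ht⟩)
    exact ⟨hUO hmem, by rw [← hGF hmem]; exact hA s t ht⟩
  · set Q := gronwallBound 1 L (B * C) (b - a) with hQ
    have hQ0 : 0 ≤ Q := by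
      have h1 := gronwallBound_mono (δ := 1) (K := L) (ε := B * C) zero_le_one (by positivity)
        L.2 hba
      rw [gronwallBound_x0] at h1
      linarith
    have huc := (hGc.fderiv ℝ).uniformContinuous_of_continuous (hG.continuous_fderiv one_ne_zero)
    have hop : ∀ x, ‖fderiv ℝ G x‖ ≤ L := fun x => norm_fderiv_le_of_lipschitz ℝ hL
    rw [hasDerivAt_iff_isLittleO, Asymptotics.isLittleO_iff]
    intro η hη
    -- `Q` is the Gronwall constant for the error `A s - α - s β`, which will be at most `ε ‖s‖ Q`
    -- at time `b`. The summand `1` guards against `Q = 0`.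
    set ε := η / (Q + 1) with hε
    have hε0 : 0 < ε := by positivity
    obtain ⟨δ', hδ', hucδ⟩ := Metric.uniformContinuous_iff.1 huc ε hε0
    have hlo := (hasDerivAt_iff_isLittleO.1 hz).def hε0
    filter_upwards [hsmall δ' hδ', hB, hlo] with s hs hBs hlos
    simp only [sub_zero] at hBs hlos ⊢
    have he : ∀ t ∈ Icc a b, HasDerivWithinAt (fun t => A s t - α t - s • β t)
        (G (A s t) - G (α t) - s • fderiv ℝ G (α t) (β t)) (Icc a b) t := fun t ht =>
      ((hA s t ht).sub (hαG t ht)).sub ((hβG t ht).const_smul s)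
    have hbound : ∀ t ∈ Icc a b, ‖G (A s t) - G (α t) - s • fderiv ℝ G (α t) (β t)‖ ≤
        L * ‖A s t - α t - s • β t‖ + (ε * ‖s‖) * (B * C) := by
      intro t ht
      -- The mean value inequality on a ball whose radius `δ'` is the same for all `t`, by uniform
      -- continuity of the compactly supported derivative.
      have h1 : ‖G (A s t) - G (α t) - fderiv ℝ G (α t) (A s t - α t)‖ ≤ ε * ‖A s t - α t‖ := by
        refine Convex.norm_image_sub_le_of_norm_fderiv_le' (s := Metric.ball (α t) δ')
          (fun x _ => (hG.differentiable one_ne_zero) x) (fun x hx => ?_) (convex_ball _ _)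
          (Metric.mem_ball_self hδ') (by rw [mem_ball_iff_norm]; exact hs t ht)
        rw [← dist_eq_norm]
        exact (hucδ hx).le
      have h2 : G (A s t) - G (α t) - s • fderiv ℝ G (α t) (β t) =
          (G (A s t) - G (α t) - fderiv ℝ G (α t) (A s t - α t)) +
            fderiv ℝ G (α t) (A s t - α t - s • β t) := by
        rw [map_sub (fderiv ℝ G (α t)) (A s t - α t), map_smul]; abel
      have h3 := (fderiv ℝ G (α t)).le_of_opNorm_le (hop (α t)) (A s t - α t - s • β t)
      have h4 := (hdist s t ht).trans (mul_le_mul_of_nonneg_right hBs (Real.exp_pos _).le)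
      rw [h2]
      refine (norm_add_le _ _).trans ?_
      have h5 : ε * ‖A s t - α t‖ ≤ ε * (B * ‖s‖ * C) := by gcongr
      linarith
    have hfin := norm_le_gronwallBound_of_norm_deriv_right_le
      (f := fun t => A s t - α t - s • β t) (δ := ε * ‖s‖)
      (fun t ht => (he t ht).continuousWithinAt)
      (fun t ht => (he t ⟨ht.1, ht.2.le⟩).Ici_of_Icc ht) (by
        rw [hA0, ← hz0]; exact hlos) (fun t ht => hbound t ⟨ht.1, ht.2.le⟩) b ⟨hab, le_rfl⟩
    have hg := gronwallBound_mul (ε * ‖s‖) 1 L (B * C) (b - a)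
    rw [mul_one] at hg
    rw [hg, ← hQ] at hfin
    rw [hA0b]
    refine hfin.trans ?_
    have : ε * Q ≤ η := by
      rw [hε, div_mul_eq_mul_div, div_le_iff₀ (by positivity)]
      nlinarith
    nlinarith [norm_nonneg s]

end Perturbation

/-! ### The matrix Jacobi equation and its boundary term -/

section IndexForm

set_option linter.unusedSectionVars false

open scoped RealInnerProductSpace

variable {F : Type*} [NormedAddCommGroup F] [InnerProductSpace ℝ F] [FiniteDimensional ℝ F]

/-- `A` is the solution of the Jacobi equation `A'' = -K A` on `[0, l]` with `A(0) = 0`,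
`A'(0) = 1`, where `K` is symmetric, and `B = A'`. -/
structure IsJacobiTensor (l : ℝ) (K A B : ℝ → F →L[ℝ] F) : Prop where
  continuousOn : ContinuousOn K (Icc 0 l)
  symm : ∀ t ∈ Icc 0 l, ∀ u v, ⟪K t u, v⟫ = ⟪u, K t v⟫
  deriv_A : ∀ t ∈ Icc 0 l, HasDerivWithinAt A (B t) (Icc 0 l) t
  deriv_B : ∀ t ∈ Icc 0 l, HasDerivWithinAt B (-(K t * A t)) (Icc 0 l) t
  A_zero : A 0 = 0
  B_zero : B 0 = 1

/-- Reduction to the first-order linear system for the pair of value and derivative. -/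
lemma exists_solution_second_order {W : Type*} [NormedAddCommGroup W] [NormedSpace ℝ W]
    [CompleteSpace W] {k : ℝ → W →L[ℝ] W} {a b : ℝ} (hab : a ≤ b) (hk : ContinuousOn k (Icc a b))
    (x v : W) : ∃ α β : ℝ → W, α a = x ∧ β a = v ∧
      (∀ t ∈ Icc a b, HasDerivWithinAt α (β t) (Icc a b) t) ∧
      ∀ t ∈ Icc a b, HasDerivWithinAt β (-(k t (α t))) (Icc a b) t := by
  set L : ℝ → W × W →L[ℝ] W × W := fun t =>
    (ContinuousLinearMap.inl ℝ W W).comp (ContinuousLinearMap.snd ℝ W W) -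
      (ContinuousLinearMap.inr ℝ W W).comp ((k t).comp (ContinuousLinearMap.fst ℝ W W)) with hL
  have hLc : ContinuousOn L (Icc a b) :=
    continuousOn_const.sub (continuousOn_const.clm_comp (hk.clm_comp continuousOn_const))
  obtain ⟨α, h0, hα⟩ := exists_solution_of_linear hab hLc (x, v)
  refine ⟨fun t => (α t).1, fun t => (α t).2, by simp [h0], by simp [h0], fun t ht => ?_,
    fun t ht => ?_⟩
  · have := (hα t ht).hasFDerivWithinAt.fst.hasDerivWithinAt
    simpa [L] using this
  · have := (hα t ht).hasFDerivWithinAt.snd.hasDerivWithinAt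
    simpa [L] using this

lemma exists_isJacobiTensor {l : ℝ} (hl : 0 ≤ l) {K : ℝ → F →L[ℝ] F}
    (hK : ContinuousOn K (Icc 0 l)) (hs : ∀ t ∈ Icc 0 l, ∀ u v, ⟪K t u, v⟫ = ⟪u, K t v⟫) :
    ∃ A B, IsJacobiTensor l K A B := by
  have := FiniteDimensional.complete ℝ F
  obtain ⟨A, B, hA0, hB0, hA, hB⟩ := exists_solution_second_order hl
    ((ContinuousLinearMap.mul ℝ (F →L[ℝ] F)).continuous.comp_continuousOn hK) 0 1
  exact ⟨A, B, hK, hs, hA, hB, hA0, hB0⟩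

namespace IsJacobiTensor

variable {l : ℝ} {K A B : ℝ → F →L[ℝ] F} (hJ : IsJacobiTensor l K A B)
  (hinj : ∀ t ∈ Ioc 0 l, Function.Injective (A t))

include hJ

/-- The Wronskian `⟪A u, B v⟫ - ⟪B u, A v⟫` has derivative zero because `K` is symmetric, and it
vanishes at time `0`. -/
lemma inner_comm {t : ℝ} (ht : t ∈ Icc 0 l) (u v : F) : ⟪A t u, B t v⟫ = ⟪B t u, A t v⟫ := by
  have hd : ∀ s ∈ Icc 0 t, HasDerivWithinAt (fun s => ⟪A s u, B s v⟫ - ⟪B s u, A s v⟫) 0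
      (Icc 0 t) s := fun s hs => by
    have hs' : s ∈ Icc 0 l := ⟨hs.1, hs.2.trans ht.2⟩
    have hA : ∀ u, HasDerivWithinAt (fun s => A s u) (B s u) (Icc 0 l) s := fun u => by
      simpa using (hJ.deriv_A s hs').clm_apply (hasDerivWithinAt_const _ _ u)
    have hB : ∀ u, HasDerivWithinAt (fun s => B s u) (-(K s (A s u))) (Icc 0 l) s := fun u => by
      simpa using (hJ.deriv_B s hs').clm_apply (hasDerivWithinAt_const _ _ u)
    refine ((((hA u).inner ℝ (hB v)).sub ((hB u).inner ℝ (hA v))).mono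
      (Icc_subset_Icc_right ht.2)).congr_deriv ?_
    rw [inner_neg_left, inner_neg_right, hJ.symm s hs']
    ring
  have := constant_of_has_deriv_right_zero (fun s hs => (hd s hs).continuousWithinAt)
    (fun s hs => (hd s ⟨hs.1, hs.2.le⟩).Ici_of_Icc hs) t ⟨ht.1, le_rfl⟩
  rw [hJ.A_zero] at this
  simpa [sub_eq_zero] using this

include hinj

lemma isUnit {t : ℝ} (ht : t ∈ Ioc 0 l) : IsUnit (A t) := by
  have := FiniteDimensional.complete ℝ F
  rw [ContinuousLinearMap.isUnit_iff_bijective]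
  exact ⟨hinj t ht, (LinearMap.injective_iff_surjective (f := (A t : F →ₗ[ℝ] F))).1 (hinj t ht)⟩

lemma apply_inverse {t : ℝ} (ht : t ∈ Ioc 0 l) (u : F) : A t (Ring.inverse (A t) u) = u := by
  have := Ring.mul_inverse_cancel _ (hJ.isUnit hinj ht)
  exact congrArg (fun L : F →L[ℝ] F => L u) this

/-- With `z = A c` one has `z' = B c + A c'`. Differentiating `⟪B c, z⟫` and using the symmetry of
the Wronskian, the index integrand of `z` is this derivative plus the square `|A c'|²`. -/
lemma hasDerivAt_boundary {t : ℝ} (ht : t ∈ Ioo 0 l) {z : ℝ → F} {z' : F}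
    (hz : HasDerivAt z z' t) : ∃ c', HasDerivAt (fun s => Ring.inverse (A s) (z s)) c' t ∧
      HasDerivAt (fun s => ⟪B s (Ring.inverse (A s) (z s)), z s⟫)
        (⟪z', z'⟫ - ⟪K t (z t), z t⟫ - ⟪A t c', A t c'⟫) t := by
  have := FiniteDimensional.complete ℝ F
  have ht' : t ∈ Icc 0 l := ⟨ht.1.le, ht.2.le⟩
  have hA := (hJ.deriv_A t ht').hasDerivAt (Icc_mem_nhds ht.1 ht.2)
  have hB := (hJ.deriv_B t ht').hasDerivAt (Icc_mem_nhds ht.1 ht.2)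
  have hinv : DifferentiableAt ℝ (fun s => Ring.inverse (A s)) t :=
    (differentiableAt_inverse (hJ.isUnit hinj ⟨ht.1, ht.2.le⟩)).comp t hA.differentiableAt
  set c := fun s => Ring.inverse (A s) (z s) with hc
  have hcd : HasDerivAt c (deriv c t) t :=
    (hinv.clm_apply hz.differentiableAt).hasDerivAt
  refine ⟨deriv c t, hcd, ?_⟩
  have hzc : ∀ s ∈ Ioc 0 l, A s (c s) = z s := fun s hs => hJ.apply_inverse hinj hs _
  have hz' : z' = B t (c t) + A t (deriv c t) := by
    refine hz.unique ((hA.clm_apply hcd).congr_of_eventuallyEq ?_)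
    filter_upwards [Ioo_mem_nhds ht.1 ht.2] with s hs
    exact (hzc s ⟨hs.1, hs.2.le⟩).symm
  refine ((hB.clm_apply hcd).inner ℝ hz).congr_deriv ?_
  rw [hz', ← hzc t ⟨ht.1, ht.2.le⟩]
  simp only [neg_apply, mul_apply_eq_comp, inner_add_left, inner_add_right,
    inner_neg_left]
  have h1 := hJ.inner_comm ht' (deriv c t) (c t)
  rw [← h1, real_inner_comm (B t (c t)) (A t (deriv c t))]
  ring

lemma continuousOn_inverse : ContinuousOn (fun s => Ring.inverse (A s)) (Ioc 0 l) := by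
  have := FiniteDimensional.complete ℝ F
  intro t ht
  exact (differentiableAt_inverse (𝕜 := ℝ) (hJ.isUnit hinj ht)).continuousAt.comp_continuousWithinAt
    ((hJ.deriv_A t ⟨ht.1.le, ht.2⟩).continuousWithinAt.mono Ioc_subset_Icc_self)

/-- The only difficulty is time `0`, where `A` is not invertible in positive dimension. There `A(s)
= s + o(s)` while `z(s) = O(s)`, so `A(s)⁻¹ z(s)` stays bounded and the boundary term tends to `0`
with `z`. -/
lemma continuousOn_boundary {p q : ℝ} (hp : 0 ≤ p) (hq : q ≤ l) {z : ℝ → F}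
    (hz : ContDiffOn ℝ 1 z (Icc p q)) (hpq : p < q) (hz0 : z 0 = 0) :
    ContinuousOn (fun s => ⟪B s (Ring.inverse (A s) (z s)), z s⟫) (Icc p q) := by
  have hBc : ContinuousOn B (Icc 0 l) := fun t ht => (hJ.deriv_B t ht).continuousWithinAt
  have hsub : Icc p q ⊆ Icc 0 l := Icc_subset_Icc hp hq
  intro t ht
  rcases (hp.trans ht.1).eq_or_lt with rfl | h0
  · have hp0 : p = 0 := le_antisymm ht.1 hp
    subst hp0
    have hA := (hJ.deriv_A 0 ⟨le_rfl, hpq.le.trans hq⟩).mono hsub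
    rw [hJ.B_zero] at hA
    have hzd := ((hz.differentiableOn one_ne_zero) 0 ht).hasDerivWithinAt
    have hAo := (hasDerivWithinAt_iff_isLittleO.1 hA).def (c := 1 / 2) (by norm_num)
    obtain ⟨C, hC0, hC⟩ := hzd.isBigO_sub.exists_pos
    rw [Asymptotics.isBigOWith_iff, Filter.prod_pure, Filter.eventually_map] at hC
    have hB1 : ∀ᶠ s in 𝓝[Icc 0 q] (0 : ℝ), ‖B s‖ < ‖B 0‖ + 1 :=
      (((hBc.mono hsub) 0 ht).norm).eventually (gt_mem_nhds (lt_add_one _))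
    have hbound : ∀ᶠ s in 𝓝[Icc 0 q] (0 : ℝ), ‖⟪B s (Ring.inverse (A s) (z s)), z s⟫‖ ≤
        (‖B 0‖ + 1) * (2 * C) * ‖z s‖ := by
      filter_upwards [hAo, hC, hB1, self_mem_nhdsWithin] with s hAs hCs hBs hs
      simp only [hJ.A_zero, hz0, sub_zero, Real.norm_eq_abs, abs_of_nonneg hs.1] at hAs hCs
      rcases hs.1.eq_or_lt with rfl | hs0
      · simp [hz0]
      set c := Ring.inverse (A s) (z s) with hc
      have hAc : A s c = z s := hJ.apply_inverse hinj ⟨hs0, hs.2.trans hq⟩ _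
      have h1 : ‖A s c - s • c‖ ≤ 1 / 2 * s * ‖c‖ := by
        have := (A s - s • (1 : F →L[ℝ] F)).le_of_opNorm_le hAs c
        simpa using this
      have h2 : ‖s • c‖ ≤ ‖A s c‖ + ‖A s c - s • c‖ := by
        have := norm_sub_le (A s c) (A s c - s • c)
        simpa using this
      rw [norm_smul, Real.norm_eq_abs, abs_of_pos hs0, hAc] at h2
      rw [hAc] at h1
      have h3 : ‖c‖ ≤ 2 * C := by
        by_contra hcon
        push Not at hcon
        nlinarith
      calc ‖⟪B s c, z s⟫‖ ≤ ‖B s c‖ * ‖z s‖ := norm_inner_le_norm _ _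
        _ ≤ (‖B s‖ * ‖c‖) * ‖z s‖ := by gcongr; exact (B s).le_opNorm c
        _ ≤ _ := by gcongr
    have hlim : Tendsto (fun s => (‖B 0‖ + 1) * (2 * C) * ‖z s‖) (𝓝[Icc 0 q] 0) (𝓝 0) := by
      have := (hz.continuousOn 0 ht).norm.const_mul ((‖B 0‖ + 1) * (2 * C))
      simpa [hz0, ContinuousWithinAt] using this
    have h0 : ⟪B 0 (Ring.inverse (A 0) (z 0)), z 0⟫ = 0 := by simp [hz0]
    unfold ContinuousWithinAt
    beta_reduce
    rw [h0]
    exact squeeze_zero_norm' hbound hlim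
  · have hc := (hJ.continuousOn_inverse hinj) t ⟨h0, ht.2.trans hq⟩
    have hmem : Ioc 0 l ∈ 𝓝[Icc p q] t := by
      filter_upwards [self_mem_nhdsWithin, mem_nhdsWithin_of_mem_nhds (Ioi_mem_nhds h0)] with s h1 h2
      exact ⟨h2, h1.2.trans hq⟩
    have hzc := hz.continuousOn t ht
    exact (((hBc t (hsub ht)).mono hsub).clm_apply
      ((hc.mono_of_mem_nhdsWithin hmem).clm_apply hzc)).inner hzc

end IsJacobiTensor

end IndexForm

/-! ### The index comparison in a Euclidean space -/

section IndexComparison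

set_option linter.unusedSectionVars false

open scoped RealInnerProductSpace

variable {F : Type*} [NormedAddCommGroup F] [InnerProductSpace ℝ F] [FiniteDimensional ℝ F]

/-- The integrand of the index form. -/
def indexIntegrand (K : ℝ → F →L[ℝ] F) (x : ℝ → F) (t : ℝ) : ℝ :=
  ⟪deriv x t, deriv x t⟫ - ⟪K t (x t), x t⟫

variable {K : ℝ → F →L[ℝ] F} {l p q : ℝ} {x : ℝ → F}

lemma continuousOn_indexIntegrand (hK : ContinuousOn K (Icc 0 l)) (hp : 0 ≤ p) (hq : q ≤ l)
    (hx : ContDiffOn ℝ 1 x (Icc p q)) : ContinuousOn (indexIntegrand K x) (Ioo p q) := by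
  have hx' : ContDiffOn ℝ 1 x (Ioo p q) := hx.mono Ioo_subset_Icc_self
  have hd := hx'.continuousOn_deriv_of_isOpen isOpen_Ioo le_rfl
  exact (hd.inner hd).sub (((hK.mono fun t ht => ⟨hp.trans ht.1.le, ht.2.le.trans hq⟩).clm_apply
    hx'.continuousOn).inner hx'.continuousOn)

lemma intervalIntegrable_indexIntegrand (hK : ContinuousOn K (Icc 0 l)) (hp : 0 ≤ p) (hpq : p < q)
    (hq : q ≤ l) (hx : ContDiffOn ℝ 1 x (Icc p q)) :
    IntervalIntegrable (indexIntegrand K x) MeasureTheory.volume p q := by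
  have hd := hx.continuousOn_derivWithin (uniqueDiffOn_Icc hpq) le_rfl
  have hc : ContinuousOn (fun t => ⟪derivWithin x (Icc p q) t, derivWithin x (Icc p q) t⟫
      - ⟪K t (x t), x t⟫) (Icc p q) :=
    (hd.inner hd).sub (((hK.mono (Icc_subset_Icc hp hq)).clm_apply
      hx.continuousOn).inner hx.continuousOn)
  refine (hc.intervalIntegrable_of_Icc hpq.le).congr_uIoo fun t ht => ?_
  rw [uIoo_of_lt hpq] at ht
  simp only [indexIntegrand, derivWithin_of_mem_nhds (Icc_mem_nhds ht.1 ht.2)]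

namespace IsJacobiTensor

variable {A B : ℝ → F →L[ℝ] F} (hJ : IsJacobiTensor l K A B)
  (hinj : ∀ t ∈ Ioc 0 l, Function.Injective (A t)) {y w : ℝ → F}
  (hy : ∀ t ∈ Icc 0 l, HasDerivWithinAt y (w t) (Icc 0 l) t)
  (hw : ∀ t ∈ Icc 0 l, HasDerivWithinAt w (-(K t (y t))) (Icc 0 l) t)

include hJ hy hw in
lemma contDiffOn_solution (hpl : p < q) (hp : 0 ≤ p) (hq : q ≤ l) : ContDiffOn ℝ 1 y (Icc p q) := by
  have hs : Icc p q ⊆ Icc 0 l := Icc_subset_Icc hp hq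
  rw [show (1 : ℕ∞ω) = 0 + 1 from rfl, contDiffOn_succ_iff_derivWithin (uniqueDiffOn_Icc hpl)]
  have hd : ∀ t ∈ Icc p q, HasDerivWithinAt y (w t) (Icc p q) t := fun t ht =>
    (hy t (hs ht)).mono hs
  refine ⟨fun t ht => (hd t ht).differentiableWithinAt, by simp, ?_⟩
  rw [contDiffOn_zero]
  refine ContinuousOn.congr (f := w) (fun t ht => ((hw t (hs ht)).mono hs).continuousWithinAt)
    fun t ht => (hd t ht).derivWithin (uniqueDiffOn_Icc hpl t ht)

/-- The difference of the index integrals over `[0, t]`, up to boundary terms. -/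
def indexDefect (K A B : ℝ → F →L[ℝ] F) (x y w : ℝ → F) (t : ℝ) : ℝ :=
  (∫ s in (0 : ℝ)..t, (indexIntegrand K x s - indexIntegrand K y s)) - 2 * ⟪w t, x t - y t⟫
    - ⟪B t (Ring.inverse (A t) (x t - y t)), x t - y t⟫

include hJ hinj hy hw

lemma continuousOn_indexDefect (hp : 0 ≤ p) (hpq : p < q) (hq : q ≤ l)
    (hx : ContDiffOn ℝ 1 x (Icc p q)) (h0 : x 0 - y 0 = 0)
    (hint : IntervalIntegrable (fun s => indexIntegrand K x s - indexIntegrand K y s)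
      MeasureTheory.volume 0 l) : ContinuousOn (indexDefect K A B x y w) (Icc p q) := by
  have hz := hx.sub (hJ.contDiffOn_solution hy hw hpq hp hq)
  have hs : Icc p q ⊆ Icc 0 l := Icc_subset_Icc hp hq
  have hl : 0 ≤ l := hp.trans (hpq.le.trans hq)
  have h1 := intervalIntegral.continuousOn_primitive_interval' hint (left_mem_uIcc)
  rw [uIcc_of_le hl] at h1
  have hwc : ContinuousOn w (Icc p q) := fun t ht => ((hw t (hs ht)).mono hs).continuousWithinAt
  exact ((h1.mono hs).sub (continuousOn_const.mul (hwc.inner hz.continuousOn))).sub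
    (hJ.continuousOn_boundary hinj hp hq hz hpq h0)

/-- With `z = x - y`, the integrands differ by `|z'|² - ⟪K z, z⟫ + 2(⟪w, z'⟫ - ⟪K y, z⟫)`. The last
bracket is the derivative of `⟪w, z⟫` by the equation for `y`; `hasDerivAt_boundary` treats the
quadratic part, and `|A c'|²` is left over. -/
lemma hasDerivAt_indexDefect (hp : 0 ≤ p) (hq : q ≤ l)
    (hx : ContDiffOn ℝ 1 x (Icc p q))
    (hint : IntervalIntegrable (fun s => indexIntegrand K x s - indexIntegrand K y s)
      MeasureTheory.volume 0 l) {t : ℝ} (ht : t ∈ Ioo p q) :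
    ∃ c', HasDerivAt (fun s => Ring.inverse (A s) (x s - y s)) c' t ∧
      HasDerivAt (indexDefect K A B x y w) ⟪A t c', A t c'⟫ t := by
  have htl : t ∈ Ioo 0 l := ⟨hp.trans_lt ht.1, ht.2.trans_le hq⟩
  have htl' : t ∈ Icc 0 l := Ioo_subset_Icc_self htl
  have hpq := ht.1.trans ht.2
  have hyC := hJ.contDiffOn_solution hy hw hpq hp hq
  have hxd : HasDerivAt x (deriv x t) t :=
    ((hx.contDiffAt (Icc_mem_nhds ht.1 ht.2)).differentiableAt one_ne_zero).hasDerivAt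
  have hyd := (hy t htl').hasDerivAt (Icc_mem_nhds htl.1 htl.2)
  have hwd := (hw t htl').hasDerivAt (Icc_mem_nhds htl.1 htl.2)
  obtain ⟨c', hc, hb⟩ := hJ.hasDerivAt_boundary hinj htl (hxd.sub hyd)
  refine ⟨c', hc, ?_⟩
  have hcont := (continuousOn_indexIntegrand hJ.continuousOn hp hq hx).sub
    (continuousOn_indexIntegrand hJ.continuousOn hp hq hyC)
  have hI := intervalIntegral.integral_hasDerivAt_right
    (hint.mono_set (by
      rw [uIcc_of_le htl'.1, uIcc_of_le (htl'.1.trans htl'.2)]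
      exact Icc_subset_Icc_right htl'.2))
    (hcont.stronglyMeasurableAtFilter isOpen_Ioo t ht)
    (hcont.continuousAt (isOpen_Ioo.mem_nhds ht))
  refine ((hI.sub ((hwd.inner ℝ (hxd.sub hyd)).const_mul 2)).sub hb).congr_deriv ?_
  simp only [indexIntegrand, Pi.sub_apply, hyd.deriv, map_sub, inner_sub_left, inner_sub_right,
    inner_neg_left]
  have h1 : ⟪K t (x t), y t⟫ = ⟪K t (y t), x t⟫ := by rw [hJ.symm t htl', real_inner_comm]
  have h2 := real_inner_comm (w t) (deriv x t)
  linarith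

/-- The defect vanishes at `0` and equals the difference of the two integrals at `l`, since `x - y`
vanishes at both ends. It is nondecreasing on every piece of the subdivision, its derivative being
the square `|A c'|²`. Equality makes it constant, so `c' = 0` by injectivity of `A`. -/
theorem index_comparison (hl : 0 < l) {n : ℕ} {a : Fin (n + 1) → ℝ} (ha : StrictMono a)
    (ha0 : a 0 = 0) (hal : a (Fin.last n) = l)
    (hx : ∀ i : Fin n, ContDiffOn ℝ 1 x (Icc (a i.castSucc) (a i.succ)))
    (h0 : x 0 = y 0) (hxl : x l = y l) :
    (∫ t in (0 : ℝ)..l, indexIntegrand K y t) ≤ ∫ t in (0 : ℝ)..l, indexIntegrand K x t ∧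
      ((∫ t in (0 : ℝ)..l, indexIntegrand K x t) = ∫ t in (0 : ℝ)..l, indexIntegrand K y t ↔
        ∀ t ∈ Icc 0 l, x t = y t) := by
  have ha0' : ∀ i, 0 ≤ a i := fun i => ha0 ▸ ha.monotone (Fin.zero_le i)
  have hal' : ∀ i, a i ≤ l := fun i => hal ▸ ha.monotone (Fin.le_last i)
  have hlt : ∀ i : Fin n, a i.castSucc < a i.succ := fun i => ha Fin.castSucc_lt_succ
  have hyi : IntervalIntegrable (indexIntegrand K y) MeasureTheory.volume 0 l :=
    intervalIntegrable_indexIntegrand hJ.continuousOn le_rfl hl le_rfl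
      (hJ.contDiffOn_solution hy hw hl le_rfl le_rfl)
  have hxi : IntervalIntegrable (indexIntegrand K x) MeasureTheory.volume 0 l := by
    have : ∀ i, IntervalIntegrable (indexIntegrand K x) MeasureTheory.volume 0 (a i) := by
      intro i
      induction i using Fin.induction with
      | zero => rw [ha0]
      | succ i ih => exact ih.trans (intervalIntegrable_indexIntegrand hJ.continuousOn (ha0' _)
          (hlt i) (hal' _) (hx i))
    exact hal ▸ this (Fin.last n)
  have hint := hxi.sub hyi
  set H := indexDefect K A B x y w with hH
  have hz0 : x 0 - y 0 = 0 := sub_eq_zero.2 h0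
  have hH0 : H 0 = 0 := by simp [hH, indexDefect, hz0]
  have hHl : H l = (∫ t in (0 : ℝ)..l, indexIntegrand K x t) -
      ∫ t in (0 : ℝ)..l, indexIntegrand K y t := by
    simp [hH, indexDefect, sub_eq_zero.2 hxl, intervalIntegral.integral_sub hxi hyi]
  have hcont : ∀ i : Fin n, ContinuousOn H (Icc (a i.castSucc) (a i.succ)) := fun i =>
    hJ.continuousOn_indexDefect hinj hy hw (ha0' _) (hlt i) (hal' _) (hx i) hz0 hint
  have hder : ∀ i : Fin n, ∀ t ∈ Ioo (a i.castSucc) (a i.succ), _ := fun i t ht =>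
    hJ.hasDerivAt_indexDefect hinj hy hw (ha0' _) (hal' _) (hx i) hint ht
  have hmono : ∀ i : Fin n, MonotoneOn H (Icc (a i.castSucc) (a i.succ)) := fun i => by
    refine monotoneOn_of_deriv_nonneg (convex_Icc _ _) (hcont i) ?_ ?_
    · rw [interior_Icc]
      intro t ht
      obtain ⟨c', -, h⟩ := hder i t ht
      exact h.differentiableAt.differentiableWithinAt
    · rw [interior_Icc]
      intro t ht
      obtain ⟨c', -, h⟩ := hder i t ht
      rw [h.deriv]
      exact real_inner_self_nonneg
  have hmonoa : Monotone fun i => H (a i) := Fin.monotone_iff_le_succ.2 fun i =>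
    hmono i ⟨le_rfl, (hlt i).le⟩ ⟨(hlt i).le, le_rfl⟩ (hlt i).le
  refine ⟨?_, fun heq => ?_, fun heq => ?_⟩
  · have := hmonoa (Fin.zero_le (Fin.last n))
    simp only [ha0, hal, hH0, hHl] at this
    linarith
  · have hHa : ∀ i, H (a i) = 0 := fun i => by
      have h1 := hmonoa (Fin.zero_le i)
      have h2 := hmonoa (Fin.le_last i)
      simp only [ha0, hal, hH0, hHl, heq, sub_self] at h1 h2
      exact le_antisymm h2 h1
    have hHzero : ∀ i : Fin n, ∀ t ∈ Icc (a i.castSucc) (a i.succ), H t = 0 := fun i t ht => by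
      have h1 := hmono i ⟨le_rfl, (hlt i).le⟩ ht ht.1
      have h2 := hmono i ht ⟨(hlt i).le, le_rfl⟩ ht.2
      rw [hHa] at h1 h2
      exact le_antisymm h2 h1
    -- On one piece `c = A⁻¹ (x - y)` is constant, so a zero of `x - y` at the right end makes it
    -- vanish throughout. The propagation goes backwards from `l` because `A` carries no information
    -- at `0`.
    have hstep : ∀ i : Fin n, x (a i.succ) - y (a i.succ) = 0 →
        ∀ t ∈ Icc (a i.castSucc) (a i.succ), x t - y t = 0 := by
      intro i hi
      have hz := (hx i).sub (hJ.contDiffOn_solution hy hw (hlt i) (ha0' _) (hal' _))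
      have hc' : ∀ t ∈ Ioo (a i.castSucc) (a i.succ),
          HasDerivAt (fun s => Ring.inverse (A s) (x s - y s)) 0 t := by
        intro t ht
        obtain ⟨c', h1, h2⟩ := hder i t ht
        have h3 : HasDerivAt H 0 t := (hasDerivAt_const t (0 : ℝ)).congr_of_eventuallyEq (by
          filter_upwards [Ioo_mem_nhds ht.1 ht.2] with s hs
          exact hHzero i s (Ioo_subset_Icc_self hs))
        have h4 := inner_self_eq_zero.1 (h2.unique h3)
        have h5 : c' = 0 := hinj t ⟨(ha0' _).trans_lt ht.1, ht.2.le.trans (hal' _)⟩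
          (by rw [h4, map_zero])
        rwa [h5] at h1
      have hopen : ∀ t ∈ Ioc (a i.castSucc) (a i.succ), x t - y t = 0 := by
        intro t ht
        have hsub : Icc t (a i.succ) ⊆ Ioc 0 l := fun s hs =>
          ⟨(ha0' _).trans_lt (ht.1.trans_le hs.1), hs.2.trans (hal' _)⟩
        have hcc : ContinuousOn (fun s => Ring.inverse (A s) (x s - y s)) (Icc t (a i.succ)) :=
          ((hJ.continuousOn_inverse hinj).mono hsub).clm_apply
            (hz.continuousOn.mono (Icc_subset_Icc_left ht.1.le))
        have := constant_of_has_deriv_right_zero hcc (fun s hs =>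
          (hc' s ⟨ht.1.trans_le hs.1, hs.2⟩).hasDerivWithinAt) (a i.succ) ⟨ht.2, le_rfl⟩
        rw [hi, map_zero] at this
        have h6 := hJ.apply_inverse hinj (hsub ⟨le_rfl, ht.2⟩) (x t - y t)
        rw [← this, map_zero] at h6
        exact h6.symm
      intro t ht
      rcases ht.1.eq_or_lt with rfl | hlt'
      -- The left end may be `0`, where `A` cannot be inverted; there the value is obtained by
      -- continuity.
      · have hcl : a i.castSucc ∈ closure (Ioc (a i.castSucc) (a i.succ)) := by
          rw [closure_Ioc (hlt i).ne]; exact ⟨le_rfl, (hlt i).le⟩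
        have hcw := (hz.continuousOn _ ht).mono Ioc_subset_Icc_self
        have := hcw.mem_closure_image hcl
        have h7 : (fun s => x s - y s) '' Ioc (a i.castSucc) (a i.succ) ⊆ {0} := by
          rintro _ ⟨s, hs, rfl⟩
          exact hopen s hs
        have h8 := closure_mono h7 this
        simpa using h8
      · exact hopen t ⟨hlt', ht.2⟩
    have hends : ∀ i, x (a i) - y (a i) = 0 := by
      intro i
      induction i using Fin.reverseInduction with
      | last => rw [hal, sub_eq_zero]; exact hxl
      | cast i ih => exact hstep i ih _ ⟨le_rfl, (hlt i).le⟩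
    intro t ht
    have hcover : ∀ i, ∀ t ∈ Icc 0 (a i), x t - y t = 0 := by
      intro i
      induction i using Fin.induction with
      | zero =>
        intro t ht
        rw [ha0] at ht
        rw [le_antisymm ht.2 ht.1, hz0]
      | succ i ih =>
        intro t ht
        rcases le_total t (a i.castSucc) with h | h
        · exact ih t ⟨ht.1, h⟩
        · exact hstep i (hends _) t ⟨h, ht.2⟩
    exact sub_eq_zero.1 (hcover (Fin.last n) t (by rwa [hal]))
  · refine intervalIntegral.integral_congr_Ioo_of_le hl.le fun t ht => ?_
    have hev : x =ᶠ[𝓝 t] y := by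
      filter_upwards [Ioo_mem_nhds ht.1 ht.2] with s hs
      exact heq s (Ioo_subset_Icc_self hs)
    simp only [indexIntegrand, hev.deriv_eq, hev.self_of_nhds]

end IsJacobiTensor

end IndexComparison

/-! ### Parallel transport along geodesics -/

section ParallelTransport

set_option linter.unusedSectionVars false

variable {E : Type*} [NormedAddCommGroup E] [NormedSpace ℝ E] [FiniteDimensional ℝ E]
  {M : Type*} [TopologicalSpace M] [ChartedSpace E M] [IsManifold 𝓘(ℝ, E) ∞ M]

/-- Induction along a curve, in steps contained in a chart. -/
lemma Icc_induction_of_charts {γ : ℝ → M} {l : ℝ} (hγ : ContinuousOn γ (Icc 0 l))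
    {Q : ℝ → Prop} (h0 : Q 0)
    (hstep : ∀ a b x₀, 0 ≤ a → a ≤ b → b ≤ l →
      (∀ t ∈ Icc a b, γ t ∈ (chartAt E x₀).source) → Q a → Q b) {t : ℝ} (ht : t ∈ Icc 0 l) :
    Q t := by
  have hγt : ContinuousOn γ (Icc 0 t) := hγ.mono (Icc_subset_Icc_right ht.2)
  -- By compactness a finite subdivision of `[0, t]` has each piece mapped into the source of one
  -- chart.
  obtain ⟨p, hp0, hpm, ⟨N, hN⟩, hp⟩ := exists_monotone_Icc_subset_open_cover_Icc ht.1
    (c := fun x₀ : M => {s : Icc (0 : ℝ) t | γ s ∈ (chartAt E x₀).source})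
    (fun x₀ => (chartAt E x₀).open_source.preimage hγt.domRestrict)
    (fun s _ => mem_iUnion.2 ⟨γ s, mem_chart_source E (γ s)⟩)
  have h : ∀ n, Q (p n) := by
    intro n
    induction n with
    | zero => rwa [hp0]
    | succ n ih =>
      obtain ⟨x₀, hx₀⟩ := hp n
      exact hstep _ _ x₀ (p n).2.1 (hpm n.le_succ) ((p (n + 1)).2.2.trans ht.2)
        (fun s hs => hx₀ (show (⟨s, (p n).2.1.trans hs.1, hs.2.trans (p (n + 1)).2.2⟩ : Icc 0 t) ∈
          Icc (p n) (p (n + 1)) from hs)) ih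
  have := h N
  rwa [hN N le_rfl] at this

variable {D : LinearConnection E M} {γ : ℝ → M} {T : ∀ t, TangentSpace 𝓘(ℝ, E) (γ t)}

/-- The field `X` is parallel along the curve `γ` with velocity `T`. -/
def IsParallelAlong (D : LinearConnection E M) (γ : ℝ → M) (T : ∀ t, TangentSpace 𝓘(ℝ, E) (γ t))
    (S : Set ℝ) (X : ∀ t, TangentSpace 𝓘(ℝ, E) (γ t)) : Prop :=
  ∀ t ∈ S, ∀ x₀, γ t ∈ (chartAt E x₀).source → HasCovDerivWithinAt D x₀ γ S X t (T t) 0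

/-- `γ` is a geodesic with velocity `T`. -/
structure IsGeodesicCurve (D : LinearConnection E M) (γ : ℝ → M)
    (T : ∀ t, TangentSpace 𝓘(ℝ, E) (γ t)) (S : Set ℝ) : Prop where
  velocity : ∀ t ∈ S, HasVelocityWithinAt γ S t (T t)
  parallel : IsParallelAlong D γ T S T

lemma IsGeodesicCurve.mono {S S' : Set ℝ} (h : IsGeodesicCurve D γ T S) (hS : S' ⊆ S) :
    IsGeodesicCurve D γ T S' :=
  ⟨fun t ht => (h.velocity t (hS ht)).mono hS, fun t ht x₀ hx => (h.parallel t (hS ht) x₀ hx).mono hS⟩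

lemma IsGeodesicCurve.continuousOn {S : Set ℝ} (h : IsGeodesicCurve D γ T S) : ContinuousOn γ S :=
  fun t ht => HasMFDerivWithinAt.continuousWithinAt (h.velocity t ht)

lemma HasCovDerivWithinAt.ite_le {x₁ : M} {X₁ X₂ : ∀ t, TangentSpace 𝓘(ℝ, E) (γ t)}
    {a b c t : ℝ} {v W : TangentSpace 𝓘(ℝ, E) (γ t)} (ha : a ≤ c) (hb : c ≤ b)
    (h₁ : t ≤ c → HasCovDerivWithinAt D x₁ γ (Icc a c) X₁ t v W)
    (h₂ : c ≤ t → HasCovDerivWithinAt D x₁ γ (Icc c b) X₂ t v W) (h : X₁ c = X₂ c) :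
    HasCovDerivWithinAt D x₁ γ (Icc a b) (fun s => if s ≤ c then X₁ s else X₂ s) t v W := by
  have key := HasDerivWithinAt.ite_le (α₁ := fun s => chartCoord x₁ (γ s) (X₁ s))
    (α₂ := fun s => chartCoord x₁ (γ s) (X₂ s)) (t := t)
    (d := chartCoord x₁ (γ t) W - christoffel D x₁ (extChartAt 𝓘(ℝ, E) x₁ (γ t))
      (chartCoord x₁ (γ t) v) (chartCoord x₁ (γ t) (if t ≤ c then X₁ t else X₂ t))) ha hb
    (fun ht => by rw [if_pos ht]; exact h₁ ht)
    (fun ht => by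
      have : (if t ≤ c then X₁ t else X₂ t) = X₂ t := by
        rcases ht.eq_or_lt with rfl | ht
        · rw [if_pos le_rfl, h]
        · exact if_neg ht.not_ge
      rw [this]; exact h₂ ht) (fun _ => by rw [h])
  refine key.congr_of_eventuallyEq (Eventually.of_forall fun s => ?_) ?_
  · exact apply_ite (chartCoord x₁ (γ s)) _ _ _
  · exact apply_ite (chartCoord x₁ (γ t)) _ _ _

/-- Within one chart the equation `X' = -Γ(T, X)` is linear with continuous coefficients, so its
solution exists on the whole interval. -/
lemma exists_isParallelAlong_of_chart [T2Space M] (hD : D.ContMDiffCovariantDerivative ∞)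
    {a b : ℝ} (hab : a ≤ b) (hγ : IsGeodesicCurve D γ T (Icc a b)) {x₀ : M}
    (hx : ∀ t ∈ Icc a b, γ t ∈ (chartAt E x₀).source) (v : TangentSpace 𝓘(ℝ, E) (γ a)) :
    ∃ X, X a = v ∧ IsParallelAlong D γ T (Icc a b) X := by
  have := FiniteDimensional.complete ℝ E
  have hq : ContinuousOn (fun t => extChartAt 𝓘(ℝ, E) x₀ (γ t)) (Icc a b) := fun t ht =>
    ((hγ.velocity t ht).hasDerivWithinAt (hx t ht)).continuousWithinAt
  have hT : ContinuousOn (fun t => chartCoord x₀ (γ t) (T t)) (Icc a b) := fun t ht =>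
    HasDerivWithinAt.continuousWithinAt (hγ.parallel t ht x₀ (hx t ht))
  have hΓ := (contDiffOn_christoffel hD x₀).continuousOn.comp hq fun t ht =>
    (extChartAt 𝓘(ℝ, E) x₀).map_source (by simpa using hx t ht)
  obtain ⟨α, hα0, hα⟩ := exists_solution_of_linear hab (hΓ.clm_apply hT).neg
    (chartCoord x₀ (γ a) v)
  refine ⟨fun t => coordField x₀ (α t) (γ t), ?_, fun t ht x₁ hx₁ => ?_⟩
  · simp only [hα0]
    exact coordField_chartCoord (hx a ⟨le_rfl, hab⟩) v
  · refine HasCovDerivWithinAt.change_chart (x₀ := x₀) ?_ (hγ.velocity t ht) (hx t ht) hx₁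
    have h1 := hα t ht
    unfold HasCovDerivWithinAt
    rw [map_zero, zero_sub, chartCoord_coordField (hx t ht)]
    refine HasDerivWithinAt.congr (f := α) ?_
      (fun s hs => chartCoord_coordField (hx s hs) _) (chartCoord_coordField (hx t ht) _)
    simpa using h1

/-- Parallel transport along a geodesic. -/
lemma exists_isParallelAlong [T2Space M] (hD : D.ContMDiffCovariantDerivative ∞)
    {l : ℝ} (hl : 0 ≤ l) (hγ : IsGeodesicCurve D γ T (Icc 0 l)) (v : TangentSpace 𝓘(ℝ, E) (γ 0)) :
    ∃ X, X 0 = v ∧ IsParallelAlong D γ T (Icc 0 l) X := by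
  refine Icc_induction_of_charts (E := E) (Q := fun t => ∃ X : ∀ t, TangentSpace 𝓘(ℝ, E) (γ t),
    X 0 = v ∧ IsParallelAlong D γ T (Icc 0 t) X) hγ.continuousOn ?_ ?_ ⟨hl, le_rfl⟩
  · have h0 : Icc (0 : ℝ) 0 ⊆ Icc 0 l := Icc_subset_Icc_right hl
    obtain ⟨X, hX, hXp⟩ := exists_isParallelAlong_of_chart hD le_rfl (hγ.mono h0)
      (x₀ := γ 0) (fun t ht => by rw [Icc_self] at ht; rw [ht]; exact mem_chart_source E _) v
    exact ⟨X, hX, hXp⟩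
  · rintro a b x₀ ha hab hbl hx ⟨X₁, h1, h1p⟩
    obtain ⟨X₂, h2, h2p⟩ := exists_isParallelAlong_of_chart hD hab
      (hγ.mono (Icc_subset_Icc ha hbl)) hx (X₁ a)
    refine ⟨fun s => if s ≤ a then X₁ s else X₂ s, by simp [ha, h1], fun t ht x₁ hx₁ => ?_⟩
    exact HasCovDerivWithinAt.ite_le ha hab (fun h => h1p t ⟨ht.1, h⟩ x₁ hx₁)
      (fun h => h2p t ⟨h, ht.2⟩ x₁ hx₁) h2.symm

end ParallelTransport

/-! ### Parallel orthonormal frames -/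

namespace PseudoHermitianStructure

set_option linter.unusedSectionVars false

variable {m : ℕ} {M : Type*} [TopologicalSpace M] [T2Space M]
  [ChartedSpace (EuclideanSpace ℝ (Fin (2 * m + 1))) M] [IsManifold (𝓡 (2 * m + 1)) ∞ M]
  (P : PseudoHermitianStructure m M)
  {D : LinearConnection (EuclideanSpace ℝ (Fin (2 * m + 1))) M}
  (hD : P.IsTanakaWebster D) (hS : P.IsSasakian D)

/-- The family `e` is orthonormal for the Webster metric at `x`. -/
def IsWebsterOrthonormal (x : M) (e : Fin (2 * m + 1) → TangentSpace (𝓡 (2 * m + 1)) x) : Prop :=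
  ∀ i j, P.websterMetric x (e i) (e j) = if i = j then 1 else 0

include hD hS

lemma exists_isWebsterOrthonormal (x : M) : ∃ e, P.IsWebsterOrthonormal x e := by
  set B := P.websterForm (D := D) x
  have hB : ∀ u v, B u v = P.websterMetric x u v := P.websterForm_apply hD hS
  have hs : LinearMap.IsSymm B := ⟨fun u v => by
    simp only [hB, P.websterMetric_comm hD hS x u v, RingHom.id_apply]⟩
  have hfr : Module.finrank ℝ (TangentSpace (𝓡 (2 * m + 1)) x) = 2 * m + 1 :=
    (finrank_euclideanSpace_fin : Module.finrank ℝ (EuclideanSpace ℝ (Fin (2 * m + 1))) = _)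
  have : FiniteDimensional ℝ (TangentSpace (𝓡 (2 * m + 1)) x) :=
    inferInstanceAs (FiniteDimensional ℝ (EuclideanSpace ℝ (Fin (2 * m + 1))))
  obtain ⟨v, hv⟩ := LinearMap.BilinForm.exists_orthogonal_basis hs
  set w := v.reindex (finCongr hfr)
  have hw : ∀ i j, i ≠ j → B (w i) (w j) = 0 := fun i j hij => by
    simp only [w, Module.Basis.reindex_apply]
    exact hv (fun h => hij ((finCongr hfr).symm.injective h))
  have hpos : ∀ i, 0 < B (w i) (w i) := fun i => by
    rw [hB]; exact P.websterMetric_self_pos hD hS x (w.ne_zero i)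
  refine ⟨fun i => (Real.sqrt (B (w i) (w i)))⁻¹ • w i, fun i j => ?_⟩
  rw [← hB, map_smul, map_smul, LinearMap.smul_apply, smul_eq_mul, smul_eq_mul]
  split_ifs with h
  · subst h
    have := Real.mul_self_sqrt (hpos i).le
    have h2 := (Real.sqrt_pos.2 (hpos i)).ne'
    field_simp
    rw [sq, this]
  · rw [hw i j h]; simp

lemma IsWebsterOrthonormal.sum_smul {x : M} {e : Fin (2 * m + 1) → TangentSpace (𝓡 (2 * m + 1)) x}
    (he : P.IsWebsterOrthonormal x e) (v : TangentSpace (𝓡 (2 * m + 1)) x) :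
    ∑ i, P.websterMetric x v (e i) • e i = v := by
  set B := P.websterForm (D := D) x
  have hB : ∀ u v, B u v = P.websterMetric x u v := P.websterForm_apply hD hS
  have hfr : Module.finrank ℝ (TangentSpace (𝓡 (2 * m + 1)) x) = 2 * m + 1 :=
    (finrank_euclideanSpace_fin : Module.finrank ℝ (EuclideanSpace ℝ (Fin (2 * m + 1))) = _)
  have : FiniteDimensional ℝ (TangentSpace (𝓡 (2 * m + 1)) x) :=
    inferInstanceAs (FiniteDimensional ℝ (EuclideanSpace ℝ (Fin (2 * m + 1))))
  have hsum : ∀ (c : Fin (2 * m + 1) → ℝ) j, B (∑ i, c i • e i) (e j) = c j := fun c j => by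
    simp only [map_sum, map_smul, LinearMap.sum_apply, LinearMap.smul_apply, hB, he _ j]
    simp
  have hli : LinearIndependent ℝ e := by
    rw [Fintype.linearIndependent_iff]
    intro c hc j
    rw [← hsum c j, hc]; simp
  have hspan := hli.span_eq_top_of_card_eq_finrank (by simp [hfr])
  have hv : v ∈ Submodule.span ℝ (range e) := hspan ▸ Submodule.mem_top
  obtain ⟨c, rfl⟩ := (Submodule.mem_span_range_iff_exists_fun ℝ).1 hv
  refine Finset.sum_congr rfl fun i _ => ?_
  rw [← hB, hsum]

variable {γ : ℝ → M} {T : ∀ t, TangentSpace (𝓡 (2 * m + 1)) (γ t)} {l : ℝ}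

/-- Metric compatibility makes the derivative of the product vanish. -/
lemma websterMetric_of_parallel
    (hγ : IsGeodesicCurve D γ T (Icc 0 l)) {X Y : ∀ t, TangentSpace (𝓡 (2 * m + 1)) (γ t)}
    (hX : IsParallelAlong D γ T (Icc 0 l) X) (hY : IsParallelAlong D γ T (Icc 0 l) Y) {t : ℝ}
    (ht : t ∈ Icc 0 l) :
    P.websterMetric (γ t) (X t) (Y t) = P.websterMetric (γ 0) (X 0) (Y 0) := by
  have h0 : ∀ x, ∀ u : TangentSpace (𝓡 (2 * m + 1)) x, P.websterMetric x u 0 = 0 ∧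
      P.websterMetric x 0 u = 0 := fun x u => by
    simp only [← P.websterForm_apply hD hS, map_zero, LinearMap.zero_apply, and_self]
  have hd : ∀ s ∈ Icc 0 l, HasDerivWithinAt (fun s => P.websterMetric (γ s) (X s) (Y s)) 0
      (Icc 0 l) s := fun s hs => by
    have hx := mem_chart_source (EuclideanSpace ℝ (Fin (2 * m + 1))) (γ s)
    have := P.hasDerivWithinAt_websterMetric hD hS (hγ.velocity s hs) hx (hX s hs _ hx)
      (hY s hs _ hx)
    rwa [(h0 _ _).1, (h0 _ _).2, add_zero] at this
  exact constant_of_has_deriv_right_zero (fun s hs => (hd s hs).continuousWithinAt)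
    (fun s hs => (hd s ⟨hs.1, hs.2.le⟩).Ici_of_Icc hs) t ht

/-- Along a geodesic there is a parallel orthonormal frame. -/
lemma exists_parallel_frame (hl : 0 ≤ l) (hγ : IsGeodesicCurve D γ T (Icc 0 l)) :
    ∃ e : Fin (2 * m + 1) → ∀ t, TangentSpace (𝓡 (2 * m + 1)) (γ t),
      (∀ i, IsParallelAlong D γ T (Icc 0 l) (e i)) ∧
      ∀ t ∈ Icc 0 l, P.IsWebsterOrthonormal (γ t) fun i => e i t := by
  obtain ⟨e₀, he₀⟩ := P.exists_isWebsterOrthonormal hD hS (γ 0)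
  choose e he hp using fun i => exists_isParallelAlong hD.smooth hl hγ (e₀ i)
  refine ⟨e, hp, fun t ht i j => ?_⟩
  rw [P.websterMetric_of_parallel hD hS hγ (hp i) (hp j) ht, he, he, he₀]

end PseudoHermitianStructure

/-! ### Geodesics as integral curves in the tangent bundle -/

section GeodesicLift

set_option linter.unusedSectionVars false

variable {E : Type*} [NormedAddCommGroup E] [NormedSpace ℝ E] [FiniteDimensional ℝ E]
  {M : Type*} [TopologicalSpace M] [ChartedSpace E M] [IsManifold 𝓘(ℝ, E) ∞ M]

/-- The coordinates of a tangent vector and of its base point in the chart at `x₀`. -/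
def chartPair (x₀ : M) (p : TangentBundle 𝓘(ℝ, E) M) : E × E :=
  (extChartAt 𝓘(ℝ, E) x₀ p.1, chartCoord x₀ p.1 p.2)

/-- The tangent vector with given coordinates in the chart at `x₀`. -/
def chartPairSymm (x₀ : M) (z : E × E) : TangentBundle 𝓘(ℝ, E) M :=
  ⟨(extChartAt 𝓘(ℝ, E) x₀).symm z.1, coordField x₀ z.2 ((extChartAt 𝓘(ℝ, E) x₀).symm z.1)⟩

lemma chartPair_chartPairSymm {x₀ : M} {z : E × E} (hz : z.1 ∈ (extChartAt 𝓘(ℝ, E) x₀).target) :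
    chartPair x₀ (chartPairSymm x₀ z) = z :=
  Prod.ext ((extChartAt 𝓘(ℝ, E) x₀).right_inv hz) (chartCoord_coordField (symm_mem_source hz) _)

lemma chartPairSymm_chartPair {x₀ : M} {p : TangentBundle 𝓘(ℝ, E) M}
    (hp : p.1 ∈ (chartAt E x₀).source) : chartPairSymm x₀ (chartPair x₀ p) = p := by
  have h : ∀ z, z = p.1 → (⟨z, coordField x₀ (chartCoord x₀ p.1 p.2) z⟩ :
      TangentBundle 𝓘(ℝ, E) M) = p := by
    rintro z rfl
    rw [coordField_chartCoord hp]
  exact h _ ((extChartAt 𝓘(ℝ, E) x₀).left_inv (by simpa using hp))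

lemma chartPair_mem {x₀ : M} {p : TangentBundle 𝓘(ℝ, E) M} (hp : p.1 ∈ (chartAt E x₀).source) :
    chartPair x₀ p ∈ (extChartAt 𝓘(ℝ, E) x₀).target ×ˢ (univ : Set E) :=
  ⟨(extChartAt 𝓘(ℝ, E) x₀).map_source (by simpa using hp), mem_univ _⟩

/-- The geodesic vector field in the chart at `x₀`. -/
def geodesicField (D : LinearConnection E M) (x₀ : M) (z : E × E) : E × E :=
  (z.2, -christoffel D x₀ z.1 z.2 z.2)

variable {D : LinearConnection E M}

lemma contDiffOn_geodesicField [T2Space M] (hD : D.ContMDiffCovariantDerivative ∞) (x₀ : M) :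
    ContDiffOn ℝ ∞ (geodesicField D x₀) ((extChartAt 𝓘(ℝ, E) x₀).target ×ˢ (univ : Set E)) := by
  have hΓ : ContDiffOn ℝ ∞ (fun z : E × E => christoffel D x₀ z.1)
      ((extChartAt 𝓘(ℝ, E) x₀).target ×ˢ (univ : Set E)) :=
    (contDiffOn_christoffel hD x₀).comp contDiffOn_fst fun z hz => hz.1
  exact contDiffOn_snd.prodMk ((hΓ.clm_apply contDiffOn_snd).clm_apply contDiffOn_snd).neg

lemma isOpen_chartPair_target (x₀ : M) :
    IsOpen ((extChartAt 𝓘(ℝ, E) x₀).target ×ˢ (univ : Set E)) :=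
  (isOpen_extChartAt_target x₀).prod isOpen_univ

/-- The curve `Φ` in the tangent bundle is the lift of a geodesic. -/
def IsGeodesicLift (D : LinearConnection E M) (Φ : ℝ → TangentBundle 𝓘(ℝ, E) M) (S : Set ℝ) :
    Prop :=
  ∀ t ∈ S, ContinuousWithinAt (fun s => (Φ s).1) S t ∧ ∀ x₀, (Φ t).1 ∈ (chartAt E x₀).source →
    HasDerivWithinAt (fun s => chartPair x₀ (Φ s)) (geodesicField D x₀ (chartPair x₀ (Φ t))) S t

variable {Φ Ψ : ℝ → TangentBundle 𝓘(ℝ, E) M} {S : Set ℝ}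

lemma IsGeodesicLift.congr (h : IsGeodesicLift D Φ S) (hΨ : EqOn Ψ Φ S) :
    IsGeodesicLift D Ψ S := fun t ht => by
  refine ⟨(h t ht).1.congr (fun s hs => by rw [hΨ hs]) (by rw [hΨ ht]), fun x₀ hx => ?_⟩
  rw [hΨ ht] at hx ⊢
  exact ((h t ht).2 x₀ hx).congr (fun s hs => by rw [hΨ hs]) (by rw [hΨ ht])

lemma IsGeodesicLift.eventually_mem {t : ℝ} (h : IsGeodesicLift D Φ S) (ht : t ∈ S) {x₀ : M}
    (hx : (Φ t).1 ∈ (chartAt E x₀).source) : ∀ᶠ s in 𝓝[S] t, (Φ s).1 ∈ (chartAt E x₀).source :=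
  (h t ht).1.eventually ((chartAt E x₀).open_source.mem_nhds hx)

lemma IsGeodesicLift.isGeodesicCurve (h : IsGeodesicLift D Φ S) :
    IsGeodesicCurve D (fun s => (Φ s).1) (fun s => (Φ s).2) S where
  velocity t ht := by
    have hx := mem_chart_source E (Φ t).1
    have h1 := ((h t ht).2 _ hx).hasFDerivWithinAt.fst.hasDerivWithinAt
    have h2 := hasVelocityWithinAt_of_chart (γ := fun s => (Φ s).1) hx (h t ht).1
      (a := chartCoord (Φ t).1 (Φ t).1 (Φ t).2) (by simpa [chartPair, geodesicField] using h1)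
    rwa [coordField_chartCoord hx] at h2
  parallel t ht x₀ hx := by
    have h1 := ((h t ht).2 _ hx).hasFDerivWithinAt.snd.hasDerivWithinAt
    unfold HasCovDerivWithinAt
    rw [map_zero, zero_sub]
    simpa [chartPair, geodesicField] using h1

lemma IsGeodesicCurve.isGeodesicLift {γ : ℝ → M} {T : ∀ t, TangentSpace 𝓘(ℝ, E) (γ t)}
    (h : IsGeodesicCurve D γ T S) :
    IsGeodesicLift D (fun t => (⟨γ t, T t⟩ : TangentBundle 𝓘(ℝ, E) M)) S := fun t ht => by
  refine ⟨h.continuousOn t ht, fun x₀ hx => ?_⟩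
  have h1 := (h.velocity t ht).hasDerivWithinAt hx
  have h2 := h.parallel t ht x₀ hx
  unfold HasCovDerivWithinAt at h2
  rw [map_zero, zero_sub] at h2
  exact h1.prodMk h2

lemma isGeodesicLift_of_chart {α : ℝ → E × E} {x₀ : M}
    (hα : ∀ t ∈ S, (α t).1 ∈ (extChartAt 𝓘(ℝ, E) x₀).target)
    (h : ∀ t ∈ S, HasDerivWithinAt α (geodesicField D x₀ (α t)) S t) :
    IsGeodesicLift D (fun t => chartPairSymm x₀ (α t)) S := by
  refine IsGeodesicLift.congr (Φ := fun t => ⟨_, _⟩) (IsGeodesicCurve.isGeodesicLift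
    (γ := fun t => (chartPairSymm x₀ (α t)).1) (T := fun t => (chartPairSymm x₀ (α t)).2) ?_)
    fun t _ => rfl
  have hsrc : ∀ t ∈ S, (chartPairSymm x₀ (α t)).1 ∈ (chartAt E x₀).source := fun t ht =>
    symm_mem_source (hα t ht)
  have hvel : ∀ t ∈ S, HasVelocityWithinAt (E := E) (fun t => (chartPairSymm x₀ (α t)).1) S t
      (chartPairSymm x₀ (α t)).2 := fun t ht => by
    refine hasVelocityWithinAt_of_chart (hsrc t ht) ?_ (a := (α t).2) ?_
    · exact ContinuousAt.comp_continuousWithinAt (f := fun t => (α t).1)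
        (g := (extChartAt 𝓘(ℝ, E) x₀).symm) ((continuousOn_extChartAt_symm x₀).continuousAt
        ((isOpen_extChartAt_target x₀).mem_nhds (hα t ht))) (h t ht).continuousWithinAt.fst
    · have h1 : HasDerivWithinAt (fun t => (α t).1) (α t).2 S t := by
        simpa [geodesicField] using (h t ht).hasFDerivWithinAt.fst.hasDerivWithinAt
      exact h1.congr (fun s hs => (extChartAt 𝓘(ℝ, E) x₀).right_inv (hα s hs))
        ((extChartAt 𝓘(ℝ, E) x₀).right_inv (hα t ht))
  refine ⟨hvel, fun t ht x₁ hx₁ => ?_⟩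
  refine HasCovDerivWithinAt.change_chart (x₀ := x₀) ?_ (hvel t ht) (hsrc t ht) hx₁
  unfold HasCovDerivWithinAt
  have hc : ∀ s ∈ S, chartCoord x₀ (chartPairSymm x₀ (α s)).1 (chartPairSymm x₀ (α s)).2 =
    (α s).2 := fun s hs => chartCoord_coordField (hsrc s hs) _
  have hb : ∀ s ∈ S, extChartAt 𝓘(ℝ, E) x₀ (chartPairSymm x₀ (α s)).1 = (α s).1 := fun s hs =>
    (extChartAt 𝓘(ℝ, E) x₀).right_inv (hα s hs)
  rw [map_zero, zero_sub, hc t ht, hb t ht]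
  have h2 : HasDerivWithinAt (fun t => (α t).2) (-christoffel D x₀ (α t).1 (α t).2 (α t).2) S t := by
    simpa [geodesicField] using (h t ht).hasFDerivWithinAt.snd.hasDerivWithinAt
  exact h2.congr hc (hc t ht)

/-- Concatenation of geodesics. -/
lemma IsGeodesicLift.ite_le {a b c : ℝ} (ha : a ≤ c) (hb : c ≤ b)
    (h₁ : IsGeodesicLift D Φ (Icc a c)) (h₂ : IsGeodesicLift D Ψ (Icc c b)) (h : Φ c = Ψ c) :
    IsGeodesicLift D (fun s => if s ≤ c then Φ s else Ψ s) (Icc a b) := by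
  have hr : ∀ t, c ≤ t → (if t ≤ c then Φ t else Ψ t) = Ψ t := fun t ht => by
    rcases ht.eq_or_lt with rfl | ht
    · rw [if_pos le_rfl, h]
    · exact if_neg ht.not_ge
  have hl : ∀ t, t ≤ c → (if t ≤ c then Φ t else Ψ t) = Φ t := fun t ht => if_pos ht
  have h₁' := h₁.congr (Ψ := fun s => if s ≤ c then Φ s else Ψ s) fun t ht => hl t ht.2
  have h₂' := h₂.congr (Ψ := fun s => if s ≤ c then Φ s else Ψ s) fun t ht => hr t ht.1
  have hcont : ContinuousOn (fun s => (if s ≤ c then Φ s else Ψ s).1) (Icc a b) := by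
    rw [← Icc_union_Icc_eq_Icc ha hb]
    exact ContinuousOn.union_of_isClosed (fun t ht => (h₁' t ht).1) (fun t ht => (h₂' t ht).1)
      isClosed_Icc isClosed_Icc
  intro t ht
  refine ⟨hcont t ht, fun x₀ hx => ?_⟩
  refine (HasDerivWithinAt.ite_le (α₁ := fun s => chartPair x₀ (if s ≤ c then Φ s else Ψ s))
    (α₂ := fun s => chartPair x₀ (if s ≤ c then Φ s else Ψ s)) ha hb
    (fun htc => (h₁' t ⟨ht.1, htc⟩).2 x₀ hx) (fun htc => (h₂' t ⟨htc, ht.2⟩).2 x₀ hx)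
    fun _ => rfl).congr (fun s _ => by rw [ite_self]) (by rw [ite_self])

/-- Uniqueness of geodesics. -/
lemma IsGeodesicLift.eqOn [T2Space M] (hD : D.ContMDiffCovariantDerivative ∞) {a b : ℝ}
    (h₁ : IsGeodesicLift D Φ (Icc a b)) (h₂ : IsGeodesicLift D Ψ (Icc a b)) (h : Φ a = Ψ a) :
    EqOn Φ Ψ (Icc a b) := by
  refine IsClosed.Icc_subset_of_forall_exists_gt (s := {t | Φ t = Ψ t}) ?_ h ?_
  -- Closedness of the coincidence set: the base points agree because `M` is Hausdorff, after which
  -- one chart contains both and the coordinates of the vectors agree in the limit.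
  · refine isClosed_of_closure_subset fun t ht => ?_
    have htI : t ∈ Icc a b := isClosed_Icc.closure_subset (closure_mono inter_subset_right ht)
    refine ⟨?_, htI⟩
    have : (𝓝[{t | Φ t = Ψ t} ∩ Icc a b] t).NeBot := mem_closure_iff_nhdsWithin_neBot.1 ht
    have hev : ∀ᶠ s in 𝓝[{t | Φ t = Ψ t} ∩ Icc a b] t, Φ s = Ψ s := by
      filter_upwards [self_mem_nhdsWithin] with s hs using hs.1
    have hbase : (Φ t).1 = (Ψ t).1 :=
      tendsto_nhds_unique_of_eventuallyEq ((h₁ t htI).1.mono inter_subset_right)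
        ((h₂ t htI).1.mono inter_subset_right) (hev.mono fun s hs => congrArg _ hs)
    have hx := mem_chart_source E (Φ t).1
    have hx' : (Ψ t).1 ∈ (chartAt E (Φ t).1).source := hbase ▸ hx
    have hpair : chartPair (Φ t).1 (Φ t) = chartPair (Φ t).1 (Ψ t) :=
      tendsto_nhds_unique_of_eventuallyEq
        ((((h₁ t htI).2 _ hx).continuousWithinAt).mono inter_subset_right)
        ((((h₂ t htI).2 _ hx').continuousWithinAt).mono inter_subset_right)
        (hev.mono fun s hs => congrArg _ hs)
    rw [mem_ofPred_eq, ← chartPairSymm_chartPair hx, hpair, chartPairSymm_chartPair hx']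
  -- The set extends to the right: both lifts stay for a short time in one chart and in a set on
  -- which the geodesic field is Lipschitz, so uniqueness for the differential equation applies up
  -- to the time `d` below.
  · rintro t ⟨hteq, ht⟩ y hy
    have htI : t ∈ Icc a b := ⟨ht.1, ht.2.le⟩
    set x₀ := (Φ t).1 with hx₀
    have hx : (Φ t).1 ∈ (chartAt E x₀).source := mem_chart_source E (Φ t).1
    have hx' : (Ψ t).1 ∈ (chartAt E x₀).source := by rw [← show Φ t = Ψ t from hteq]; exact hx
    obtain ⟨K, s, hs, hK⟩ := (((contDiffOn_geodesicField hD x₀).contDiffAt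
      ((isOpen_chartPair_target x₀).mem_nhds (chartPair_mem hx))).of_le
        (show (1 : ℕ∞ω) ≤ ∞ by simp)).exists_lipschitzOnWith
    have hd₁ := (h₁ t htI).2 x₀ hx
    have hd₂ := (h₂ t htI).2 x₀ hx'
    have hev : ∀ᶠ r in 𝓝[Icc a b] t, (Φ r).1 ∈ (chartAt E x₀).source ∧
        (Ψ r).1 ∈ (chartAt E x₀).source ∧ chartPair x₀ (Φ r) ∈ s ∧ chartPair x₀ (Ψ r) ∈ s := by
      filter_upwards [h₁.eventually_mem htI hx, h₂.eventually_mem htI hx',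
        hd₁.continuousWithinAt hs, hd₂.continuousWithinAt
          (by rw [← show Φ t = Ψ t from hteq]; exact hs)] with r h1 h2 h3 h4
      exact ⟨h1, h2, h3, h4⟩
    obtain ⟨ε, hε, hball⟩ := Metric.mem_nhdsWithin_iff.1 hev
    set d := min (min y b) (t + ε / 2) with hd
    have htd : t < d := lt_min (lt_min hy ht.2) (by linarith)
    have hdb : d ≤ b := (min_le_left _ _).trans (min_le_right _ _)
    have hdy : d ≤ y := (min_le_left _ _).trans (min_le_left _ _)
    have hgood : ∀ r ∈ Icc t d, r ∈ Icc a b ∧ (Φ r).1 ∈ (chartAt E x₀).source ∧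
        (Ψ r).1 ∈ (chartAt E x₀).source ∧ chartPair x₀ (Φ r) ∈ s ∧ chartPair x₀ (Ψ r) ∈ s := by
      intro r hr
      have hrI : r ∈ Icc a b := ⟨ht.1.trans hr.1, hr.2.trans hdb⟩
      refine ⟨hrI, hball ⟨?_, hrI⟩⟩
      have : r ≤ t + ε / 2 := hr.2.trans (min_le_right _ _)
      rw [Metric.mem_ball, Real.dist_eq, abs_of_nonneg (by linarith [hr.1])]
      linarith
    have hsub : Icc t d ⊆ Icc a b := fun r hr => (hgood r hr).1
    have hder₁ : ∀ r ∈ Icc t d, HasDerivWithinAt (fun s => chartPair x₀ (Φ s))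
        (geodesicField D x₀ (chartPair x₀ (Φ r))) (Icc t d) r := fun r hr =>
      ((h₁ r (hsub hr)).2 x₀ (hgood r hr).2.1).mono hsub
    have hder₂ : ∀ r ∈ Icc t d, HasDerivWithinAt (fun s => chartPair x₀ (Ψ s))
        (geodesicField D x₀ (chartPair x₀ (Ψ r))) (Icc t d) r := fun r hr =>
      ((h₂ r (hsub hr)).2 x₀ (hgood r hr).2.2.1).mono hsub
    have heq := ODE_solution_unique_of_mem_Icc_right (v := fun _ => geodesicField D x₀)
      (s := fun _ => s) (fun _ _ => hK) (fun r hr => (hder₁ r hr).continuousWithinAt)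
      (fun r hr => (hder₁ r ⟨hr.1, hr.2.le⟩).Ici_of_Icc hr)
      (fun r hr => (hgood r ⟨hr.1, hr.2.le⟩).2.2.2.1)
      (fun r hr => (hder₂ r hr).continuousWithinAt)
      (fun r hr => (hder₂ r ⟨hr.1, hr.2.le⟩).Ici_of_Icc hr)
      (fun r hr => (hgood r ⟨hr.1, hr.2.le⟩).2.2.2.2)
      (by rw [show Φ t = Ψ t from hteq])
    have hdm : d ∈ Icc t d := ⟨htd.le, le_rfl⟩
    have h3 : chartPair x₀ (Φ d) = chartPair x₀ (Ψ d) := heq hdm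
    refine ⟨d, ?_, htd, hdy⟩
    rw [mem_ofPred_eq, ← chartPairSymm_chartPair (hgood d hdm).2.1, h3,
      chartPairSymm_chartPair (hgood d hdm).2.2.1]

/-- Affine reparametrisation of geodesics. -/
lemma IsGeodesicLift.rescale {t₀ : ℝ} (ht₀ : 0 ≤ t₀) (h : IsGeodesicLift D Φ (Icc 0 t₀)) :
    IsGeodesicLift D (fun r => (⟨(Φ (t₀ * r)).1, t₀ • (Φ (t₀ * r)).2⟩ : TangentBundle 𝓘(ℝ, E) M))
      (Icc 0 1) := by
  have hmaps : MapsTo (fun r => t₀ * r) (Icc 0 1) (Icc 0 t₀) := fun r hr =>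
    ⟨mul_nonneg ht₀ hr.1, by nlinarith [hr.2]⟩
  intro r hr
  refine ⟨(h _ (hmaps hr)).1.comp (by fun_prop : Continuous fun r => t₀ * r).continuousWithinAt hmaps,
    fun x₀ hx => ?_⟩
  have hm : HasDerivWithinAt (fun r => t₀ * r) t₀ (Icc 0 1) r := by
    simpa using (hasDerivWithinAt_id r (Icc 0 1)).const_mul t₀
  have h1 := ((h _ (hmaps hr)).2 x₀ hx).scomp r hm hmaps
  have hf : HasDerivWithinAt (fun r => extChartAt 𝓘(ℝ, E) x₀ (Φ (t₀ * r)).1)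
      (t₀ • chartCoord x₀ (Φ (t₀ * r)).1 (Φ (t₀ * r)).2) (Icc 0 1) r := by
    simpa [chartPair, geodesicField, Function.comp_def] using
      h1.hasFDerivWithinAt.fst.hasDerivWithinAt
  have hs : HasDerivWithinAt (fun r => chartCoord x₀ (Φ (t₀ * r)).1 (Φ (t₀ * r)).2)
      (-(t₀ • christoffel D x₀ (extChartAt 𝓘(ℝ, E) x₀ (Φ (t₀ * r)).1)
        (chartCoord x₀ (Φ (t₀ * r)).1 (Φ (t₀ * r)).2)
        (chartCoord x₀ (Φ (t₀ * r)).1 (Φ (t₀ * r)).2))) (Icc 0 1) r := by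
    simpa [chartPair, geodesicField, Function.comp_def] using
      h1.hasFDerivWithinAt.snd.hasDerivWithinAt
  refine ((hf.prodMk (hs.const_smul t₀)).congr (fun s _ => ?_) ?_).congr_deriv ?_
  · simp [chartPair]
  · simp [chartPair]
  · simp [chartPair, geodesicField]

end GeodesicLift

/-! ### The linearised geodesic equation -/

section GeodesicVariation

set_option linter.unusedSectionVars false

variable {E : Type*} [NormedAddCommGroup E] [NormedSpace ℝ E] [FiniteDimensional ℝ E]
  {M : Type*} [TopologicalSpace M] [ChartedSpace E M] [IsManifold 𝓘(ℝ, E) ∞ M]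

/-- The torsion of the connection is parallel, in coordinates. -/
def HasParallelTorsion (D : LinearConnection E M) : Prop :=
  ∀ x₀ : M, ∀ q ∈ (extChartAt 𝓘(ℝ, E) x₀).target, ∀ a b c,
    fderiv ℝ (christoffel D x₀) q c a b - fderiv ℝ (christoffel D x₀) q c b a =
      (christoffel D x₀ q (christoffel D x₀ q c a) b
        - christoffel D x₀ q b (christoffel D x₀ q c a))
      + (christoffel D x₀ q a (christoffel D x₀ q c b)
        - christoffel D x₀ q (christoffel D x₀ q c b) a)
      - christoffel D x₀ q c (christoffel D x₀ q a b - christoffel D x₀ q b a)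

/-- `V` solves the Jacobi equation of a connection with parallel torsion along the geodesic `γ`
with velocity `T`, and `W` is its covariant derivative. -/
def IsJacobiPair (D : LinearConnection E M) (γ : ℝ → M) (T : ∀ t, TangentSpace 𝓘(ℝ, E) (γ t))
    (S : Set ℝ) (V W : ∀ t, TangentSpace 𝓘(ℝ, E) (γ t)) : Prop :=
  ∀ t ∈ S, ∀ x₀, γ t ∈ (chartAt E x₀).source →
    HasCovDerivWithinAt D x₀ γ S V t (T t) (W t) ∧
    HasCovDerivWithinAt D x₀ γ S W t (T t)
      (curvatureTensor D (γ t) (T t) (V t) (T t) + D.torsion (γ t) (T t) (W t))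

/-- The coordinates of the derivative of the lift of a variation of geodesics whose variation field
is `V`, where `W` is the covariant derivative of `V`. -/
def variationRep (D : LinearConnection E M) (x₀ : M) (p : TangentBundle 𝓘(ℝ, E) M)
    (V W : TangentSpace 𝓘(ℝ, E) p.1) : E × E :=
  (chartCoord x₀ p.1 V, chartCoord x₀ p.1 W - christoffel D x₀ (extChartAt 𝓘(ℝ, E) x₀ p.1)
    (chartCoord x₀ p.1 p.2) (chartCoord x₀ p.1 V))

lemma hasDerivWithinAt_comp_curve {F : Type*} [NormedAddCommGroup F] [NormedSpace ℝ F] {f : E → F}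
    {f' : E →L[ℝ] F} {q : ℝ → E} {q' : E} {S : Set ℝ} {t : ℝ} (hf : HasFDerivAt f f' (q t))
    (hq : HasDerivWithinAt q q' S t) : HasDerivWithinAt (fun s => f (q s)) (f' q') S t :=
  hf.comp_hasDerivWithinAt t hq

set_option synthInstance.maxHeartbeats 200000 in
lemma hasDerivWithinAt_clm_apply_apply {G : ℝ → E →L[ℝ] E →L[ℝ] E} {G' : E →L[ℝ] E →L[ℝ] E}
    {v y : ℝ → E} {v' y' : E} {S : Set ℝ} {t : ℝ} (hG : HasDerivWithinAt G G' S t) (hv : HasDerivWithinAt v v' S t)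
    (hy : HasDerivWithinAt y y' S t) :
    HasDerivWithinAt (fun s => G s (v s) (y s))
      (G' (v t) (y t) + G t v' (y t) + G t (v t) y') S t :=
  (hG.clm_apply hv).clm_apply hy

variable {D : LinearConnection E M}

/-- The invariant content of `variationRep` is that the base point moves with velocity `V` and the
vector has covariant derivative `W - T(p, V)`: interchanging the two derivatives of a variation
costs a torsion term. Both data are independent of the chart. -/
lemma hasDerivAt_chartPair_change_chart {C : ℝ → TangentBundle 𝓘(ℝ, E) M}
    {p : TangentBundle 𝓘(ℝ, E) M} (hp : C 0 = p) (hC : ContinuousAt (fun s => (C s).1) 0)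
    {V W : TangentSpace 𝓘(ℝ, E) p.1} {x₀ x₁ : M} (hx₀ : p.1 ∈ (chartAt E x₀).source)
    (hx₁ : p.1 ∈ (chartAt E x₁).source)
    (h : HasDerivAt (fun s => chartPair x₀ (C s)) (variationRep D x₀ p V W) 0) :
    HasDerivAt (fun s => chartPair x₁ (C s)) (variationRep D x₁ p V W) 0 := by
  subst hp
  have h' := hasDerivWithinAt_univ.2 h
  have hv : HasVelocityWithinAt (E := E) (fun s => (C s).1) univ 0 V := by
    have h1 := hasVelocityWithinAt_of_chart (γ := fun s => (C s).1) hx₀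
      (continuousWithinAt_univ _ _ |>.2 hC) (a := chartCoord x₀ (C 0).1 V)
      (by simpa [chartPair, variationRep] using h'.hasFDerivWithinAt.fst.hasDerivWithinAt)
    rwa [coordField_chartCoord hx₀] at h1
  have hc : HasCovDerivWithinAt D x₀ (fun s => (C s).1) univ (fun s => (C s).2) 0 V
      (W - D.torsion _ (C 0).2 V) := by
    unfold HasCovDerivWithinAt
    rw [map_sub, chartCoord_torsion D hx₀]
    have h1 : HasDerivWithinAt (fun s => chartCoord x₀ (C s).1 (C s).2)
        (variationRep D x₀ (C 0) V W).2 univ 0 := by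
      simpa [chartPair] using h'.hasFDerivWithinAt.snd.hasDerivWithinAt
    refine h1.congr_deriv ?_
    simp only [variationRep]
    abel
  have hc₁ := hc.change_chart hv hx₀ hx₁
  unfold HasCovDerivWithinAt at hc₁
  rw [map_sub, chartCoord_torsion D hx₁] at hc₁
  refine hasDerivWithinAt_univ.1 (((hv.hasDerivWithinAt hx₁).prodMk hc₁).congr_deriv ?_)
  simp only [variationRep]
  congr 1
  abel

set_option synthInstance.maxHeartbeats 200000 in
lemma fderiv_geodesicField [T2Space M] (hD : D.ContMDiffCovariantDerivative ∞) {x₀ : M} {q : E}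
    (hq : q ∈ (extChartAt 𝓘(ℝ, E) x₀).target) (v y b : E) :
    fderiv ℝ (geodesicField D x₀) (q, v) (y, b) =
      (b, -(fderiv ℝ (christoffel D x₀) q y v v + christoffel D x₀ q b v
        + christoffel D x₀ q v b)) := by
  have hmem : (q, v) ∈ (extChartAt 𝓘(ℝ, E) x₀).target ×ˢ (univ : Set E) := ⟨hq, mem_univ _⟩
  have hF := (((contDiffOn_geodesicField hD x₀).contDiffAt
    ((isOpen_chartPair_target x₀).mem_nhds hmem)).differentiableAt (by simp)).hasFDerivAt
  have hΓ := IsSasakianModel.hasDerivAt_line (IsSasakianModel.hasFDerivAt_of_contDiffOn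
    (isOpen_extChartAt_target x₀) (contDiffOn_christoffel hD x₀) hq) y
  have hl : ∀ a c : E, HasDerivAt (fun s : ℝ => a + s • c) c 0 := fun a c => by
    simpa using ((hasDerivAt_id (0 : ℝ)).smul_const c).const_add a
  have h1 : HasDerivAt (fun s : ℝ => geodesicField D x₀ (q + s • y, v + s • b))
      (fderiv ℝ (geodesicField D x₀) (q, v) (y, b)) 0 := by
    have hF' : HasFDerivAt (geodesicField D x₀) (fderiv ℝ (geodesicField D x₀) (q, v))
        (q + (0 : ℝ) • y, v + (0 : ℝ) • b) := by simpa using hF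
    exact hF'.comp_hasDerivAt (0 : ℝ) ((hl q y).prodMk (hl v b))
  have h2 := (hl v b).prodMk
    (((hΓ.clm_apply (hl v b)).clm_apply (hl v b)).neg)
  have h3 := h1.unique h2
  rw [h3]
  simp

set_option synthInstance.maxHeartbeats 200000 in
/-- The derivative of a variation of geodesics solves the linearised geodesic equation. -/
lemma IsJacobiPair.hasDerivWithinAt_variationRep [T2Space M]
    (hD : D.ContMDiffCovariantDerivative ∞) (hpt : HasParallelTorsion D) {γ : ℝ → M}
    {T V W : ∀ t, TangentSpace 𝓘(ℝ, E) (γ t)} {S : Set ℝ} (hγ : IsGeodesicCurve D γ T S)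
    (hJ : IsJacobiPair D γ T S V W) {t : ℝ} (ht : t ∈ S) {x₀ : M}
    (hx : γ t ∈ (chartAt E x₀).source) :
    HasDerivWithinAt (fun s => variationRep D x₀ ⟨γ s, T s⟩ (V s) (W s))
      (fderiv ℝ (geodesicField D x₀) (chartPair x₀ ⟨γ t, T t⟩)
        (variationRep D x₀ ⟨γ t, T t⟩ (V t) (W t))) S t := by
  have hq : extChartAt 𝓘(ℝ, E) x₀ (γ t) ∈ (extChartAt 𝓘(ℝ, E) x₀).target :=
    (extChartAt 𝓘(ℝ, E) x₀).map_source (by simpa using hx)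
  have hqd := (hγ.velocity t ht).hasDerivWithinAt hx
  have hTd := hγ.parallel t ht x₀ hx
  obtain ⟨hVd, hWd⟩ := hJ t ht x₀ hx
  have hΓ := IsSasakianModel.hasFDerivAt_of_contDiffOn
    (isOpen_extChartAt_target x₀) (contDiffOn_christoffel hD x₀) hq
  unfold HasCovDerivWithinAt at hTd hVd hWd
  refine (hVd.prodMk (hWd.sub (hasDerivWithinAt_clm_apply_apply (v := fun s =>
    chartCoord x₀ (γ s) (T s)) (y := fun s => chartCoord x₀ (γ s) (V s))
    (hasDerivWithinAt_comp_curve hΓ hqd) hTd hVd))).congr_deriv ?_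
  rw [chartPair, variationRep, fderiv_geodesicField hD hq, map_add, chartCoord_torsion D hx,
    chartCoord_curvatureTensor hD hx, map_zero]
  -- The curvature contributes `∂_T Γ(V, T)`, while differentiating the fibre component contributes
  -- `-∂_T Γ(T, V)`. Parallel torsion expresses their sum by undifferentiated symbols, and the
  -- linearised equation, containing only `∂_V Γ(T, T)`, results.
  have h2 := hpt x₀ _ hq (chartCoord x₀ (γ t) (T t)) (chartCoord x₀ (γ t) (V t))
    (chartCoord x₀ (γ t) (T t))
  refine Prod.ext rfl ?_
  simp only [curvRep, map_sub, map_neg, zero_sub, neg_apply, sub_apply] at h2 ⊢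
  linear_combination (norm := module) (-1 : ℝ) • h2

end GeodesicVariation

/-! ### Jacobi fields as variation fields -/

section ExistsVariation

set_option linter.unusedSectionVars false

variable {E : Type*} [NormedAddCommGroup E] [NormedSpace ℝ E] [FiniteDimensional ℝ E]
  {M : Type*} [TopologicalSpace M] [ChartedSpace E M] [IsManifold 𝓘(ℝ, E) ∞ M]
  {D : LinearConnection E M} {γ : ℝ → M} {T V W : ∀ t, TangentSpace 𝓘(ℝ, E) (γ t)}

/-- `C` is a variation up to time `t` of the geodesic `γ` whose initial velocities are
`T 0 + s W 0` and whose variation field is `V`. -/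
structure IsVariation (D : LinearConnection E M) (γ : ℝ → M)
    (T V W : ∀ t, TangentSpace 𝓘(ℝ, E) (γ t)) (t : ℝ) (C : ℝ → ℝ → TangentBundle 𝓘(ℝ, E) M) :
    Prop where
  geodesic : ∀ᶠ s in 𝓝 0, C s 0 = ⟨γ 0, T 0 + s • W 0⟩ ∧ IsGeodesicLift D (C s) (Icc 0 t)
  eq : C 0 t = ⟨γ t, T t⟩
  continuousAt : ContinuousAt (fun s => (C s t).1) 0
  hasDerivAt : ∀ x₀, γ t ∈ (chartAt E x₀).source →
    HasDerivAt (fun s => chartPair x₀ (C s t)) (variationRep D x₀ ⟨γ t, T t⟩ (V t) (W t)) 0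

lemma isGeodesicLift_singleton (Φ : ℝ → TangentBundle 𝓘(ℝ, E) M) (t : ℝ) :
    IsGeodesicLift D Φ {t} := by
  rintro s rfl
  exact ⟨continuousWithinAt_singleton, fun x₀ _ =>
    HasFDerivWithinAt.of_finite (finite_singleton _)⟩

lemma isVariation_zero (hV : V 0 = 0) :
    IsVariation D γ T V W 0 (fun s _ => ⟨γ 0, T 0 + s • W 0⟩) where
  geodesic := Eventually.of_forall fun s => ⟨rfl, by
    rw [Icc_self]; exact isGeodesicLift_singleton _ _⟩
  eq := by simp
  continuousAt := continuousAt_const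
  hasDerivAt x₀ _ := by
    have h1 : HasDerivAt (fun s : ℝ => chartCoord x₀ (γ 0) (T 0) + s • chartCoord x₀ (γ 0) (W 0))
        (chartCoord x₀ (γ 0) (W 0)) 0 := by
      simpa using ((hasDerivAt_id (0 : ℝ)).smul_const (chartCoord x₀ (γ 0) (W 0))).const_add
        (chartCoord x₀ (γ 0) (T 0))
    refine (((hasDerivAt_const (0 : ℝ) (extChartAt 𝓘(ℝ, E) x₀ (γ 0))).prodMk
      h1).congr_deriv ?_).congr_of_eventuallyEq ?_
    · simp [variationRep, hV]
    · exact Eventually.of_forall fun s => by simp [chartPair]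

/-- Inside one chart geodesics solve an autonomous first-order equation, so the derivative in `s` at
time `a` is carried to time `b` by the linearised equation, which the Jacobi pair satisfies. -/
lemma IsVariation.extend [T2Space M] (hD : D.ContMDiffCovariantDerivative ∞)
    (hpt : HasParallelTorsion D) {a b : ℝ} {x₀ : M} (ha : 0 ≤ a) (hab : a < b)
    (hγ : IsGeodesicCurve D γ T (Icc a b)) (hJ : IsJacobiPair D γ T (Icc a b) V W)
    (hx : ∀ t ∈ Icc a b, γ t ∈ (chartAt E x₀).source) {C : ℝ → ℝ → TangentBundle 𝓘(ℝ, E) M}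
    (hC : IsVariation D γ T V W a C) : ∃ C', IsVariation D γ T V W b C' := by
  have ham : a ∈ Icc a b := ⟨le_rfl, hab.le⟩
  have hbm : b ∈ Icc a b := ⟨hab.le, le_rfl⟩
  have hmem : ∀ t ∈ Icc a b, chartPair x₀ (⟨γ t, T t⟩ : TangentBundle 𝓘(ℝ, E) M) ∈
      (extChartAt 𝓘(ℝ, E) x₀).target ×ˢ (univ : Set E) := fun t ht => chartPair_mem (hx t ht)
  obtain ⟨A, hA, hAb, hAd⟩ := exists_perturbed_solutions (isOpen_chartPair_target x₀)
    ((contDiffOn_geodesicField hD x₀).of_le (show (1 : ℕ∞ω) ≤ ∞ by simp)) hab.le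
    (fun t ht => (hγ.isGeodesicLift t ht).2 x₀ (hx t ht)) hmem
    (fun t ht => hJ.hasDerivWithinAt_variationRep hD hpt hγ ht (hx t ht))
    (z := fun s => chartPair x₀ (C s a)) (by beta_reduce; rw [hC.eq]) (hC.hasDerivAt x₀ (hx a ham))
  -- The strict inequality `a < b` selects the new branch at time `b`.
  have hC' : ∀ s, (if b ≤ a then C s b else chartPairSymm x₀ (A s b)) = chartPairSymm x₀ (A s b) :=
    fun s => if_neg hab.not_ge
  have hsrc : ∀ᶠ s in 𝓝 (0 : ℝ), (C s a).1 ∈ (chartAt E x₀).source :=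
    hC.continuousAt.eventually ((chartAt E x₀).open_source.mem_nhds (by
      beta_reduce; rw [hC.eq]; exact hx a ham))
  have hAb1 : (A 0 b).1 ∈ (extChartAt 𝓘(ℝ, E) x₀).target := by rw [hAb]; exact (hmem b hbm).1
  have heq : chartPairSymm x₀ (A 0 b) = ⟨γ b, T b⟩ := by
    rw [hAb]; exact chartPairSymm_chartPair (hx b hbm)
  have hcont : ContinuousAt (fun s => (chartPairSymm x₀ (A s b)).1) 0 :=
    ContinuousAt.comp (f := fun s => (A s b).1) (g := (extChartAt 𝓘(ℝ, E) x₀).symm)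
      ((continuousOn_extChartAt_symm x₀).continuousAt
        ((isOpen_extChartAt_target x₀).mem_nhds hAb1)) hAd.continuousAt.fst
  refine ⟨fun s t => if t ≤ a then C s t else chartPairSymm x₀ (A s t), ?_, ?_, ?_, ?_⟩
  · filter_upwards [hC.geodesic, hA, hsrc] with s h1 h2 h3
    refine ⟨by rw [if_pos ha]; exact h1.1, h1.2.ite_le ha hab.le
      (isGeodesicLift_of_chart (fun t ht => (h2.2 t ht).1.1) fun t ht => (h2.2 t ht).2) ?_⟩
    rw [h2.1, chartPairSymm_chartPair h3]
  · rw [hC', heq]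
  · simpa only [hC'] using hcont
  · intro x₁ hx₁
    simp only [hC']
    refine hasDerivAt_chartPair_change_chart (C := fun s => chartPairSymm x₀ (A s b))
      (p := ⟨γ b, T b⟩) heq hcont (hx b hbm) hx₁ ?_
    refine hAd.congr_of_eventuallyEq ?_
    filter_upwards [hA] with s hs
    exact chartPair_chartPairSymm (hs.2 b hbm).1.1

/-- A Jacobi field vanishing at the initial time is the variation field of a variation of
geodesics. -/
theorem exists_isVariation [T2Space M] (hD : D.ContMDiffCovariantDerivative ∞)
    (hpt : HasParallelTorsion D) {l : ℝ} (hγ : IsGeodesicCurve D γ T (Icc 0 l))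
    (hJ : IsJacobiPair D γ T (Icc 0 l) V W) (hV : V 0 = 0) {t : ℝ} (ht : t ∈ Icc 0 l) :
    ∃ C, IsVariation D γ T V W t C := by
  refine Icc_induction_of_charts (E := E) (Q := fun t => ∃ C, IsVariation D γ T V W t C)
    hγ.continuousOn ⟨fun s _ => ⟨γ 0, T 0 + s • W 0⟩, isVariation_zero hV⟩ ?_ ht
  rintro a b x₀ ha hab hbl hx ⟨C, hC⟩
  rcases hab.eq_or_lt with rfl | hab
  · exact ⟨C, hC⟩
  · have hs : Icc a b ⊆ Icc 0 l := Icc_subset_Icc ha hbl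
    exact hC.extend hD hpt ha hab (hγ.mono hs) (fun t ht x₀ hx =>
      ⟨(hJ t (hs ht) x₀ hx).1.mono hs, (hJ t (hs ht) x₀ hx).2.mono hs⟩) hx

end ExistsVariation

/-! ### The exponential map and conjugate points -/

section ExponentialMap

set_option linter.unusedSectionVars false

lemma contDiffWithinAt_succ_of_hasDerivWithinAt {V : Type*} [NormedAddCommGroup V]
    [NormedSpace ℝ V] {f g : ℝ → V} {S : Set ℝ} {t : ℝ} (n : ℕ) (ht : t ∈ S)
    (h : ∀ᶠ s in 𝓝[S] t, HasDerivWithinAt f (g s) S s) (hg : ContDiffWithinAt ℝ n g S t) :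
    ContDiffWithinAt ℝ (n + 1) f S t := by
  rw [contDiffWithinAt_succ_iff_hasFDerivWithinAt (by simp)]
  refine ⟨{s | s ∈ S ∧ HasDerivWithinAt f (g s) S s}, ?_, by simp, fun s =>
    ContinuousLinearMap.toSpanSingleton ℝ (g s), fun s hs => ?_, ?_⟩
  · rw [insert_eq_of_mem ht]
    exact inter_mem self_mem_nhdsWithin h
  · exact HasFDerivWithinAt.mono hs.2.hasFDerivWithinAt fun r hr => hr.1
  · exact ((ContinuousLinearMap.toSpanSingletonCLE (𝕜 := ℝ) (E := V)).contDiff.contDiffAt.comp_contDiffWithinAt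
      t hg).mono fun r hr => hr.1

variable {E : Type*} [NormedAddCommGroup E] [NormedSpace ℝ E] [FiniteDimensional ℝ E]
  {M : Type*} [TopologicalSpace M] [ChartedSpace E M] [IsManifold 𝓘(ℝ, E) ∞ M]
  {D : LinearConnection E M}

lemma contMDiffOn_velocity {γ : ℝ → M} {a b : ℝ} (hab : a < b)
    (h : ContMDiffOn 𝓘(ℝ, ℝ) 𝓘(ℝ, E) 2 γ (Icc a b)) :
    ContMDiffOn 𝓘(ℝ, ℝ) (𝓘(ℝ, E).prod 𝓘(ℝ, E)) 1
      (fun t => (⟨γ t, velocity γ (Icc a b) t⟩ : TangentBundle 𝓘(ℝ, E) M)) (Icc a b) := by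
  have h1 := h.contMDiffOn_tangentMapWithin (m := 1) (by norm_num)
    (uniqueDiffOn_Icc hab).uniqueMDiffOn
  have h2 : ContMDiff 𝓘(ℝ, ℝ) (𝓘(ℝ, ℝ).prod 𝓘(ℝ, ℝ)) 1
      (fun t => (⟨t, (1 : ℝ)⟩ : TangentBundle 𝓘(ℝ, ℝ) ℝ)) := fun t =>
    (contMDiffAt_vectorSpace_iff_contDiffAt (n := 1) (V := fun _ : ℝ => (1 : ℝ))).2
      contDiffAt_const
  exact h1.comp h2.contMDiffOn fun t ht => ht

lemma IsGeodesicOn.isGeodesicCurve {γ : ℝ → M} {a b : ℝ} (hab : a < b)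
    (h : IsGeodesicOn D γ (Icc a b)) :
    IsGeodesicCurve D γ (velocity γ (Icc a b)) (Icc a b) := by
  have key := fun t ht x₀ hx => hasCovDerivWithinAt_covDerivAlong (D := D) (x₀ := x₀)
    ((contMDiffOn_velocity hab h.contMDiffOn t ht).mdifferentiableWithinAt (by simp))
    (uniqueDiffOn_Icc hab t ht) hx
  refine ⟨fun t ht => (key t ht (γ t) (mem_chart_source E _)).1, fun t ht x₀ hx => ?_⟩
  have := (key t ht x₀ hx).2
  rwa [h.geodesic_eq t ht] at this

lemma IsGeodesicCurve.velocity_eq {γ : ℝ → M} {T : ∀ t, TangentSpace 𝓘(ℝ, E) (γ t)} {a b : ℝ}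
    (hab : a < b) (h : IsGeodesicCurve D γ T (Icc a b)) {t : ℝ} (ht : t ∈ Icc a b) :
    _root_.velocity γ (Icc a b) t = T t :=
  (h.velocity t ht).velocity_eq (uniqueDiffOn_Icc hab t ht)

lemma IsGeodesicCurve.isGeodesicOn [T2Space M] (hD : D.ContMDiffCovariantDerivative ∞) {γ : ℝ → M}
    {T : ∀ t, TangentSpace 𝓘(ℝ, E) (γ t)} {a b : ℝ} (hab : a < b)
    (h : IsGeodesicCurve D γ T (Icc a b)) : IsGeodesicOn D γ (Icc a b) where
  contMDiffOn t ht := by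
    rw [contMDiffWithinAt_iff_target]
    refine ⟨h.continuousOn t ht, ContDiffWithinAt.contMDiffWithinAt ?_⟩
    set x₀ := γ t
    have hx : γ t ∈ (chartAt E x₀).source := mem_chart_source E _
    set α : ℝ → E × E := fun s => chartPair x₀ (⟨γ s, T s⟩ : TangentBundle 𝓘(ℝ, E) M)
    have hα : ∀ᶠ s in 𝓝[Icc a b] t, HasDerivWithinAt α (geodesicField D x₀ (α s)) (Icc a b) s := by
      filter_upwards [h.isGeodesicLift.eventually_mem ht hx, self_mem_nhdsWithin] with s hs hs'
      exact (h.isGeodesicLift s hs').2 x₀ hs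
    have hF : ContDiffAt ℝ ∞ (geodesicField D x₀) (α t) :=
      (contDiffOn_geodesicField hD x₀).contDiffAt
        ((isOpen_chartPair_target x₀).mem_nhds (chartPair_mem hx))
    -- Bootstrapping: the coordinates of the lift are continuous, and each use of the geodesic
    -- equation gains one derivative until the class `C²` demanded by `IsGeodesicOn` is reached.
    have h0 : ContDiffWithinAt ℝ 0 α (Icc a b) t :=
      (contDiffWithinAt_zero ht).2 ⟨_, hα, fun s hs =>
        (hs.2 : HasDerivWithinAt _ _ _ _).continuousWithinAt.mono inter_subset_left⟩
    have h1 : ContDiffWithinAt ℝ 1 α (Icc a b) t := by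
      simpa using contDiffWithinAt_succ_of_hasDerivWithinAt 0 ht hα
        ((hF.of_le (by simp)).comp_contDiffWithinAt t h0)
    have h2 : ContDiffWithinAt ℝ (1 + 1) α (Icc a b) t := by
      simpa using contDiffWithinAt_succ_of_hasDerivWithinAt 1 ht hα
        ((hF.of_le (by simp)).comp_contDiffWithinAt t h1)
    rw [one_add_one_eq_two] at h2
    exact h2.fst
  geodesic_eq t ht := by
    have hx := mem_chart_source E (γ t)
    refine ((h.parallel t ht _ hx).congr ?_ (h.velocity_eq hab ht)).covDerivAlong_eq
      (h.velocity t ht) hx (uniqueDiffOn_Icc hab t ht)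
    filter_upwards [self_mem_nhdsWithin] with s hs using h.velocity_eq hab hs

/-- The exponential map is given by the geodesics. -/
lemma expMap_smul [T2Space M] (hD : D.ContMDiffCovariantDerivative ∞) {p : M} {u : E}
    {Φ : ℝ → TangentBundle 𝓘(ℝ, E) M} {t : ℝ} (ht : 0 ≤ t) (hΦ : IsGeodesicLift D Φ (Icc 0 t))
    (h0 : Φ 0 = ⟨p, u⟩) : expMap D p (t • u) = (Φ t).1 := by
  have hΨ := hΦ.rescale ht
  have h1 := hΨ.isGeodesicCurve.isGeodesicOn hD one_pos
  have hinit : (⟨(Φ (t * 0)).1, t • (Φ (t * 0)).2⟩ : TangentBundle 𝓘(ℝ, E) M) = ⟨p, t • u⟩ := by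
    rw [mul_zero, h0]
    rfl
  have hv := hΨ.isGeodesicCurve.velocity_eq one_pos (t := 0) (by simp)
  have hex : ∃ c : ℝ → M, IsGeodesicOn D c (Icc 0 1) ∧
      (⟨c 0, velocity c (Icc 0 1) 0⟩ : TangentBundle 𝓘(ℝ, E) M) = ⟨p, t • u⟩ :=
    ⟨_, h1, by rw [hv]; exact hinit⟩
  rw [expMap, dif_pos hex]
  have h2 := hex.choose_spec.1.isGeodesicCurve one_pos
  -- Uniqueness of geodesics makes the curve chosen in `expMap` coincide with the rescaled one.
  have h3 := h2.isGeodesicLift.eqOn hD hΨ (by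
    rw [hex.choose_spec.2, hinit])
  have h4 := congrArg (fun p => p.1) (h3 (right_mem_Icc.2 zero_le_one))
  simpa using h4

/-- The end point of a Jacobi field with a further zero is a conjugate point. -/
theorem IsGeodesicOn.isConjugateAlong [T2Space M] (hD : D.ContMDiffCovariantDerivative ∞)
    (hpt : HasParallelTorsion D) {γ : ℝ → M} {l t : ℝ} (hγ : IsGeodesicOn D γ (Icc 0 l))
    {V W : ∀ t, TangentSpace 𝓘(ℝ, E) (γ t)}
    (hJ : IsJacobiPair D γ (velocity γ (Icc 0 l)) (Icc 0 l) V W) (hV : V 0 = 0) (hW : W 0 ≠ 0)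
    (ht : t ∈ Ioc 0 l) (hVt : V t = 0) : IsConjugateAlong D γ l t := by
  have hl : 0 < l := ht.1.trans_le ht.2
  have htI : t ∈ Icc 0 l := ⟨ht.1.le, ht.2⟩
  have hc := hγ.isGeodesicCurve hl
  obtain ⟨C, hC⟩ := exists_isVariation hD hpt hc hJ hV htI
  intro hinj
  set w : E := (W 0 : E)
  have hW' : t • w ≠ 0 := smul_ne_zero ht.1.ne' hW
  set u : E := (velocity (E := E) γ (Icc 0 l) 0 : E) with hu
  -- The geodesics of the variation start at `γ 0` with velocity `u + s w`, so their points at time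
  -- `t` are values of the exponential map along a line through `t u` with direction `t w`.
  have hexp : ∀ᶠ s : ℝ in 𝓝 0, expMap D (γ 0) (t • (u + s • w)) = (C s t).1 := by
    filter_upwards [hC.geodesic] with s hs
    exact expMap_smul hD ht.1.le hs.2 hs.1
  set A := mfderiv 𝓘(ℝ, E) 𝓘(ℝ, E) (expMap D (γ 0)) (t • u) with hA
  suffices hA0 : A (t • w) = 0 from hW' (hinj (hA0.trans (map_zero A).symm))
  -- If the exponential map is not differentiable at `t u`, its `mfderiv` is `0` by convention and
  -- kills `t w` as well.
  by_cases hd : MDifferentiableAt 𝓘(ℝ, E) 𝓘(ℝ, E) (expMap D (γ 0)) (t • u)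
  · have hline : HasDerivAt (fun s : ℝ => t • (u + s • w)) (t • w) 0 := by
      exact ((((hasDerivAt_id (0 : ℝ)).smul_const w).const_add u).const_smul t).congr_deriv (by simp)
    have h0 : expMap D (γ 0) (t • u) = (C 0 t).1 := by
      simpa using hexp.self_of_nhds
    have h0' : expMap D (γ 0) (t • u) = γ t := by rw [h0, hC.eq]
    have hx : expMap D (γ 0) (t • u) ∈ (chartAt E (γ t)).source := by
      rw [h0']; exact mem_chart_source E _
    have hdiff := HasMFDerivAt.comp (t • u) (hasMFDerivAt_extChartAt_chartCoord hx) hd.hasMFDerivAt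
    have h1 : HasDerivAt (fun s : ℝ => extChartAt 𝓘(ℝ, E) (γ t)
        (expMap D (γ 0) (t • (u + s • w))))
        (chartCoord (γ t) (expMap D (γ 0) (t • u)) (A (t • w))) 0 := by
      have h2 := hasMFDerivAt_iff_hasFDerivAt.1 hdiff
      have h3 : t • u = t • (u + (0 : ℝ) • w) := by simp
      rw [h3] at h2
      exact (h2.comp_hasDerivAt (0 : ℝ) hline).congr_deriv (by rw [← h3])
    -- The base component of the variation at time `t` moves with velocity `V t = 0`; comparison
    -- with the chain rule puts `t w` in the kernel.
    have h4 : HasDerivAt (fun s => extChartAt 𝓘(ℝ, E) (γ t) (C s t).1) 0 0 := by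
      have h5 := (hC.hasDerivAt (γ t) (mem_chart_source E _)).hasFDerivAt.fst.hasDerivAt
      simpa [chartPair, variationRep, hVt] using h5
    have h6 := h1.unique (h4.congr_of_eventuallyEq (hexp.mono fun s hs => by
      beta_reduce; rw [hs]))
    exact chartCoord_injective hx (h6.trans (map_zero _).symm)
  · rw [hA, mfderiv_zero_of_not_mdifferentiableAt hd]
    rfl

end ExponentialMap

/-! ### Fields and curvature in a parallel orthonormal frame -/

namespace PseudoHermitianStructure

set_option linter.unusedSectionVars false

variable {m : ℕ} {M : Type*} [TopologicalSpace M] [T2Space M]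
  [ChartedSpace (EuclideanSpace ℝ (Fin (2 * m + 1))) M] [IsManifold (𝓡 (2 * m + 1)) ∞ M]
  (P : PseudoHermitianStructure m M)
  {D : LinearConnection (EuclideanSpace ℝ (Fin (2 * m + 1))) M}
  (hD : P.IsTanakaWebster D) (hS : P.IsSasakian D)

local notation "𝔼" => EuclideanSpace ℝ (Fin (2 * m + 1))

lemma hasParallelTorsion (hD : P.IsTanakaWebster D) (hS : P.IsSasakian D) :
    HasParallelTorsion D := fun x₀ _ hq a b c =>
  (P.isSasakianModel hD hS x₀).sub_smul_Γ hq a b c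

section Pointwise

variable {x : M} {e : Fin (2 * m + 1) → TangentSpace (𝓡 (2 * m + 1)) x}

/-- The coordinates of a tangent vector with respect to a family of tangent vectors. -/
def websterCoord (x : M) (e : Fin (2 * m + 1) → TangentSpace (𝓡 (2 * m + 1)) x)
    (v : TangentSpace (𝓡 (2 * m + 1)) x) : 𝔼 :=
  WithLp.toLp 2 fun i => P.websterMetric x v (e i)

/-- The tangent vector with given coordinates. -/
def ofCoord (x : M) (e : Fin (2 * m + 1) → TangentSpace (𝓡 (2 * m + 1)) x) (z : 𝔼) :
    TangentSpace (𝓡 (2 * m + 1)) x := ∑ i, z i • e i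

/-- The curvature operator `v ↦ R(v, T)T` in coordinates. -/
def curvatureOperator (D : LinearConnection (EuclideanSpace ℝ (Fin (2 * m + 1))) M) (x : M)
    (e : Fin (2 * m + 1) → TangentSpace (𝓡 (2 * m + 1)) x) (T : TangentSpace (𝓡 (2 * m + 1)) x) :
    𝔼 →L[ℝ] 𝔼 :=
  LinearMap.toContinuousLinearMap (Matrix.toEuclideanLin (Matrix.of fun i j =>
    P.websterMetric x (curvatureTensor D x (e j) T T) (e i)))

lemma ofCoord_zero : ofCoord x e 0 = 0 := by simp [ofCoord]

include hD hS

lemma ofCoord_websterCoord (he : P.IsWebsterOrthonormal x e)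
    (v : TangentSpace (𝓡 (2 * m + 1)) x) : ofCoord x e (P.websterCoord x e v) = v :=
  he.sum_smul P hD hS v

lemma inner_websterCoord (he : P.IsWebsterOrthonormal x e)
    (u v : TangentSpace (𝓡 (2 * m + 1)) x) :
    inner ℝ (P.websterCoord x e u) (P.websterCoord x e v) = P.websterMetric x u v := by
  have h : P.websterForm (D := D) x u (∑ i, P.websterMetric x v (e i) • e i) =
      ∑ i, P.websterMetric x v (e i) * P.websterMetric x u (e i) := by
    rw [map_sum]
    exact Finset.sum_congr rfl fun i _ => by
      rw [map_smul, P.websterForm_apply hD hS, smul_eq_mul]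
  rw [he.sum_smul P hD hS, P.websterForm_apply hD hS] at h
  rw [h, PiLp.inner_apply]
  rfl

lemma websterCoord_ofCoord (he : P.IsWebsterOrthonormal x e) (z : 𝔼) :
    P.websterCoord x e (ofCoord x e z) = z := by
  ext j
  have h : ∀ i, P.websterForm (D := D) x (e i) (e j) = if i = j then 1 else 0 := fun i => by
    rw [P.websterForm_apply hD hS, he]
  simp only [websterCoord, ofCoord, ← P.websterForm_apply hD hS, map_sum, map_smul,
    LinearMap.sum_apply, LinearMap.smul_apply, h]
  simp

lemma curvatureOperator_websterCoord (he : P.IsWebsterOrthonormal x e)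
    (T v : TangentSpace (𝓡 (2 * m + 1)) x) :
    P.curvatureOperator D x e T (P.websterCoord x e v) =
      P.websterCoord x e (curvatureTensor D x v T T) := by
  ext i
  conv_rhs => rw [← he.sum_smul P hD hS v, P.curvatureTensor_sum_smul hD hS]
  simp only [websterCoord, ← P.websterForm_apply hD hS, map_sum, map_smul,
    LinearMap.sum_apply, LinearMap.smul_apply]
  simp [curvatureOperator, Matrix.toLpLin_apply, Matrix.mulVec, dotProduct,
    P.websterForm_apply hD hS, mul_comm]

lemma curvatureOperator_symm (he : P.IsWebsterOrthonormal x e)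
    (T : TangentSpace (𝓡 (2 * m + 1)) x) (u v : 𝔼) :
    inner ℝ (P.curvatureOperator D x e T u) v = inner ℝ u (P.curvatureOperator D x e T v) := by
  rw [← P.websterCoord_ofCoord hD hS he u, ← P.websterCoord_ofCoord hD hS he v,
    P.curvatureOperator_websterCoord hD hS he, P.curvatureOperator_websterCoord hD hS he,
    P.inner_websterCoord hD hS he, P.inner_websterCoord hD hS he, P.curvatureTensor_symm hD hS,
    P.websterMetric_comm hD hS]

end Pointwise

section AlongGeodesic

variable {γ : ℝ → M} {T X : ∀ t, TangentSpace (𝓡 (2 * m + 1)) (γ t)} {S : Set ℝ} {t : ℝ} {x₀ : M}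
  {e : Fin (2 * m + 1) → ∀ t, TangentSpace (𝓡 (2 * m + 1)) (γ t)}

include hD hS in
lemma hasDerivWithinAt_websterCoord (hγ : IsGeodesicCurve D γ T S)
    (he : ∀ i, IsParallelAlong D γ T S (e i)) (ht : t ∈ S)
    (hx : γ t ∈ (chartAt 𝔼 x₀).source) {W : TangentSpace (𝓡 (2 * m + 1)) (γ t)}
    (hX : HasCovDerivWithinAt D x₀ γ S X t (T t) W) :
    HasDerivWithinAt (fun s => P.websterCoord (γ s) (fun i => e i s) (X s))
      (P.websterCoord (γ t) (fun i => e i t) W) S t := by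
  have h1 : HasDerivWithinAt (fun s i => P.websterMetric (γ s) (X s) (e i s))
      (fun i => P.websterMetric (γ t) W (e i t)) S t := by
    refine hasDerivWithinAt_pi.2 fun i => ?_
    refine (P.hasDerivWithinAt_websterMetric hD hS (hγ.velocity t ht) hx hX
      (he i t ht x₀ hx)).congr_deriv ?_
    rw [← P.websterForm_apply hD hS _ 0, map_zero, add_zero]
  exact (PiLp.continuousLinearEquiv 2 ℝ fun _ : Fin (2 * m + 1) => ℝ).symm.hasFDerivAt
    |>.comp_hasDerivWithinAt t h1

lemma hasCovDerivWithinAt_ofCoord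
    (he : ∀ i, IsParallelAlong D γ T S (e i)) (ht : t ∈ S)
    (hx : γ t ∈ (chartAt 𝔼 x₀).source) {z : ℝ → 𝔼} {z' : 𝔼} (hz : HasDerivWithinAt z z' S t) :
    HasCovDerivWithinAt D x₀ γ S (fun s => ofCoord (γ s) (fun i => e i s) (z s)) t (T t)
      (ofCoord (γ t) (fun i => e i t) z') := by
  have h1 := HasCovDerivWithinAt.sum_smul (D := D) (x₀ := x₀) (f := fun i s => z s i)
    (f' := fun i => z' i) (fun i => by
      have := (EuclideanSpace.proj (𝕜 := ℝ) i : 𝔼 →L[ℝ] ℝ).hasFDerivAt.comp_hasDerivWithinAt t hz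
      exact this) fun i => he i t ht x₀ hx
  simpa [ofCoord] using h1

include hD hS in
lemma continuousOn_curvatureOperator (hγ : IsGeodesicCurve D γ T S)
    (he : ∀ i, IsParallelAlong D γ T S (e i)) :
    ContinuousOn (fun t => P.curvatureOperator D (γ t) (fun i => e i t) (T t)) S := by
  refine continuousOn_clm_apply.2 fun z t ht => ?_
  have hx := mem_chart_source 𝔼 (γ t)
  have h1 : ContinuousWithinAt (fun s i => ∑ j, P.websterMetric (γ s)
      (curvatureTensor D (γ s) (e j s) (T s) (T s)) (e i s) * z j) S t := by
    refine continuousWithinAt_pi.2 fun i => ?_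
    refine tendsto_finsetSum _ fun j _ => ?_
    exact (P.continuousWithinAt_curvature hD hS (hγ.velocity t ht) hx (he j t ht _ hx)
      (he i t ht _ hx) (hγ.parallel t ht _ hx)).mul continuousWithinAt_const
  have h2 := (PiLp.continuous_toLp 2 fun _ : Fin (2 * m + 1) => ℝ).continuousAt.comp_continuousWithinAt
    h1
  exact h2

end AlongGeodesic

end PseudoHermitianStructure

/-! ### Regularity of fields along a geodesic -/

section FieldRegularity

set_option linter.unusedSectionVars false

variable {E : Type*} [NormedAddCommGroup E] [NormedSpace ℝ E] [FiniteDimensional ℝ E]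
  {M : Type*} [TopologicalSpace M] [ChartedSpace E M] [IsManifold 𝓘(ℝ, E) ∞ M]
  {D : LinearConnection E M} {γ : ℝ → M} {T X : ∀ t, TangentSpace 𝓘(ℝ, E) (γ t)} {S : Set ℝ} {t : ℝ}

lemma IsContDiffFieldAlong.contDiffWithinAt {n : ℕ∞ω} (hX : IsContDiffFieldAlong n γ S X)
    (ht : t ∈ S) :
    ContDiffWithinAt ℝ n (fun s => extChartAt 𝓘(ℝ, E) (γ t) (γ s)) S t ∧
      ContDiffWithinAt ℝ n (fun s => chartCoord (γ t) (γ s) (X s)) S t := by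
  obtain ⟨h1, h2⟩ := contMDiffWithinAt_totalSpace.1 (hX t ht)
  have hsrc : ∀ᶠ s in 𝓝[S] t, γ s ∈ (chartAt E (γ t)).source :=
    h1.continuousWithinAt ((chartAt E (γ t)).open_source.mem_nhds (mem_chart_source E _))
  refine ⟨contMDiffWithinAt_iff_contDiffWithinAt.1 (contMDiffWithinAt_iff_target.1 h1).2, ?_⟩
  refine (contMDiffWithinAt_iff_contDiffWithinAt.1 h2).congr_of_eventuallyEq ?_ ?_
  · filter_upwards [hsrc] with s hs
    exact (trivializationAt_snd_eq_chartCoord hs _).symm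
  · exact (trivializationAt_snd_eq_chartCoord (mem_chart_source E _) _).symm

lemma IsContDiffFieldAlong.mdifferentiableWithinAt {n : ℕ∞ω} (hX : IsContDiffFieldAlong n γ S X)
    (hn : n ≠ 0) (ht : t ∈ S) : MDifferentiableWithinAt 𝓘(ℝ, ℝ) (𝓘(ℝ, E).prod 𝓘(ℝ, E))
      (fun t => (⟨γ t, X t⟩ : TangentBundle 𝓘(ℝ, E) M)) S t :=
  (hX t ht).mdifferentiableWithinAt hn

/-- Parallel fields are continuously differentiable. -/
lemma IsParallelAlong.contDiffWithinAt [T2Space M] (hD : D.ContMDiffCovariantDerivative ∞)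
    (hγ : IsGeodesicCurve D γ T S) (hX : IsParallelAlong D γ T S X) (ht : t ∈ S) :
    ContDiffWithinAt ℝ 1 (fun s => chartCoord (γ t) (γ s) (X s)) S t := by
  have hsrc : {s | γ s ∈ (chartAt E (γ t)).source} ∈ 𝓝[S] t :=
    (hγ.velocity t ht).eventually_mem (mem_chart_source E _)
  have hXd : ∀ s ∈ S, γ s ∈ (chartAt E (γ t)).source →
      HasDerivWithinAt (fun s => chartCoord (γ t) (γ s) (X s))
        (-christoffel D (γ t) (extChartAt 𝓘(ℝ, E) (γ t) (γ s)) (chartCoord (γ t) (γ s) (T s))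
          (chartCoord (γ t) (γ s) (X s))) S s := fun s hs hx => by
    have := hX s hs (γ t) hx
    unfold HasCovDerivWithinAt at this
    rwa [map_zero, zero_sub] at this
  have h := contDiffWithinAt_succ_of_hasDerivWithinAt 0 ht
    (f := fun s => chartCoord (γ t) (γ s) (X s))
    (g := fun s => -christoffel D (γ t) (extChartAt 𝓘(ℝ, E) (γ t) (γ s))
      (chartCoord (γ t) (γ s) (T s)) (chartCoord (γ t) (γ s) (X s))) ?_ ?_
  · simpa using h
  · filter_upwards [hsrc, self_mem_nhdsWithin] with s hs hs' using hXd s hs' hs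
  · refine (contDiffWithinAt_zero ht).2 ⟨_, hsrc, fun s hs => ?_⟩
    have hq := ((hγ.velocity s hs.1).hasDerivWithinAt hs.2).continuousWithinAt
    have hT := HasDerivWithinAt.continuousWithinAt (hγ.parallel s hs.1 (γ t) hs.2)
    have hΓ := ((contDiffOn_christoffel hD (γ t)).continuousOn.continuousAt
      ((isOpen_extChartAt_target (γ t)).mem_nhds ((extChartAt 𝓘(ℝ, E) (γ t)).map_source
        (by simpa using hs.2)))).comp_continuousWithinAt
        (f := fun s => extChartAt 𝓘(ℝ, E) (γ t) (γ s)) hq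
    exact (((hΓ.clm_apply hT).clm_apply (hXd s hs.1 hs.2).continuousWithinAt).neg).mono
      inter_subset_left

lemma hasCovDerivWithinAt_of_differentiableWithinAt {x₀ : M} (hS : UniqueDiffWithinAt ℝ S t)
    {v : TangentSpace 𝓘(ℝ, E) (γ t)} (hγ : HasVelocityWithinAt γ S t v)
    (hx₀ : γ t ∈ (chartAt E x₀).source)
    (h : DifferentiableWithinAt ℝ (fun s => chartCoord x₀ (γ s) (X s)) S t) :
    HasCovDerivWithinAt D x₀ γ S X t v (covDerivAlong D γ S X t) := by
  have h4 : HasCovDerivWithinAt D x₀ γ S X t v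
      (coordField x₀ (derivWithin (fun s => chartCoord x₀ (γ s) (X s)) S t
        + christoffel D x₀ (extChartAt 𝓘(ℝ, E) x₀ (γ t))
      (chartCoord x₀ (γ t) v) (chartCoord x₀ (γ t) (X t))) (γ t)) := by
    unfold HasCovDerivWithinAt
    rw [chartCoord_coordField hx₀, add_sub_cancel_right]
    exact h.hasDerivWithinAt
  rwa [h4.covDerivAlong_eq hγ hx₀ hS]

set_option synthInstance.maxHeartbeats 200000 in
/-- The covariant derivative of a twice differentiable field is differentiable. -/
lemma IsContDiffFieldAlong.hasCovDerivWithinAt_covDerivAlong [T2Space M]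
    (hD : D.ContMDiffCovariantDerivative ∞) {a b : ℝ} (hab : a < b)
    (hγ : IsGeodesicCurve D γ T (Icc a b)) (hX : IsContDiffFieldAlong 2 γ (Icc a b) X)
    (ht : t ∈ Icc a b) :
    HasCovDerivWithinAt D (γ t) γ (Icc a b) (fun s => covDerivAlong D γ (Icc a b) X s) t (T t)
      (covDerivAlong D γ (Icc a b) (fun s => covDerivAlong D γ (Icc a b) X s) t) := by
  have hU := uniqueDiffOn_Icc hab
  have hx := mem_chart_source E (γ t)
  refine hasCovDerivWithinAt_of_differentiableWithinAt (hU t ht) (hγ.velocity t ht) hx ?_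
  have hX1 : ∀ s ∈ Icc a b, γ s ∈ (chartAt E (γ t)).source →
      HasDerivWithinAt (fun s => chartCoord (γ t) (γ s) (X s))
      (chartCoord (γ t) (γ s) (covDerivAlong D γ (Icc a b) X s) -
        christoffel D (γ t) (extChartAt 𝓘(ℝ, E) (γ t) (γ s)) (chartCoord (γ t) (γ s) (T s))
          (chartCoord (γ t) (γ s) (X s))) (Icc a b) s := fun s hs hxs => by
    have := (_root_.hasCovDerivWithinAt_covDerivAlong (D := D)
      (hX.mdifferentiableWithinAt (by simp) hs) (hU s hs) hxs).2
    rwa [hγ.velocity_eq hab hs] at this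
  -- The covariant derivative is the derivative of the components, which is `C¹` as the field is
  -- `C²`, plus a Christoffel term composed of differentiable factors.
  have hd2 : DifferentiableWithinAt ℝ
      (derivWithin (fun s => chartCoord (γ t) (γ s) (X s)) (Icc a b)) (Icc a b) t :=
    ((hX.contDiffWithinAt ht).2.derivWithin (m := 1) hU (by norm_num) ht).differentiableWithinAt (by simp)
  have hq : extChartAt 𝓘(ℝ, E) (γ t) (γ t) ∈ (extChartAt 𝓘(ℝ, E) (γ t)).target :=
    mem_extChartAt_target (γ t)
  have hΓd := IsSasakianModel.hasFDerivAt_of_contDiffOn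
    (isOpen_extChartAt_target (γ t)) (contDiffOn_christoffel hD (γ t)) hq
  have h3 := hasDerivWithinAt_clm_apply_apply (v := fun s => chartCoord (γ t) (γ s) (T s))
    (y := fun s => chartCoord (γ t) (γ s) (X s)) (hasDerivWithinAt_comp_curve hΓd
      ((hγ.velocity t ht).hasDerivWithinAt hx)) (hγ.parallel t ht _ hx) (hX1 t ht hx)
  refine (hd2.add h3.differentiableWithinAt).congr_of_eventuallyEq ?_ ?_
  · filter_upwards [(hγ.velocity t ht).eventually_mem hx, self_mem_nhdsWithin] with s hs hs'
    simp only [Pi.add_apply, (hX1 s hs' hs).derivWithin (hU s hs'), sub_add_cancel]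
  · simp only [Pi.add_apply, (hX1 t ht hx).derivWithin (hU t ht), sub_add_cancel]

end FieldRegularity

section CovariantDerivativeAlgebra

set_option linter.unusedSectionVars false

variable {E : Type*} [NormedAddCommGroup E] [NormedSpace ℝ E] [FiniteDimensional ℝ E]
  {M : Type*} [TopologicalSpace M] [ChartedSpace E M] [IsManifold 𝓘(ℝ, E) ∞ M]
  {D : LinearConnection E M} {γ : ℝ → M} {S : Set ℝ} {t : ℝ} {x₀ : M}

lemma HasCovDerivWithinAt.add {X Y : ∀ t, TangentSpace 𝓘(ℝ, E) (γ t)}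
    {v W Z : TangentSpace 𝓘(ℝ, E) (γ t)} (hX : HasCovDerivWithinAt D x₀ γ S X t v W)
    (hY : HasCovDerivWithinAt D x₀ γ S Y t v Z) :
    HasCovDerivWithinAt D x₀ γ S (fun s => X s + Y s) t v (W + Z) := by
  have h := HasDerivWithinAt.add hX hY
  unfold HasCovDerivWithinAt
  simp only [map_add]
  refine h.congr_deriv ?_
  abel

lemma HasCovDerivWithinAt.smul {X : ∀ t, TangentSpace 𝓘(ℝ, E) (γ t)}
    {v W : TangentSpace 𝓘(ℝ, E) (γ t)} {f : ℝ → ℝ} {f' : ℝ} (hf : HasDerivWithinAt f f' S t)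
    (hX : HasCovDerivWithinAt D x₀ γ S X t v W) :
    HasCovDerivWithinAt D x₀ γ S (fun s => f s • X s) t v (f' • X t + f t • W) := by
  simpa using HasCovDerivWithinAt.sum_smul (ι := Unit) (fun _ => hf) (fun _ => hX)

end CovariantDerivativeAlgebra

/-! ### Horizontal Jacobi fields in a parallel frame -/

namespace PseudoHermitianStructure

set_option linter.unusedSectionVars false

variable {m : ℕ} {M : Type*} [TopologicalSpace M] [T2Space M]
  [ChartedSpace (EuclideanSpace ℝ (Fin (2 * m + 1))) M] [IsManifold (𝓡 (2 * m + 1)) ∞ M]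
  (P : PseudoHermitianStructure m M)
  {D : LinearConnection (EuclideanSpace ℝ (Fin (2 * m + 1))) M}
  (hD : P.IsTanakaWebster D) (hS : P.IsSasakian D)
  {γ : ℝ → M} {T X Y : ∀ t, TangentSpace (𝓡 (2 * m + 1)) (γ t)} {S : Set ℝ} {t : ℝ} {x₀ : M}
  {e : Fin (2 * m + 1) → ∀ t, TangentSpace (𝓡 (2 * m + 1)) (γ t)}

local notation "𝔼" => EuclideanSpace ℝ (Fin (2 * m + 1))

include hD hS

lemma websterCoord_neg {x : M} (e : Fin (2 * m + 1) → TangentSpace (𝓡 (2 * m + 1)) x)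
    (v : TangentSpace (𝓡 (2 * m + 1)) x) :
    P.websterCoord x e (-v) = -P.websterCoord x e v := by
  ext i
  simp [websterCoord, ← P.websterForm_apply hD hS]

lemma contDiffOn_websterCoord (hγ : IsGeodesicCurve D γ T S)
    (he : ∀ i, IsParallelAlong D γ T S (e i)) (hX : IsContDiffFieldAlong 1 γ S X) :
    ContDiffOn ℝ 1 (fun t => P.websterCoord (γ t) (fun i => e i t) (X t)) S := by
  intro t ht
  obtain ⟨h1, h2⟩ := hX.contDiffWithinAt ht
  have hx := mem_chart_source 𝔼 (γ t)
  have hq : extChartAt (𝓡 (2 * m + 1)) (γ t) (γ t) ∈ (extChartAt (𝓡 (2 * m + 1)) (γ t)).target :=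
    mem_extChartAt_target (γ t)
  have hg := (((P.isSasakianModel hD hS (γ t)).smooth_g.contDiffAt
    ((isOpen_extChartAt_target (γ t)).mem_nhds hq)).of_le
      (show (1 : ℕ∞ω) ≤ ∞ by simp)).comp_contDiffWithinAt t h1
  rw [contDiffWithinAt_euclidean]
  intro i
  refine ((hg.clm_apply h2).clm_apply
    ((he i).contDiffWithinAt hD.smooth hγ ht)).congr_of_eventuallyEq ?_ ?_
  · filter_upwards [(hγ.velocity t ht).eventually_mem hx] with s hs
    exact (P.metricRep_extChartAt hD hS hs _ _).symm
  · exact (P.metricRep_extChartAt hD hS hx _ _).symm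

/-- The contact form is the Webster product with the parallel field `ξ`. -/
lemma hasDerivWithinAt_theta {v W : TangentSpace (𝓡 (2 * m + 1)) (γ t)}
    (hγ : HasVelocityWithinAt (E := EuclideanSpace ℝ (Fin (2 * m + 1))) γ S t v)
    (hx : γ t ∈ (chartAt 𝔼 x₀).source) (hX : HasCovDerivWithinAt D x₀ γ S X t v W) :
    HasDerivWithinAt (fun s => P.θ (γ s) (X s)) (P.θ (γ t) W) S t := by
  have h := P.hasDerivWithinAt_websterMetric hD hS hγ hx hX (P.hasCovDerivWithinAt_xi hD hS hγ hx)
  simp only [P.websterMetric_xi_right hD hS] at h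
  refine h.congr_deriv ?_
  rw [← P.websterForm_apply hD hS, map_zero, add_zero]

lemma hasCovDerivWithinAt_smul_xi {v : TangentSpace (𝓡 (2 * m + 1)) (γ t)}
    (hγ : HasVelocityWithinAt (E := EuclideanSpace ℝ (Fin (2 * m + 1))) γ S t v)
    (hx : γ t ∈ (chartAt 𝔼 x₀).source) {f : ℝ → ℝ} {f' : ℝ} (hf : HasDerivWithinAt f f' S t) :
    HasCovDerivWithinAt D x₀ γ S (fun s => f s • P.ξ (γ s)) t v (f' • P.ξ (γ t)) := by
  have h := HasCovDerivWithinAt.smul hf (P.hasCovDerivWithinAt_xi hD hS hγ hx)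
  rwa [smul_zero, add_zero] at h

/-- The function differentiated is the coefficient along `ξ` of the torsion `T(γ', X)`. As `γ'`, `J`
and the metric are parallel, only `X` is differentiated. -/
lemma hasDerivWithinAt_websterMetric_J (hγ : IsGeodesicCurve D γ T S) (ht : t ∈ S)
    (hx : γ t ∈ (chartAt 𝔼 x₀).source) {W : TangentSpace (𝓡 (2 * m + 1)) (γ t)}
    (hX : HasCovDerivWithinAt D x₀ γ S X t (T t) W) :
    HasDerivWithinAt (fun s => -2 * P.websterMetric (γ s) (T s) (P.J (γ s) (X s)))
      (-2 * P.websterMetric (γ t) (T t) (P.J (γ t) W)) S t := by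
  have h := P.hasDerivWithinAt_websterMetric hD hS (hγ.velocity t ht) hx (hγ.parallel t ht _ hx)
    (P.hasCovDerivWithinAt_J hD hS (hγ.velocity t ht) hx hX)
  refine (h.const_mul (-2)).congr_deriv ?_
  rw [← P.websterForm_apply hD hS 0, map_zero, LinearMap.zero_apply, zero_add]

/-- The Jacobi equation of a horizontal field in a parallel orthonormal frame. -/
lemma hasDerivWithinAt_of_isJacobiField {l : ℝ} (hl : 0 < l) (hγ : IsGeodesicOn D γ (Icc 0 l))
    (he : ∀ i, IsParallelAlong D γ (velocity γ (Icc 0 l)) (Icc 0 l) (e i))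
    (ho : ∀ t ∈ Icc 0 l, P.IsWebsterOrthonormal (γ t) fun i => e i t)
    (hY : IsJacobiField D γ l Y) (hYh : ∀ t ∈ Icc 0 l, P.θ (γ t) (Y t) = 0) (ht : t ∈ Icc 0 l) :
    HasDerivWithinAt (fun s => P.websterCoord (γ s) (fun i => e i s) (Y s))
      (P.websterCoord (γ t) (fun i => e i t) (covDerivAlong D γ (Icc 0 l) Y t)) (Icc 0 l) t ∧
    HasDerivWithinAt (fun s => P.websterCoord (γ s) (fun i => e i s)
        (covDerivAlong D γ (Icc 0 l) Y s))
      (-(P.curvatureOperator D (γ t) (fun i => e i t) (velocity γ (Icc 0 l) t)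
        (P.websterCoord (γ t) (fun i => e i t) (Y t)))) (Icc 0 l) t := by
  have hc := hγ.isGeodesicCurve hl
  have hU := uniqueDiffOn_Icc hl
  have h1 : ∀ s ∈ Icc 0 l, HasCovDerivWithinAt D (γ s) γ (Icc 0 l) Y s (velocity γ (Icc 0 l) s)
      (covDerivAlong D γ (Icc 0 l) Y s) := fun s hs =>
    (hasCovDerivWithinAt_covDerivAlong (hY.contDiff.mdifferentiableWithinAt (by simp) hs)
      (hU s hs) (mem_chart_source 𝔼 _)).2
  have h2 := hY.contDiff.hasCovDerivWithinAt_covDerivAlong hD.smooth hl hc ht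
  -- Differentiating `θ(Y) = 0` twice shows that the first and second covariant derivatives of `Y`
  -- are horizontal.
  have hθ1 : ∀ s ∈ Icc 0 l, P.θ (γ s) (covDerivAlong D γ (Icc 0 l) Y s) = 0 := fun s hs =>
    (hU s hs).eq_deriv _ (P.hasDerivWithinAt_theta hD hS (hc.velocity s hs)
      (mem_chart_source 𝔼 _) (h1 s hs)) ((hasDerivWithinAt_const s _ (0 : ℝ)).congr hYh (hYh s hs))
  have hx := mem_chart_source 𝔼 (γ t)
  have hθ2 := (hU t ht).eq_deriv _ (P.hasDerivWithinAt_theta hD hS (hc.velocity t ht) hx h2)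
    ((hasDerivWithinAt_const t _ (0 : ℝ)).congr hθ1 (hθ1 t ht))
  have htor := (P.hasCovDerivWithinAt_smul_xi hD hS (hc.velocity t ht) hx
    (P.hasDerivWithinAt_websterMetric_J hD hS hc ht hx (h1 t ht))).covDerivAlong_eq
      (hc.velocity t ht) hx (hU t ht)
  have heq := hY.jacobi_eq t ht
  simp only [P.torsion_eq_websterMetric hD hS] at heq
  rw [htor] at heq
  -- Applying `θ` to the Jacobi equation kills the second derivative and the curvature term. The
  -- torsion term, a multiple of `ξ`, must therefore vanish, and `Y'' = -R(Y, γ')γ'` remains.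
  have h3 := hθ2
  rw [heq, map_add, P.theta_curvatureTensor hD hS, map_smul, P.θ_ξ, zero_add, smul_eq_mul,
    mul_one] at h3
  rw [h3, zero_smul, add_zero, P.curvatureTensor_antisymm hD hS] at heq
  refine ⟨P.hasDerivWithinAt_websterCoord hD hS hc he ht hx (h1 t ht), ?_⟩
  refine (P.hasDerivWithinAt_websterCoord hD hS hc he ht hx h2).congr_deriv ?_
  rw [heq, P.websterCoord_neg hD hS, P.curvatureOperator_websterCoord hD hS (ho t ht)]

end PseudoHermitianStructure

/-- A point of an interval which is not a point of the subdivision lies inside a piece. -/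
lemma exists_mem_Ioo_of_subdivision {n : ℕ} {a : Fin (n + 1) → ℝ} {t : ℝ} (h0 : a 0 < t)
    (hl : t < a (Fin.last n)) (ht : t ∉ range a) :
    ∃ i : Fin n, t ∈ Ioo (a i.castSucc) (a i.succ) := by
  by_contra hcon
  push Not at hcon
  have h : ∀ i, a i < t := fun i => by
    induction i using Fin.induction with
    | zero => exact h0
    | succ i ih =>
      exact lt_of_le_of_ne (not_lt.1 fun h => hcon i ⟨ih, h⟩) fun h => ht ⟨_, h⟩
  exact (h (Fin.last n)).not_gt hl

/-! ### From frame solutions to conjugate points, and the index form in the frame -/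

namespace PseudoHermitianStructure

set_option linter.unusedSectionVars false

variable {m : ℕ} {M : Type*} [TopologicalSpace M] [T2Space M]
  [ChartedSpace (EuclideanSpace ℝ (Fin (2 * m + 1))) M] [IsManifold (𝓡 (2 * m + 1)) ∞ M]
  (P : PseudoHermitianStructure m M)
  {D : LinearConnection (EuclideanSpace ℝ (Fin (2 * m + 1))) M}
  (hD : P.IsTanakaWebster D) (hS : P.IsSasakian D)
  {γ : ℝ → M} {X : ∀ t, TangentSpace (𝓡 (2 * m + 1)) (γ t)} {t l : ℝ}
  {e : Fin (2 * m + 1) → ∀ t, TangentSpace (𝓡 (2 * m + 1)) (γ t)}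

local notation "𝔼" => EuclideanSpace ℝ (Fin (2 * m + 1))

include hD hS

/-- A solution of the Jacobi equation of the frame which vanishes at two times, and is not
identically zero, gives a conjugate point. -/
lemma isConjugateAlong_of_frame_solution (hγ : IsGeodesicOn D γ (Icc 0 l))
    (he : ∀ i, IsParallelAlong D γ (velocity γ (Icc 0 l)) (Icc 0 l) (e i))
    (ho : ∀ t ∈ Icc 0 l, P.IsWebsterOrthonormal (γ t) fun i => e i t) {z w : ℝ → 𝔼}
    (hz : ∀ t ∈ Icc 0 l, HasDerivWithinAt z (w t) (Icc 0 l) t)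
    (hw : ∀ t ∈ Icc 0 l, HasDerivWithinAt w (-(P.curvatureOperator D (γ t) (fun i => e i t)
      (velocity γ (Icc 0 l) t) (z t))) (Icc 0 l) t)
    (hz0 : z 0 = 0) (hw0 : w 0 ≠ 0) (ht : t ∈ Ioc 0 l) (hzt : z t = 0) :
    IsConjugateAlong D γ l t := by
  have hl : 0 < l := ht.1.trans_le ht.2
  have h0I : (0 : ℝ) ∈ Icc 0 l := ⟨le_rfl, hl.le⟩
  have htI : t ∈ Icc 0 l := ⟨ht.1.le, ht.2⟩
  have hc := hγ.isGeodesicCurve hl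
  set T := velocity (E := 𝔼) γ (Icc 0 l)
  set Z : ∀ t, TangentSpace (𝓡 (2 * m + 1)) (γ t) := fun s => ofCoord (γ s) (fun i => e i s) (z s)
    with hZdef
  set W : ∀ t, TangentSpace (𝓡 (2 * m + 1)) (γ t) := fun s => ofCoord (γ s) (fun i => e i s) (w s)
    with hWdef
  have hZ : ∀ s ∈ Icc 0 l, ∀ x₀, γ s ∈ (chartAt 𝔼 x₀).source →
      HasCovDerivWithinAt D x₀ γ (Icc 0 l) Z s (T s) (W s) := fun s hs x₀ hx =>
    hasCovDerivWithinAt_ofCoord he hs hx (hz s hs)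
  have hW : ∀ s ∈ Icc 0 l, ∀ x₀, γ s ∈ (chartAt 𝔼 x₀).source →
      HasCovDerivWithinAt D x₀ γ (Icc 0 l) W s (T s) (curvatureTensor D (γ s) (T s) (Z s) (T s)) := by
    intro s hs x₀ hx
    have h := hasCovDerivWithinAt_ofCoord he hs hx (hw s hs)
    convert h using 1
    rw [← P.websterCoord_ofCoord hD hS (ho s hs) (z s),
      P.curvatureOperator_websterCoord hD hS (ho s hs), ← P.websterCoord_neg hD hS,
      P.ofCoord_websterCoord hD hS (ho s hs), ← P.curvatureTensor_antisymm hD hS]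
  have hZ0 : Z 0 = 0 := by simp only [hZdef, hz0, ofCoord_zero]
  have hZt : Z t = 0 := by simp only [hZdef, hzt, ofCoord_zero]
  have hW0 : W 0 ≠ 0 := fun h => hw0 (by
    rw [← P.websterCoord_ofCoord hD hS (ho 0 h0I) (w 0)]
    change P.websterCoord (γ 0) _ (W 0) = 0
    rw [h, ← ofCoord_zero (e := fun i => e i 0), P.websterCoord_ofCoord hD hS (ho 0 h0I)])
  have hθW : ∀ s ∈ Icc 0 l, P.θ (γ s) (W s) = P.θ (γ 0) (W 0) := by
    have hd : ∀ s ∈ Icc 0 l, HasDerivWithinAt (fun s => P.θ (γ s) (W s)) 0 (Icc 0 l) s :=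
      fun s hs => by
        have hx := mem_chart_source 𝔼 (γ s)
        have := P.hasDerivWithinAt_theta hD hS (hc.velocity s hs) hx (hW s hs _ hx)
        rwa [P.theta_curvatureTensor hD hS] at this
    exact constant_of_has_deriv_right_zero (fun s hs => (hd s hs).continuousWithinAt)
      fun s hs => (hd s ⟨hs.1, hs.2.le⟩).Ici_of_Icc hs
  -- As the curvature is horizontal, `θ(W)` is constant and `θ(Z)` is linear in time. Vanishing at
  -- the positive time `t` forces the slope `θ(W 0)` to be zero.
  have hθ0 : P.θ (γ 0) (W 0) = 0 := by
    have hd : ∀ s ∈ Icc 0 l, HasDerivWithinAt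
        (fun s => P.θ (γ s) (Z s) - s * P.θ (γ 0) (W 0)) 0 (Icc 0 l) s := fun s hs => by
      have hx := mem_chart_source 𝔼 (γ s)
      refine ((P.hasDerivWithinAt_theta hD hS (hc.velocity s hs) hx (hZ s hs _ hx)).sub
        ((hasDerivWithinAt_id s _).mul_const _)).congr_deriv ?_
      rw [hθW s hs]; ring
    have h := constant_of_has_deriv_right_zero (fun s hs => (hd s hs).continuousWithinAt)
      (fun s hs => (hd s ⟨hs.1, hs.2.le⟩).Ici_of_Icc hs) t htI
    simp only [hZ0, hZt, map_zero, zero_mul, sub_zero, zero_sub, neg_eq_zero, mul_eq_zero] at h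
    exact h.resolve_left ht.1.ne'
  -- `f` is the coefficient of `T(γ', Z)` along `ξ`. Adding `h ξ` with `h' = f - c` to `Z` supplies
  -- the missing torsion term `f' ξ = T(γ', W)`, while `R(γ', ξ)γ' = 0` leaves the curvature term
  -- unchanged.
  set f : ℝ → ℝ := fun s => -2 * P.websterMetric (γ s) (T s) (P.J (γ s) (Z s)) with hf
  have hfd : ∀ s ∈ Icc 0 l, HasDerivWithinAt f
      (-2 * P.websterMetric (γ s) (T s) (P.J (γ s) (W s))) (Icc 0 l) s := fun s hs =>
    P.hasDerivWithinAt_websterMetric_J hD hS hc hs (mem_chart_source 𝔼 _)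
      (hZ s hs _ (mem_chart_source 𝔼 _))
  -- An antiderivative of `f`, as the solution of an equation whose right side does not involve the
  -- unknown.
  obtain ⟨α, hα0, hα⟩ := exists_solution_of_lipschitz (f := fun s _ => f s) (K := 0) hl.le
    (fun s _ => LipschitzWith.const _)
    (fun _ s hs => (hfd s hs).continuousWithinAt) 0
  -- The free constant of integration is used to make the vertical correction `α s - s c` vanish at
  -- time `t` as well as at `0`.
  set c := α t / t with hcdef
  refine hγ.isConjugateAlong hD.smooth (P.hasParallelTorsion hD hS)
    (V := fun s => Z s + (α s - s * c) • P.ξ (γ s)) (W := fun s => W s + (f s - c) • P.ξ (γ s))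
    ?_ ?_ ?_ ht ?_
  · intro s hs x₀ hx
    have hαd : HasDerivWithinAt (fun s => α s - s * c) (f s - c) (Icc 0 l) s :=
      ((hα s hs).sub ((hasDerivWithinAt_id s _).mul_const c)).congr_deriv (by rw [one_mul])
    refine ⟨(hZ s hs x₀ hx).add
      (P.hasCovDerivWithinAt_smul_xi hD hS (hc.velocity s hs) hx hαd), ?_⟩
    have h := (hW s hs x₀ hx).add
      (P.hasCovDerivWithinAt_smul_xi hD hS (hc.velocity s hs) hx ((hfd s hs).sub_const c))
    convert h using 1
    congr 1
    · have h1 := P.curvatureTensor_sum_smul hD hS (x := γ s) Finset.univ ![1, α s - s * c]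
        ![Z s, P.ξ (γ s)] (T s) (T s)
      simp only [Fin.sum_univ_two, Matrix.cons_val_zero, Matrix.cons_val_one, one_smul,
        P.curvatureTensor_xi hD hS, smul_zero, add_zero] at h1
      rw [P.curvatureTensor_antisymm hD hS, h1, ← P.curvatureTensor_antisymm hD hS]
    · rw [P.torsion_eq_websterMetric hD hS, map_add, map_smul, P.J_ξ, smul_zero, add_zero]
  · simp [hZ0, hα0]
  -- The corrected field has initial derivative `W 0` plus a multiple of `ξ`. Because `W 0` is
  -- horizontal, this sum can vanish only if `W 0` does.
  · intro h
    have h1 := congrArg (P.θ (γ 0)) h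
    rw [map_add, map_smul, hθ0, P.θ_ξ, map_zero, zero_add, smul_eq_mul, mul_one] at h1
    rw [h1, zero_smul, add_zero] at h
    exact hW0 h
  · rw [hZt, hcdef, mul_div_cancel₀ _ ht.1.ne', sub_self, zero_smul, add_zero]

/-- In a parallel orthonormal frame covariant differentiation is differentiation of the components.
The integrands agree off the subdivision points, a finite and hence negligible set, where the
derivative of `X` need not exist. -/
lemma intervalIntegral_indexIntegrand (hl : 0 < l) (hγ : IsGeodesicOn D γ (Icc 0 l))
    (he : ∀ i, IsParallelAlong D γ (velocity γ (Icc 0 l)) (Icc 0 l) (e i))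
    (ho : ∀ t ∈ Icc 0 l, P.IsWebsterOrthonormal (γ t) fun i => e i t) {n : ℕ} {a : Fin (n + 1) → ℝ}
    (ha0 : a 0 = 0) (hal : a (Fin.last n) = l)
    (hX : ∀ i : Fin n, IsContDiffFieldAlong 1 γ (Icc (a i.castSucc) (a i.succ)) X) :
    ∫ t in (0 : ℝ)..l, indexIntegrand (fun t => P.curvatureOperator D (γ t) (fun i => e i t)
      (velocity γ (Icc 0 l) t)) (fun t => P.websterCoord (γ t) (fun i => e i t) (X t)) t =
    P.indexForm D γ l X := by
  have hc := hγ.isGeodesicCurve hl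
  have hU := uniqueDiffOn_Icc hl
  refine intervalIntegral.integral_congr_ae ?_
  filter_upwards [(finite_range a).countable.ae_notMem MeasureTheory.volume] with t hta ht
  rw [uIoc_of_le hl.le] at ht
  have htl : t ≠ l := fun h => hta ⟨_, hal.trans h.symm⟩
  have htl' : t < l := lt_of_le_of_ne ht.2 htl
  have htI : t ∈ Icc 0 l := ⟨ht.1.le, ht.2⟩
  obtain ⟨i, hi⟩ := exists_mem_Ioo_of_subdivision (by rw [ha0]; exact ht.1)
    (by rw [hal]; exact htl') hta
  have hx := mem_chart_source 𝔼 (γ t)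
  have hXd := (((hX i).mdifferentiableWithinAt one_ne_zero
    (Ioo_subset_Icc_self hi)).mdifferentiableAt (Icc_mem_nhds hi.1 hi.2)).mdifferentiableWithinAt
    (s := Icc 0 l)
  have h1 := (hasCovDerivWithinAt_covDerivAlong (D := D) hXd (hU t htI) hx).2
  have h2 := (P.hasDerivWithinAt_websterCoord hD hS hc he htI hx h1).hasDerivAt
    (Icc_mem_nhds ht.1 htl')
  rw [indexIntegrand, h2.deriv, P.inner_websterCoord hD hS (ho t htI),
    P.curvatureOperator_websterCoord hD hS (ho t htI), P.inner_websterCoord hD hS (ho t htI)]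

end PseudoHermitianStructure

end

/-! ### The index inequality -/

theorem theorem5p1 {m : ℕ} {M : Type*} [TopologicalSpace M] [T2Space M]
    [ChartedSpace (EuclideanSpace ℝ (Fin (2 * m + 1))) M] [IsManifold (𝓡 (2 * m + 1)) ∞ M]
    (P : PseudoHermitianStructure m M)
    (D : LinearConnection (EuclideanSpace ℝ (Fin (2 * m + 1))) M)
    (hD : P.IsTanakaWebster D) (hSasakian : P.IsSasakian D)
    (l : ℝ) (hl : 0 < l) (γ : ℝ → M) (hγ : IsGeodesicOn D γ (Icc 0 l))
    (hunit : ∀ t ∈ Icc 0 l,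
      P.websterMetric (γ t) (velocity γ (Icc 0 l) t) (velocity γ (Icc 0 l) t) = 1)
    (hconj : ∀ t ∈ Ioc 0 l, ¬ IsConjugateAlong D γ l t)
    (Y : ∀ t, TangentSpace (𝓡 (2 * m + 1)) (γ t)) (hY : IsJacobiField D γ l Y)
    (hYhor : ∀ t ∈ Icc 0 l, P.θ (γ t) (Y t) = 0) (hY0 : Y 0 = 0)
    (X : ∀ t, TangentSpace (𝓡 (2 * m + 1)) (γ t)) (hX : IsPiecewiseC1Along γ l X)
    (hX0 : X 0 = 0) (hXl : X l = Y l) :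
    P.indexForm D γ l Y ≤ P.indexForm D γ l X ∧
      (P.indexForm D γ l X = P.indexForm D γ l Y ↔ ∀ t ∈ Icc 0 l, X t = Y t) := by
  have hc := hγ.isGeodesicCurve hl
  obtain ⟨e, he, ho⟩ := P.exists_parallel_frame hD hSasakian hl.le hc
  set K : ℝ → EuclideanSpace ℝ (Fin (2 * m + 1)) →L[ℝ] EuclideanSpace ℝ (Fin (2 * m + 1)) :=
    fun t => P.curvatureOperator D (γ t) (fun i => e i t) (velocity γ (Icc 0 l) t)
  obtain ⟨A, B, hJ⟩ := exists_isJacobiTensor hl.le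
    (P.continuousOn_curvatureOperator hD hSasakian hc he)
    fun t ht u v => P.curvatureOperator_symm hD hSasakian (ho t ht) _ u v
  -- A nonzero `v` with `A(t) v = 0` would give the frame solution `A v`, with initial derivative
  -- `v`, and hence a conjugate point.
  have hinj : ∀ t ∈ Ioc 0 l, Function.Injective (A t) := by
    intro t ht
    rw [injective_iff_map_eq_zero]
    intro v hv
    by_contra hv0
    refine hconj t ht (P.isConjugateAlong_of_frame_solution hD hSasakian hγ he ho
      (z := fun s => A s v) (w := fun s => B s v) (fun s hs => ?_) (fun s hs => ?_) ?_ ?_ ht hv)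
    · simpa using (hJ.deriv_A s hs).clm_apply (hasDerivWithinAt_const s _ v)
    · simpa using (hJ.deriv_B s hs).clm_apply (hasDerivWithinAt_const s _ v)
    · simp [hJ.A_zero]
    · simpa [hJ.B_zero] using hv0
  have hYd := fun t ht => P.hasDerivWithinAt_of_isJacobiField hD hSasakian hl hγ he ho hY hYhor
    (t := t) ht
  have hz : ∀ t ∈ Icc 0 l, ∀ u v : TangentSpace (𝓡 (2 * m + 1)) (γ t),
      P.websterCoord (γ t) (fun i => e i t) u = P.websterCoord (γ t) (fun i => e i t) v ↔ u = v :=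
    fun t ht u v => ⟨fun h => by
      rw [← P.ofCoord_websterCoord hD hSasakian (ho t ht) u, h,
        P.ofCoord_websterCoord hD hSasakian (ho t ht)], fun h => by rw [h]⟩
  obtain ⟨n, a, ha, ha0, hal, hXa⟩ := hX
  have ha0' : ∀ i, 0 ≤ a i := fun i => ha0 ▸ ha.monotone (Fin.zero_le i)
  have hal' : ∀ i, a i ≤ l := fun i => hal ▸ ha.monotone (Fin.le_last i)
  have hsub : ∀ i : Fin n, Icc (a i.castSucc) (a i.succ) ⊆ Icc 0 l := fun i =>
    Icc_subset_Icc (ha0' _) (hal' _)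
  have key := hJ.index_comparison hinj (fun t ht => (hYd t ht).1) (fun t ht => (hYd t ht).2) hl
    ha ha0 hal (x := fun t => P.websterCoord (γ t) (fun i => e i t) (X t))
    (fun i => P.contDiffOn_websterCoord hD hSasakian (hc.mono (hsub i))
      (fun j t ht x₀ hx => (he j t (hsub i ht) x₀ hx).mono (hsub i)) (hXa i))
    (by rw [hX0, hY0]) (by rw [hXl])
  -- `Y` is regarded as piecewise `C¹` for the subdivision of `X`, so that both index forms are
  -- converted by the same lemma.
  have hYa : ∀ i : Fin n, IsContDiffFieldAlong 1 γ (Icc (a i.castSucc) (a i.succ)) Y := fun i =>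
    (ContMDiffOn.of_le hY.contDiff (by norm_num)).mono (hsub i)
  rw [P.intervalIntegral_indexIntegrand hD hSasakian hl hγ he ho ha0 hal hYa,
    P.intervalIntegral_indexIntegrand hD hSasakian hl hγ he ho ha0 hal hXa] at key
  exact ⟨key.1, key.2.trans (forall₂_congr fun t ht => hz t ht _ _)⟩
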